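/- Let $n\ge 1$ and let $\overline M^{n+1}$ be either a simply connected space form ($\mathbb R^{n+1}$, the unit sphere $\mathbb S^{n+1}$, or the real hyperbolic space $\mathbb H^{n+1}$ of curvature $-1$) or a rank-one symmetric space of noncompact type $\mathbb H_{\mathbb F}^m$ of real dimension $n+1$, where $\mathbb F$ is $\mathbb C$, the quaternions, or the octonions (with $m=2$ in the last case), with the metric normalized so that its sectional curvatures range in $[-1,-1/4]$ (in the case $m=1$ this means constant curvature $-1$). Let $\Gamma\subset\mathbb R^n$ be an open set containing the positive cone $\Gamma_+=\{k : k_i>0\ \forall i\}$ and let $W\in C^\infty(\Gamma)$ be a Weingarten function, i.e. $W$ is symmetric, homogeneous (of some real degree), nondecreasing in each variable, and positive on $\Gamma_+$. A $W$-flow $F:M^n\times[0,T)\to\overline M^{n+1}$, $0<T\le+\infty$, is a smooth family of immersions $F_t=F(\cdot,t)$ with smooth unit normals $N(\cdot,t)$ such that the principal curvatures $(k_1,\dots,k_n)$ of $F_t$ with respect to $N(\cdot,t)$ lie in $\Gamma$ and $\partial F/\partial t=W(k_1,\dots,k_n)\,N$. The function $W$ is odd if it has an extension to $\Gamma\cup(-\Gamma)$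 with $W(-k)=-W(k)$ for all $k\in\Gamma$. Let $M^n$ be a nonempty compact smooth manifold without boundary, $F:M\times[0,T)\to\overline M$ a $W$-flow, and suppose that $F_0(M)$ is contained in an open geodesic ball $B_R$ of radius $R>0$, where $R<\pi/2$ if $\overline M=\mathbb S^{n+1}$ (so that $B_R$ is convex and $\partial B_R$ is a strictly convex geodesic sphere). Assume that one of the following holds: (i) $W$ is odd; (ii) for every $t\in[0,T)$, $F_t$ is an embedding with the inward orientation, i.e. whenever $F_t(M)\subset B_R$, the normal $N(p,t)$ points, at every $p\in M$, into a connected component of $\overline M\setminus F_t(M)$ that is contained in $B_R$. Then there is a parallel $W$-flow $P:\mathbb S^n\times[0,T_R)\to\overline M$ with $P_0$ an embedding onto $\partial B_R$ with inward orientation, that is, a $W$-flow of the form $P_t(q)=\exp_{P_0(q)}(\varphi(t)N(q))$ with $\varphi\in C^\infty[0,T_R)$ and $\varphi(0)=0$, where $N$ is the inward unit normal of $P_0$ and $P_t$ is oriented by the velocities of the geodesics $s\mapsto\exp_{P_0(q)}(sN(q))$ at $s=\varphi(t)$, and which is maximal: it does not extend to such a flow on a longer interval. For every such maximal flow $P$,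 with collapsing time $T_R$, one has $$F_t(M)\cap P_t(\mathbb S^n)=\emptyset\quad\text{for all } t\in[0,T),\qquad\text{and}\qquad T\le T_R<\infty .$$ -/

import Mathlib

open Set Filter Topology
open scoped Manifold ContDiff Quaternion

noncomputable section

namespace WeingartenFlow

/-! ### Octonions -/

/-- The octonions, as pairs of quaternions with the Euclidean norm of `ℝ⁸`. -/
def Octonion : Type := WithLp 2 (ℍ[ℝ] × ℍ[ℝ])

namespace Octonion

instance : NormedAddCommGroup Octonion :=
  inferInstanceAs (NormedAddCommGroup (WithLp 2 (ℍ[ℝ] × ℍ[ℝ])))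

instance : InnerProductSpace ℝ Octonion :=
  inferInstanceAs (InnerProductSpace ℝ (WithLp 2 (ℍ[ℝ] × ℍ[ℝ])))

/-- The octonion with quaternionic components `a` and `b`. -/
def mk (a b : ℍ[ℝ]) : Octonion := WithLp.toLp 2 (a, b)

/-- First quaternionic component. -/
def left (x : Octonion) : ℍ[ℝ] := (WithLp.ofLp x).1

/-- Second quaternionic component. -/
def right (x : Octonion) : ℍ[ℝ] := (WithLp.ofLp x).2

/-- The Cayley-Dickson product `(a, b) (c, d) = (a c - d̄ b, d a + b c̄)`. -/
instance : Mul Octonion :=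
  ⟨fun x y => mk (x.left * y.left - star y.right * x.right)
    (y.right * x.left + x.right * star y.left)⟩

instance : One Octonion := ⟨mk 1 0⟩

/-- Octonionic conjugation `(a, b) ↦ (ā, -b)`. -/
instance : Star Octonion := ⟨fun x => mk (star x.left) (-x.right)⟩

end Octonion

/-! ### Space forms and hyperbolic spaces, as submanifolds of (pseudo-)Euclidean vector spaces -/

/-- A subset `carrier` of a real vector space `V` with a symmetric bilinear form. In the instances
below, `carrier` is an embedded submanifold on whose tangent spaces `form` is positive definite;
it carries the Riemannian metric induced by `form`. -/
structure Ambient where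
  V : Type
  [normedAddCommGroup : NormedAddCommGroup V]
  [normedSpace : NormedSpace ℝ V]
  form : LinearMap.BilinForm ℝ V
  carrier : Set V

attribute [instance] Ambient.normedAddCommGroup Ambient.normedSpace

/-- Euclidean space `ℝ^(n+1)`. -/
def euclidean (n : ℕ) : Ambient where
  V := EuclideanSpace ℝ (Fin (n + 1))
  form := innerₗ _
  carrier := univ

/-- The unit sphere `𝕊^(n+1)` in `ℝ^(n+2)`. -/
def sphere (n : ℕ) : Ambient where
  V := EuclideanSpace ℝ (Fin (n + 2))
  form := innerₗ _
  carrier := {x | ‖x‖ = 1}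

/-- The signature `(-1, 1, …, 1)`. -/
def signature {k : ℕ} (i : Fin (k + 1)) : ℝ := if i = 0 then -1 else 1

/-- The Lorentzian form `-x₀ y₀ + x₁ y₁ + ⋯ + xₖ yₖ`. -/
def lorentzForm (k : ℕ) : LinearMap.BilinForm ℝ (EuclideanSpace ℝ (Fin (k + 1))) :=
  LinearMap.mk₂ ℝ (fun x y => ∑ i, signature i * (x i * y i))
    (fun x y z => by simp [add_mul, mul_add, Finset.sum_add_distrib])
    (fun c x y => by simp only [PiLp.smul_apply, smul_eq_mul, Finset.mul_sum]
                     exact Finset.sum_congr rfl fun i _ => by ring)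
    (fun x y z => by simp [mul_add, Finset.sum_add_distrib])
    (fun c x y => by simp only [PiLp.smul_apply, smul_eq_mul, Finset.mul_sum]
                     exact Finset.sum_congr rfl fun i _ => by ring)

/-- The real hyperbolic space `ℍ^(n+1)` of constant curvature `-1` (hyperboloid model). -/
def realHyperbolic (n : ℕ) : Ambient where
  V := EuclideanSpace ℝ (Fin (n + 2))
  form := lorentzForm (n + 1)
  carrier := {x | lorentzForm (n + 1) x x = -1 ∧ 0 < x 0}

section HyperbolicF

variable (F : Type) [NormedAddCommGroup F] [InnerProductSpace ℝ F]

/-- For `F`-Hermitian matrices `A`, `B` and `J = diag(-1, 1, …, 1)` this is `-2 Re tr (J A J B)`,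
since `Re (x ȳ) = ⟪x, y⟫`. -/
def hermitianForm (m : ℕ) : LinearMap.BilinForm ℝ (Fin (m + 1) → Fin (m + 1) → F) :=
  LinearMap.mk₂ ℝ (fun A B => -2 * ∑ i, ∑ j, signature i * signature j * inner ℝ (A i j) (B i j))
    (fun x y z => by simp [inner_add_left, mul_add, Finset.sum_add_distrib])
    (fun c x y => by
      simp only [Pi.smul_apply, real_inner_smul_left, smul_eq_mul, Finset.mul_sum]
      exact Finset.sum_congr rfl fun i _ => Finset.sum_congr rfl fun j _ => by ring)
    (fun x y z => by simp [inner_add_right, mul_add, Finset.sum_add_distrib])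
    (fun c x y => by
      simp only [Pi.smul_apply, real_inner_smul_right, smul_eq_mul, Finset.mul_sum]
      exact Finset.sum_congr rfl fun i _ => Finset.sum_congr rfl fun j _ => by ring)

variable [Mul F] [One F] [Star F]

/-- The hyperbolic space `H_F^m`, `F` one of `ℂ`, `ℍ`, `𝕆` (with `m = 2` for `𝕆`), in its
projective model. With `J = diag(-1, 1, …, 1)`, its points are the Hermitian matrices `A` over `F`
with `A J A = -A`, `tr (J A) = -1` and `A₀₀ > 0`. Over `ℂ` and `ℍ` these are exactly the matrices
`A = z z*` with `z* J z = -1`, so that `A` stands for the negative line spanned by `z`; over `𝕆`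
they are the negative primitive idempotents `-A` of the exceptional Jordan algebra with the product
`(X J Y + Y J X) / 2`. For a curve `A = z z*` with `z* J z' = 0`, the form gives
`|A'|² = 4 z'* J z'`, which is the normalization in which the sectional curvatures fill
`[-1, -1/4]`. -/
def hyperbolic (m : ℕ) : Ambient where
  V := Fin (m + 1) → Fin (m + 1) → F
  form := hermitianForm F m
  carrier := {A | (∀ i j, star (A i j) = A j i) ∧
    (∀ i j, ∑ k, signature k • (A i k * A k j) = -A i j) ∧
    ∑ k, signature k • A k k = -1 ∧
    0 < inner ℝ (1 : F) (A 0 0)}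

end HyperbolicF

/-- The `(n+1)`-dimensional simply connected space forms and rank-one symmetric spaces of
noncompact type (`H_ℝ^(n+1)` is the real hyperbolic space form). -/
inductive ModelSpace (n : ℕ) : Type
  | euclidean
  | sphere
  | realHyperbolic
  | complexHyperbolic (m : ℕ) (h : n + 1 = 2 * m)
  | quaternionicHyperbolic (m : ℕ) (h : n + 1 = 4 * m)
  | cayleyHyperbolic (h : n + 1 = 16)

/-- The concrete model of each of the spaces. -/
def ModelSpace.ambient {n : ℕ} : ModelSpace n → Ambient
  | .euclidean => WeingartenFlow.euclidean n
  | .sphere => WeingartenFlow.sphere n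
  | .realHyperbolic => WeingartenFlow.realHyperbolic n
  | .complexHyperbolic m _ => hyperbolic ℂ m
  | .quaternionicHyperbolic m _ => hyperbolic ℍ[ℝ] m
  | .cayleyHyperbolic _ => hyperbolic Octonion 2

/-- The radii of the geodesic balls that are convex with strictly convex boundary sphere:
`0 < R < π/2` in the unit sphere, `0 < R` in all the other spaces. -/
def ModelSpace.IsConvexRadius {n : ℕ} : ModelSpace n → ℝ → Prop
  | .sphere, R => 0 < R ∧ R < Real.pi / 2
  | _, R => 0 < R

/-! ### Riemannian geometry of the spaces -/

namespace Ambient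

variable (A : Ambient)

/-- Tangent vectors to `carrier` at `x`: velocities of curves in `carrier`. -/
def tangent (x : A.V) : Set A.V :=
  {v | ∃ c : ℝ → A.V, (∀ s, c s ∈ A.carrier) ∧ c 0 = x ∧ HasDerivAt c v 0}

/-- Unit speed geodesics `ℝ → carrier`: the covariant derivative of the velocity, that is, the
tangential part of the second derivative in `V`, vanishes. -/
structure IsUnitGeodesic (γ : ℝ → A.V) : Prop where
  smooth : ContDiff ℝ ∞ γ
  mem : ∀ s, γ s ∈ A.carrier
  unit : ∀ s, A.form (deriv γ s) (deriv γ s) = 1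
  geodesic : ∀ s, ∀ v ∈ A.tangent (γ s), A.form (deriv (deriv γ) s) v = 0

/-- The open geodesic ball of radius `R` about `o`. -/
def geodesicBall (o : A.V) (R : ℝ) : Set A.V :=
  {x | ∃ γ, A.IsUnitGeodesic γ ∧ γ 0 = o ∧ ∃ s, 0 ≤ s ∧ s < R ∧ γ s = x}

/-- The geodesic sphere of radius `R` about `o`. -/
def geodesicSphere (o : A.V) (R : ℝ) : Set A.V :=
  {x | ∃ γ, A.IsUnitGeodesic γ ∧ γ 0 = o ∧ γ R = x}

end Ambient

/-! ### Hypersurfaces and Weingarten flows -/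

/-- `W ∈ C^∞(Γ)` is a Weingarten function: `Γ` is open and contains the positive cone, and `W` is
symmetric, homogeneous, increasing in each variable, and positive on the positive cone.
(Increasing is required along segments in `Γ` parallel to the axes, in the non-strict sense.) -/
structure IsWeingarten {n : ℕ} (Γ : Set (Fin n → ℝ)) (W : (Fin n → ℝ) → ℝ) : Prop where
  isOpen : IsOpen Γ
  cone_subset : {k | ∀ i, 0 < k i} ⊆ Γ
  smooth : ContDiffOn ℝ ∞ W Γ
  symmetric : ∀ k ∈ Γ, ∀ σ : Equiv.Perm (Fin n), k ∘ σ ∈ Γ → W (k ∘ σ) = W k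
  homogeneous : ∃ α : ℝ, ∀ k ∈ Γ, ∀ c : ℝ, 0 < c → c • k ∈ Γ → W (c • k) = c ^ α * W k
  increasing : ∀ k ∈ Γ, ∀ i, ∀ s : ℝ, 0 ≤ s → (∀ u ∈ Icc 0 s, k + Pi.single i u ∈ Γ) →
    W k ≤ W (k + Pi.single i s)
  pos : ∀ k, (∀ i, 0 < k i) → 0 < W k

/-- `W` has an odd extension to `Γ ∪ -Γ`. -/
def IsOdd {n : ℕ} (Γ : Set (Fin n → ℝ)) (W : (Fin n → ℝ) → ℝ) : Prop :=
  ∃ W' : (Fin n → ℝ) → ℝ, (∀ k ∈ Γ, W' k = W k) ∧ ∀ k ∈ Γ, W' (-k) = -W' k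

section Hypersurfaces

variable (n : ℕ) {M : Type*} [TopologicalSpace M] [ChartedSpace (EuclideanSpace ℝ (Fin n)) M]
variable (A : Ambient)

/-- The differential of a map `M → V` at `p`. -/
def differential (f : M → A.V) (p : M) : TangentSpace (𝓡 n) p →L[ℝ] A.V :=
  mfderiv (𝓡 n) 𝓘(ℝ, A.V) f p

/-- `f : M → carrier` is an immersion with unit normal field `N` (tangent to the space). -/
structure IsOrientedHypersurface (f N : M → A.V) : Prop where
  mem : ∀ p, f p ∈ A.carrier
  immersion : ∀ p, Function.Injective (differential n A f p)
  tangent : ∀ p, N p ∈ A.tangent (f p)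
  unit : ∀ p, A.form (N p) (N p) = 1
  normal : ∀ p v, A.form (N p) (differential n A f p v) = 0

end Hypersurfaces

/-- `k` lists the principal curvatures of `f` at `p` with respect to `N`: in some orthonormal basis
`e` of the tangent space of `M` at `p`, for the induced metric, the second fundamental form
`h(X, Y) = -⟨∇_X N, df Y⟩` is diagonal with entries `k`. Here `∇_X N` may be replaced by the
derivative `dN X` in `V`, of which it is the tangential part. -/
def IsPrincipalCurvatures {n : ℕ} {M : Type*} [TopologicalSpace M]
    [ChartedSpace (EuclideanSpace ℝ (Fin n)) M] (A : Ambient) (f N : M → A.V) (p : M) (k : Fin n → ℝ) : Prop :=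
  ∃ e : Fin n → TangentSpace (𝓡 n) p,
    (∀ i j, A.form (differential n A f p (e i)) (differential n A f p (e j)) = if i = j then 1 else 0) ∧
    ∀ i j, -A.form (differential n A N p (e i)) (differential n A f p (e j)) =
      if i = j then k i else 0

/-- The time interval `[0, T)`, `T ≤ +∞`. -/
def timeInterval (T : EReal) : Set ℝ := {t | 0 ≤ t ∧ (t : EReal) < T}

/-- `F : M × [0, T) → carrier`, with unit normals `N`, is a `W`-flow: a smooth family of oriented
immersions with `∂F/∂t = W(k₁, …, kₙ) N`. The time is the first argument. -/
structure IsWFlow {n : ℕ} {M : Type*} [TopologicalSpace M]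
    [ChartedSpace (EuclideanSpace ℝ (Fin n)) M] (A : Ambient) (Γ : Set (Fin n → ℝ)) (W : (Fin n → ℝ) → ℝ) (T : EReal)
    (F N : ℝ → M → A.V) : Prop where
  smooth : ContMDiffOn (𝓘(ℝ, ℝ).prod (𝓡 n)) 𝓘(ℝ, A.V) ∞ (fun z : ℝ × M => F z.1 z.2)
    (timeInterval T ×ˢ univ)
  smooth_normal : ContMDiffOn (𝓘(ℝ, ℝ).prod (𝓡 n)) 𝓘(ℝ, A.V) ∞ (fun z : ℝ × M => N z.1 z.2)
    (timeInterval T ×ˢ univ)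
  hypersurface : ∀ t ∈ timeInterval T, IsOrientedHypersurface n A (F t) (N t)
  evolution : ∀ t ∈ timeInterval T, ∀ p, ∃ k ∈ Γ, IsPrincipalCurvatures A (F t) (N t) p k ∧
    HasDerivWithinAt (fun s => F s p) (W k • N t p) (timeInterval T) t

/-! ### Inward orientation -/

section Orientation

variable (A : Ambient) {M : Type*}

/-- The union of the connected components of `carrier \ K` that are contained in `B`. -/
def enclosedRegion (B K : Set A.V) : Set A.V :=
  {x | x ∈ A.carrier \ K ∧ connectedComponentIn (A.carrier \ K) x ⊆ B}

/-- The normal field `N` of a hypersurface `f` contained in the closure of a ball `B` is inward: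
curves in `carrier` issuing from `f p` with velocity `N p` enter the region that `f` encloses
in `B`. -/
def IsInward (B : Set A.V) (f N : M → A.V) : Prop :=
  ∀ p, ∃ c : ℝ → A.V, (∀ s, c s ∈ A.carrier) ∧ c 0 = f p ∧ HasDerivAt c (N p) 0 ∧
    ∀ᶠ s in 𝓝[>] (0 : ℝ), c s ∈ enclosedRegion A B (range f)

/-- The parallel `φ`-flow: `P_t(p) = exp_{P₀(p)} (φ(t) N₀(p))`, with unit normal
`N_t(p) = d exp_{P₀(p)} (φ(t) N₀(p)) N₀(p)`, the velocity of the normal geodesic. -/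
structure IsParallelFlow (T : EReal) (φ : ℝ → ℝ) (P N : ℝ → M → A.V) : Prop where
  smooth : ContDiffOn ℝ ∞ φ (timeInterval T)
  zero : φ 0 = 0
  parallel : ∀ p, ∀ t ∈ timeInterval T, ∃ γ, A.IsUnitGeodesic γ ∧ γ 0 = P 0 p ∧
    deriv γ 0 = N 0 p ∧ P t p = γ (φ t) ∧ N t p = deriv γ (φ t)

end Orientation

/-- The unit sphere `𝕊ⁿ`, the parameter manifold of geodesic spheres. -/
abbrev UnitSphere (n : ℕ) : Type := Metric.sphere (0 : EuclideanSpace ℝ (Fin (n + 1))) 1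

/-- `P : 𝕊ⁿ × [0, T) → carrier` is a parallel `W`-flow whose initial hypersurface is the embedded
geodesic sphere of radius `R` about `o` with inward orientation. -/
structure IsSphericalFlow {n : ℕ} (A : Ambient) (Γ : Set (Fin n → ℝ)) (W : (Fin n → ℝ) → ℝ)
    (o : A.V) (R : ℝ) (T : EReal) (φ : ℝ → ℝ) (P N : ℝ → UnitSphere n → A.V) : Prop where
  pos : 0 < T
  embedding : IsEmbedding (P 0)
  initial : range (P 0) = A.geodesicSphere o R
  inward : IsInward A (A.geodesicBall o R) (P 0) (N 0)
  parallel : IsParallelFlow A T φ P N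
  flow : IsWFlow A Γ W T P N

/-- `P` is moreover defined on its maximal time interval: `T` is its collapsing time. -/
structure IsMaximalSphericalFlow {n : ℕ} (A : Ambient) (Γ : Set (Fin n → ℝ))
    (W : (Fin n → ℝ) → ℝ) (o : A.V) (R : ℝ) (T : EReal) (φ : ℝ → ℝ)
    (P N : ℝ → UnitSphere n → A.V) : Prop where
  isSphericalFlow : IsSphericalFlow A Γ W o R T φ P N
  maximal : ∀ T' φ' P' N', IsSphericalFlow A Γ W o R T' φ' P' N' →
    (∀ t ∈ timeInterval T, P' t = P t) → T' ≤ T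

end WeingartenFlow

end

noncomputable section

namespace WeingartenFlow

/-! A geodesic sphere about o has the same principal curvatures `curv r` at all its points, so under
the flow only its radius changes, by ρ' = -W(curv ρ). The entries of `curv r` are positive and
decrease in r. Hence W(curv r) is positive and nonincreasing, its reciprocal is bounded near r = 0,
and Φ(r) = ∫₀^r 1/W(curv) is finite. The sphere satisfies Φ(ρ(t)) + t = Φ(R) and collapses at the
finite time Φ(R) (`exists_clock`, `Clock`).

For the avoidance, let p be a point of F_t at maximal distance r from o. There F_t touches the
sphere of radius r from inside, so its principal curvatures for the normal towards o dominate `curv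
r` in a suitable order (`touching`, `curv_le_of_isLocalMax`). By symmetry and monotonicity of W the
point moves towards o at least with speed W(curv r). If N points away from o, oddness of W gives the
same conclusion, and an inward orientation excludes this case (`not_isInward`). Thus the maximum of
Φ(distance) + t does not increase (`speed_at_max`, `le_of_max_nonincreasing`). It is below Φ(R) at
the start by compactness, so F_t stays strictly inside the sphere, and T ≤ Φ(R) because Φ ≥ 0
(`avoidance`).

Any spherical flow consists of geodesic spheres whose radius solves the same equation, so it is the
standard one up to parametrization and ends by Φ(R) (`IsSphericalFlow.unique`). A maximal one lasts
exactly until Φ(R).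

The Riemannian input is collected in `Geometry`: geodesics have the form x + S(s) ι w + C(s) β(w,
w), and half the squared chord in V equals C of the distance. The field `sff` gives the normal part
of the acceleration of curves, hence the Hessian of the distance. Its eigenvalues on a sphere are (1
- κC)/S, with multiplicity d - 1, and (1 - κC/2)/S.

This structure is immediate for Euclidean space and is a computation on quadrics for the sphere and
real hyperbolic space. For H_F^m it is computed at one point of the matrix model (`basePolar`) and
transported by symmetries (`exists_symmetry`), which are compositions of real reflections and
entrywise twists. For the octonions the Moufang identities replace associativity. -/

/-- The parameter space `ℝ^(n+1)` of the tangent spaces. -/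
abbrev Euc (n : ℕ) : Type := EuclideanSpace ℝ (Fin (n + 1))

/-! ### Polar coordinates as an abstract structure. -/

/-- The generalized trigonometric functions of a space whose geodesics satisfy `γ''' = -κ γ'`:
`S` is the generalized sine, `C` its primitive, and `D` inverts `C` on the range `J` of the
distance function. The set `I` consists of the radii of strictly convex geodesic spheres. -/
structure Profile where
  κ : ℝ
  S : ℝ → ℝ
  C : ℝ → ℝ
  D : ℝ → ℝ
  J : Set ℝ
  I : Set ℝ
  S_zero : S 0 = 0
  C_zero : C 0 = 0
  hasDerivAt_S : ∀ s, HasDerivAt S (1 - κ * C s) s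
  hasDerivAt_C : ∀ s, HasDerivAt C (S s) s
  contDiff_S : ContDiff ℝ ∞ S
  contDiff_C : ContDiff ℝ ∞ C
  continuous_D : Continuous D
  D_C : ∀ s ∈ J, D (C s) = s
  C_D : ∀ r ∈ I, ∀ᶠ y in 𝓝 (C r), C (D y) = y
  strictMonoOn_C : StrictMonoOn C J
  zero_mem : 0 ∈ J
  nonneg : ∀ s ∈ J, 0 ≤ s
  I_subset : I ⊆ J
  isOpen_I : IsOpen I
  pos : ∀ r ∈ I, 0 < r
  mem_I : ∀ r ∈ I, ∀ s, 0 < s → s ≤ r → s ∈ I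
  S_pos : ∀ r ∈ I, 0 < S r
  cos_pos : ∀ r ∈ I, 0 < 1 - κ * C r

/-- Geodesic polar coordinates about a point `x`: `ι` identifies `ℝ^(n+1)` with the tangent space,
`β` is the second fundamental form of `carrier` in `V`, and `K w` is the orthogonal projection to
the directions spanning, together with `w`, planes of extremal curvature. -/
structure Polar (A : Ambient) (n : ℕ) (p : Profile) (d : ℕ) (x : A.V) where
  ι : Euc n →ₗ[ℝ] A.V
  β : Euc n →ₗ[ℝ] Euc n →ₗ[ℝ] A.V
  K : Euc n → (Euc n →ₗ[ℝ] Euc n)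
  form_ι : ∀ v w, A.form (ι v) (ι w) = inner ℝ v w
  β_symm : ∀ v w, β v w = β w v
  form_β_ι : ∀ w v, A.form (β w w) (ι v) = 0
  tangent_eq : A.tangent x = range ι
  sff : ∀ c : ℝ → A.V, (∀ᶠ s in 𝓝 0, c s ∈ A.carrier) → c 0 = x → ContDiffAt ℝ 2 c 0 →
    ∀ w ξ, deriv c 0 = ι ξ → A.form (β w w) (deriv (deriv c) 0) =
      p.κ / 2 * (‖w‖ ^ 2 * ‖ξ‖ ^ 2 + inner ℝ (K w ξ) ξ)
  K_symm : ∀ w ξ η, inner ℝ (K w ξ) η = inner ℝ ξ (K w η)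
  K_self : ∀ w, ‖w‖ = 1 → K w w = w
  K_idem : ∀ w, ‖w‖ = 1 → ∀ ξ, K w (K w ξ) = K w ξ
  K_rank : ∀ w, ‖w‖ = 1 → Module.finrank ℝ (LinearMap.range (K w)) = d
  isGeodesic : ∀ w, ‖w‖ = 1 → A.IsUnitGeodesic fun s => x + p.S s • ι w + p.C s • β w w
  geodesic_second : ∀ γ, A.IsUnitGeodesic γ → γ 0 = x → ∀ w, deriv γ 0 = ι w →
    deriv (deriv γ) 0 = β w w
  surj : ∀ y ∈ A.carrier, ∃ s ∈ p.J, ∃ w, ‖w‖ = 1 ∧ y = x + p.S s • ι w + p.C s • β w w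

/-- A space with geodesic polar coordinates about each point. -/
structure Geometry (A : Ambient) (n : ℕ) where
  profile : Profile
  d : ℕ
  finiteDimensional : FiniteDimensional ℝ A.V
  symm : ∀ x y, A.form x y = A.form y x
  one_le_d : 1 ≤ d
  d_le : d ≤ n + 1
  d_eq : profile.κ ≤ 0 ∨ d = n + 1
  third : ∀ γ, A.IsUnitGeodesic γ → ∀ s, deriv (deriv (deriv γ)) s = -profile.κ • deriv γ s
  polar : ∀ x ∈ A.carrier, Polar A n profile d x

/-! ### Generalized trigonometry. -/

namespace Profile

variable (p : Profile)

/-- Pythagoras for the pair S, 1 - κC, written so that it remains meaningful for κ = 0: the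
difference of the two sides has derivative zero. -/
lemma S_sq (s : ℝ) : p.S s ^ 2 = 2 * p.C s - p.κ * p.C s ^ 2 := by
  have h : ∀ s, HasDerivAt (fun s => p.S s ^ 2 - (2 * p.C s - p.κ * p.C s ^ 2)) 0 s := fun s => by
    refine (((p.hasDerivAt_S s).pow 2).sub (((p.hasDerivAt_C s).const_mul 2).sub
      (((p.hasDerivAt_C s).pow 2).const_mul p.κ))).congr_deriv ?_
    push_cast
    ring
  have := is_const_of_deriv_eq_zero (fun s => (h s).differentiableAt) (fun s => (h s).deriv) s 0
  simp only [p.S_zero, p.C_zero] at this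
  linarith

lemma C_pos {r : ℝ} (hr : r ∈ p.I) : 0 < p.C r := by
  have := p.strictMonoOn_C p.zero_mem (p.I_subset hr) (p.pos r hr)
  rwa [p.C_zero] at this

/-- Both sides are half the generalized cotangent of r/2, the curvature of the sphere in the
directions of sectional curvature κ/4. The left side shows that it is positive. -/
lemma half_eq {r : ℝ} (hr : r ∈ p.I) :
    p.S r / (2 * p.C r) = (1 - p.κ * p.C r / 2) / p.S r := by
  have h1 := p.S_pos r hr
  have h2 := p.C_pos hr
  have h3 := p.S_sq r
  field_simp
  linarith

lemma half_pos {r : ℝ} (hr : r ∈ p.I) : 0 < 1 - p.κ * p.C r / 2 := by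
  have h1 := p.S_pos r hr
  have h2 := p.C_pos hr
  have h := p.half_eq hr
  have h3 : 0 < p.S r / (2 * p.C r) := by positivity
  rw [h] at h3
  exact (div_pos_iff_of_pos_right h1).1 h3

lemma hasDerivAt_D {r : ℝ} (hr : r ∈ p.I) : HasDerivAt p.D (p.S r)⁻¹ (p.C r) := by
  refine HasDerivAt.of_local_left_inverse p.continuous_D.continuousAt ?_ (p.S_pos r hr).ne'
    (p.C_D r hr)
  rw [p.D_C r (p.I_subset hr)]
  exact p.hasDerivAt_C r

lemma lt_of_C_lt {r s : ℝ} (hr : r ∈ p.J) (hs : s ∈ p.J) (h : p.C s < p.C r) : s < r :=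
  (p.strictMonoOn_C.lt_iff_lt hs hr).1 h

lemma mem_I_of_lt {R s : ℝ} (hR : R ∈ p.I) (hs : s ∈ p.J) (h0 : p.C s ≠ 0) (h : p.C s ≤ p.C R) :
    s ∈ p.I ∧ s ≤ R := by
  have h1 := (p.strictMonoOn_C.le_iff_le hs (p.I_subset hR)).1 h
  refine ⟨p.mem_I R hR s (lt_of_le_of_ne (p.nonneg s hs) ?_) h1, h1⟩
  rintro rfl
  exact h0 p.C_zero

/-- Room beyond R lets the radius equation be solved on an open time interval around 0. -/
lemma exists_larger {R : ℝ} (hR : R ∈ p.I) : ∃ R' ∈ p.I, R < R' := by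
  have h1 : ∀ᶠ r in 𝓝[>] R, r ∈ p.I := nhdsWithin_le_nhds (p.isOpen_I.mem_nhds hR)
  obtain ⟨r, hr, hr'⟩ := (h1.and self_mem_nhdsWithin).exists
  exact ⟨r, hr, hr'⟩

end Profile

/-! ### Curves and geodesics -/

/-- The bilinear form as a continuous bilinear map. -/
def Ambient.formL (A : Ambient) [FiniteDimensional ℝ A.V] : A.V →L[ℝ] A.V →L[ℝ] ℝ :=
  LinearMap.toContinuousBilinearMap A.form

section Curves

variable {A : Ambient} [FiniteDimensional ℝ A.V]

lemma hasDerivWithinAt_form {a b : ℝ → A.V} {a' b' : A.V} {u : Set ℝ} {s : ℝ}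
    (ha : HasDerivWithinAt a a' u s) (hb : HasDerivWithinAt b b' u s) :
    HasDerivWithinAt (fun s => A.form (a s) (b s)) (A.form (a s) b' + A.form a' (b s)) u s :=
  A.formL.hasDerivWithinAt_of_bilinear ha hb

lemma hasDerivAt_form {a b : ℝ → A.V} {a' b' : A.V} {s : ℝ}
    (ha : HasDerivAt a a' s) (hb : HasDerivAt b b' s) :
    HasDerivAt (fun s => A.form (a s) (b s)) (A.form (a s) b' + A.form a' (b s)) s :=
  A.formL.hasDerivAt_of_bilinear (fun _ => ha) (fun _ => hb)

lemma continuous_form : Continuous fun z : A.V × A.V => A.form z.1 z.2 :=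
  A.formL.isBoundedBilinearMap.continuous

omit [FiniteDimensional ℝ A.V] in
lemma _root_.ContDiff.hasDerivAt_deriv {c : ℝ → A.V} (hc : ContDiff ℝ ∞ c) (s : ℝ) :
    HasDerivAt c (deriv c s) s :=
  ((hc.differentiable (by simp)) s).hasDerivAt

omit [FiniteDimensional ℝ A.V] in
lemma _root_.ContDiff.deriv_infty {c : ℝ → A.V} (hc : ContDiff ℝ ∞ c) : ContDiff ℝ ∞ (deriv c) :=
  (contDiff_infty_iff_deriv.1 hc).2

omit [FiniteDimensional ℝ A.V] in
/-- Solutions of `γ''' = -κ γ'`. -/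
lemma Profile.eq_of_third (p : Profile) {γ : ℝ → A.V} (hγ : ContDiff ℝ ∞ γ)
    (h : ∀ s, deriv (deriv (deriv γ)) s = -p.κ • deriv γ s) (s : ℝ) :
    γ s = γ 0 + p.S s • deriv γ 0 + p.C s • deriv (deriv γ) 0 := by
  have h1 := fun s => hγ.hasDerivAt_deriv s
  have h2 := fun s => hγ.deriv_infty.hasDerivAt_deriv s
  have h3 := fun s => hγ.deriv_infty.deriv_infty.hasDerivAt_deriv s
  simp only [h] at h3
  -- Seen in a rotating frame the pair (γ', γ'') is constant: `hA` and `hB` are its coordinates,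
  -- conserved because γ''' = -κ γ'.
  have hA : ∀ s, HasDerivAt (fun s => (1 - p.κ * p.C s) • deriv γ s - p.S s • deriv (deriv γ) s)
      0 s := fun s => by
    refine (((((p.hasDerivAt_C s).const_mul p.κ).const_sub 1).smul (h2 s)).sub
      ((p.hasDerivAt_S s).smul (h3 s))).congr_deriv ?_
    simp only [smul_smul]
    module
  have hB : ∀ s, HasDerivAt (fun s => (p.κ * p.S s) • deriv γ s +
      (1 - p.κ * p.C s) • deriv (deriv γ) s) 0 s := fun s => by
    refine ((((p.hasDerivAt_S s).const_mul p.κ).smul (h2 s)).add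
      ((((p.hasDerivAt_C s).const_mul p.κ).const_sub 1).smul (h3 s))).congr_deriv ?_
    simp only [smul_smul]
    module
  have hA' := fun s => is_const_of_deriv_eq_zero (fun s => (hA s).differentiableAt)
    (fun s => (hA s).deriv) s 0
  have hB' := fun s => is_const_of_deriv_eq_zero (fun s => (hB s).differentiableAt)
    (fun s => (hB s).deriv) s 0
  simp only [p.S_zero, p.C_zero, mul_zero, sub_zero, one_smul, zero_smul, zero_add] at hA' hB'
  have hy : ∀ s, deriv γ s = (1 - p.κ * p.C s) • deriv γ 0 + p.S s • deriv (deriv γ) 0 := fun s => by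
    rw [← hA' s, ← hB' s]
    -- The frame has determinant 1 by `S_sq`, so the two conservation laws can be solved for γ'.
    have e : (1 - p.κ * p.C s) * (1 - p.κ * p.C s) + p.S s * (p.κ * p.S s) = 1 := by
      linear_combination p.κ * p.S_sq s
    calc deriv γ s = ((1 - p.κ * p.C s) * (1 - p.κ * p.C s) + p.S s * (p.κ * p.S s)) • deriv γ s := by
          rw [e, one_smul]
      _ = _ := by module
  have hG : ∀ s, HasDerivAt (fun s => γ s - (γ 0 + p.S s • deriv γ 0 + p.C s • deriv (deriv γ) 0))
      0 s := fun s => by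
    refine ((h1 s).sub ((((p.hasDerivAt_S s).smul_const _).const_add (γ 0)).add
      ((p.hasDerivAt_C s).smul_const _))).congr_deriv ?_
    rw [hy s, sub_self]
  have := is_const_of_deriv_eq_zero (fun s => (hG s).differentiableAt)
    (fun s => (hG s).deriv) s 0
  simp only [p.S_zero, p.C_zero, zero_smul, add_zero, sub_self] at this
  exact sub_eq_zero.1 this

-- Reversal serves to look at the centre of a sphere from one of its points: the radial geodesic
-- read backwards starts on the sphere with inward velocity.
omit [FiniteDimensional ℝ A.V] in
lemma Ambient.IsUnitGeodesic.reverse {γ : ℝ → A.V} (h : A.IsUnitGeodesic γ) (R : ℝ) :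
    A.IsUnitGeodesic (fun s => γ (R - s)) ∧ ∀ s, deriv (fun s => γ (R - s)) s = -deriv γ (R - s) := by
  have d1 : ∀ s, deriv (fun s => γ (R - s)) s = -deriv γ (R - s) := fun s => by
    rw [deriv_comp_const_sub]
  have d1' : deriv (fun s => γ (R - s)) = fun s => -deriv γ (R - s) := funext d1
  have d2 : ∀ s, deriv (deriv (fun s => γ (R - s))) s = deriv (deriv γ) (R - s) := fun s => by
    rw [d1', deriv.fun_neg, deriv_comp_const_sub, neg_neg]
  refine ⟨⟨h.smooth.comp (contDiff_const.sub contDiff_id), fun s => h.mem _, fun s => ?_,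
    fun s v hv => ?_⟩, d1⟩
  · rw [d1]; simpa using h.unit (R - s)
  · rw [d2]; exact h.geodesic _ v hv

omit [FiniteDimensional ℝ A.V] in
lemma Ambient.IsUnitGeodesic.deriv_mem_tangent {γ : ℝ → A.V} (h : A.IsUnitGeodesic γ) (s : ℝ) :
    deriv γ s ∈ A.tangent (γ s) :=
  ⟨fun u => γ (s + u), fun u => h.mem _, by simp, by
    simpa using (h.smooth.hasDerivAt_deriv (s + 0)).comp_const_add s 0⟩

end Curves

/-! ### Radial geodesics and the second fundamental form. -/

namespace Polar

variable {A : Ambient} {n : ℕ} {p : Profile} {d : ℕ} {x : A.V} (P : Polar A n p d x)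

/-- The exponential map in polar coordinates. -/
def exp (w : Euc n) (s : ℝ) : A.V := x + p.S s • P.ι w + p.C s • P.β w w

/-- The velocity of the radial geodesics. -/
def vel (w : Euc n) (s : ℝ) : A.V := (1 - p.κ * p.C s) • P.ι w + p.S s • P.β w w

@[simp] lemma exp_zero (w : Euc n) : P.exp w 0 = x := by simp [exp, p.S_zero, p.C_zero]

@[simp] lemma vel_zero (w : Euc n) : P.vel w 0 = P.ι w := by simp [vel, p.S_zero, p.C_zero]

lemma hasDerivAt_exp (w : Euc n) (s : ℝ) : HasDerivAt (P.exp w) (P.vel w s) s :=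
  (((p.hasDerivAt_S s).smul_const _).const_add x).add ((p.hasDerivAt_C s).smul_const _)

lemma deriv_exp (w : Euc n) : deriv (P.exp w) = P.vel w :=
  funext fun s => (P.hasDerivAt_exp w s).deriv

lemma hasDerivAt_vel (w : Euc n) (s : ℝ) :
    HasDerivAt (P.vel w) (-(p.κ * p.S s) • P.ι w + (1 - p.κ * p.C s) • P.β w w) s :=
  ((((p.hasDerivAt_C s).const_mul p.κ).const_sub 1).smul_const _).add
    ((p.hasDerivAt_S s).smul_const _)

lemma isUnitGeodesic_exp {w : Euc n} (hw : ‖w‖ = 1) : A.IsUnitGeodesic (P.exp w) :=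
  P.isGeodesic w hw

lemma mem {w : Euc n} (hw : ‖w‖ = 1) (s : ℝ) : P.exp w s ∈ A.carrier := (P.isGeodesic w hw).mem s

/-- A radial geodesic with velocity ξ has acceleration β ξ ξ at its start, so `sff` evaluated on it
becomes an identity for β alone. -/
lemma form_β_self {w ξ : Euc n} (hw : ‖w‖ = 1) (hξ : ‖ξ‖ = 1) :
    A.form (P.β w w) (P.β ξ ξ) = p.κ / 2 * (1 + inner ℝ (P.K w ξ) ξ) := by
  have h := P.sff (P.exp ξ) (Eventually.of_forall fun s => P.mem hξ s) (P.exp_zero ξ)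
    ((P.isUnitGeodesic_exp hξ).smooth.contDiffAt.of_le (by norm_cast)) w ξ
    (by rw [P.deriv_exp, vel_zero])
  rw [P.deriv_exp, (P.hasDerivAt_vel ξ 0).deriv, hw, hξ] at h
  simpa [p.S_zero, p.C_zero] using h

lemma K_smul {w : Euc n} (ξ : Euc n) (c : ℝ) :
    inner ℝ (P.K w (c • ξ)) (c • ξ) = c ^ 2 * inner ℝ (P.K w ξ) ξ := by
  rw [map_smul, real_inner_smul_left, real_inner_smul_right]
  ring

lemma form_β_β {w : Euc n} (hw : ‖w‖ = 1) (ξ : Euc n) :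
    A.form (P.β w w) (P.β ξ ξ) = p.κ / 2 * (‖ξ‖ ^ 2 + inner ℝ (P.K w ξ) ξ) := by
  rcases eq_or_ne ξ 0 with rfl | h
  · simp
  · have h' : ‖ξ‖ ≠ 0 := norm_ne_zero_iff.2 h
    have h1 : ‖(‖ξ‖⁻¹ • ξ : Euc n)‖ = 1 := by
      rw [norm_smul, norm_inv, norm_norm, inv_mul_cancel₀ h']
    have h2 := P.form_β_self hw h1
    rw [P.K_smul] at h2
    simp only [map_smul, LinearMap.smul_apply, smul_eq_mul] at h2
    field_simp at h2 ⊢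
    linarith

lemma form_β_β_self (w : Euc n) : A.form (P.β w w) (P.β w w) = p.κ * ‖w‖ ^ 4 := by
  rcases eq_or_ne w 0 with rfl | h
  · simp
  · have h' : ‖w‖ ≠ 0 := norm_ne_zero_iff.2 h
    have h1 : ‖(‖w‖⁻¹ • w : Euc n)‖ = 1 := by
      rw [norm_smul, norm_inv, norm_norm, inv_mul_cancel₀ h']
    have h2 := P.form_β_self h1 h1
    rw [P.K_self _ h1, real_inner_self_eq_norm_sq, h1] at h2
    simp only [map_smul, LinearMap.smul_apply, smul_eq_mul] at h2
    field_simp at h2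
    linarith

end Polar

/-! ### Geodesics, chords and balls. -/

namespace Geometry

variable {A : Ambient} {n : ℕ} (G : Geometry A n)

/-- Half the square of the chordal distance. -/
def _root_.WeingartenFlow.Ambient.chord (A : Ambient) (o x : A.V) : ℝ := A.form (x - o) (x - o) / 2

variable {G}

/-- Since ι w and β w w are orthogonal with squares 1 and κ, half the squared chord is (S² + κC²)/2
= C. As C is increasing on J, distances can be compared through `form`. -/
lemma chord_exp {o : A.V} (P : Polar A n G.profile G.d o) {w : Euc n} (hw : ‖w‖ = 1) (s : ℝ) :
    A.chord o (P.exp w s) = G.profile.C s := by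
  have : P.exp w s - o = G.profile.S s • P.ι w + G.profile.C s • P.β w w := by
    simp only [Polar.exp]; abel
  rw [Ambient.chord, this]
  simp only [map_add, map_smul, LinearMap.add_apply, LinearMap.smul_apply, smul_eq_mul, P.form_ι,
    P.form_β_ι, P.form_β_β_self, G.symm (P.ι w), hw, real_inner_self_eq_norm_sq]
  linear_combination G.profile.S_sq s / 2

/-- The third-order equation determines a geodesic from its position, velocity and acceleration at
0, and the acceleration is β w w. -/
lemma eq_exp_of_geodesic {o : A.V} (P : Polar A n G.profile G.d o) {γ : ℝ → A.V}
    (hγ : A.IsUnitGeodesic γ) (h0 : γ 0 = o) {w : Euc n} (hw : deriv γ 0 = P.ι w) :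
    ‖w‖ = 1 ∧ γ = P.exp w := by
  constructor
  · have := hγ.unit 0
    rw [hw, P.form_ι, real_inner_self_eq_norm_sq] at this
    exact (pow_eq_one_iff_of_nonneg (norm_nonneg _) two_ne_zero).1 this
  · funext s
    rw [G.profile.eq_of_third hγ.smooth (G.third γ hγ) s, h0, hw, P.geodesic_second γ hγ h0 w hw,
      Polar.exp]

lemma exists_eq_exp {o : A.V} (P : Polar A n G.profile G.d o) {γ : ℝ → A.V}
    (hγ : A.IsUnitGeodesic γ) (h0 : γ 0 = o) :
    ∃ w, ‖w‖ = 1 ∧ deriv γ 0 = P.ι w ∧ γ = P.exp w := by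
  have := hγ.deriv_mem_tangent 0
  rw [h0, P.tangent_eq] at this
  obtain ⟨w, hw⟩ := this
  obtain ⟨h1, h2⟩ := eq_exp_of_geodesic P hγ h0 hw.symm
  exact ⟨w, h1, hw.symm, h2⟩

/-- A geodesic is determined by its position and velocity at one time. -/
lemma geodesic_unique (G : Geometry A n) {γ δ : ℝ → A.V} (hγ : A.IsUnitGeodesic γ)
    (hδ : A.IsUnitGeodesic δ) (h0 : γ 0 = δ 0) (h1 : deriv γ 0 = deriv δ 0) : γ = δ := by
  obtain ⟨w, -, hw, e⟩ := exists_eq_exp (G.polar (δ 0) (hδ.mem 0)) hδ rfl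
  rw [e]
  exact (eq_exp_of_geodesic _ hγ h0 (h1.trans hw)).2

lemma geodesicSphere_eq {o : A.V} (P : Polar A n G.profile G.d o) (R : ℝ) :
    A.geodesicSphere o R = {x | ∃ w, ‖w‖ = 1 ∧ P.exp w R = x} := by
  ext x
  constructor
  · rintro ⟨γ, hγ, h0, h1⟩
    obtain ⟨w, hw, -, e⟩ := exists_eq_exp P hγ h0
    exact ⟨w, hw, by rw [← e, h1]⟩
  · rintro ⟨w, hw, rfl⟩
    exact ⟨_, P.isUnitGeodesic_exp hw, P.exp_zero w, rfl⟩

/-- Replaces the ball by a sublevel set of the chord: C is strictly increasing on J, and by `surj`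
every point is reached by a radial geodesic of length in J. -/
lemma mem_geodesicBall_iff {o : A.V} (P : Polar A n G.profile G.d o) {R : ℝ}
    (hR : R ∈ G.profile.I) (x : A.V) :
    x ∈ A.geodesicBall o R ↔ x ∈ A.carrier ∧ A.chord o x < G.profile.C R := by
  have hRJ := G.profile.I_subset hR
  constructor
  · rintro ⟨γ, hγ, h0, s, hs0, hsR, rfl⟩
    refine ⟨hγ.mem s, ?_⟩
    obtain ⟨w, hw, -, e⟩ := exists_eq_exp P hγ h0
    rw [e, chord_exp P hw]
    have hsJ : s ∈ G.profile.J := by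
      rcases hs0.eq_or_lt with rfl | h
      · exact G.profile.zero_mem
      · exact G.profile.I_subset (G.profile.mem_I R hR s h hsR.le)
    exact G.profile.strictMonoOn_C hsJ hRJ hsR
  · rintro ⟨hx, hlt⟩
    obtain ⟨s, hs, w, hw, rfl⟩ := P.surj x hx
    rw [← Polar.exp] at hlt ⊢
    rw [chord_exp P hw] at hlt
    exact ⟨_, P.isUnitGeodesic_exp hw, P.exp_zero w, s, G.profile.nonneg s hs,
      G.profile.lt_of_C_lt hRJ hs hlt, rfl⟩

end Geometry

/-! ### Comparison of principal curvatures -/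

lemma exists_perm_mem_iff {n m : ℕ} (S : Finset (Fin n)) (hS : S.card = m) :
    ∃ σ : Equiv.Perm (Fin n), ∀ i, σ i ∈ S ↔ (i : ℕ) < m := by
  have hm : m ≤ n := by simpa [hS] using S.card_le_univ
  have hc : Fintype.card {i : Fin n // (i : ℕ) < m} = Fintype.card {i // i ∈ S} := by
    rw [Fintype.card_coe, hS, Fintype.card_subtype, Fin.card_filter_val_lt]
    exact min_eq_right hm
  let e := Fintype.equivOfCardEq hc
  refine ⟨e.extendSubtype, fun i => ⟨fun h => ?_, fun h => e.extendSubtype_mem i h⟩⟩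
  by_contra h'
  exact e.extendSubtype_not_mem i h' h

/-- The list with entries `b` (`d - 1` times) and `a`. -/
def twoValued (n d : ℕ) (a b : ℝ) : Fin n → ℝ := fun i => if (i : ℕ) < d - 1 then b else a

section Count

variable {n d : ℕ} {v : Fin n → Euc n} {k : Fin n → ℝ} {a b : ℝ}

lemma norm_sq_sum (hv : Orthonormal ℝ v) (y : Fin n → ℝ) : ‖∑ i, y i • v i‖ ^ 2 = ∑ i, y i ^ 2 := by
  rw [← real_inner_self_eq_norm_sq, hv.inner_sum]
  exact Finset.sum_congr rfl fun i _ => by simp [sq]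

/-- A diagonal quadratic form that is at least `b` on a subspace of codimension `m` has at most `m`
diagonal entries below `b`. -/
lemma card_lt_le {U : Type*} [AddCommGroup U] [Module ℝ U] [FiniteDimensional ℝ U] {m : ℕ}
    (hU : Module.finrank ℝ U = m) (hv : Orthonormal ℝ v) (L : Euc n →ₗ[ℝ] U)
    (h : ∀ y : Fin n → ℝ, L (∑ i, y i • v i) = 0 →
      b * ‖∑ i, y i • v i‖ ^ 2 ≤ ∑ i, k i * y i ^ 2) :
    (Finset.univ.filter fun i => k i < b).card ≤ m := by
  by_contra! hlt
  set J := Finset.univ.filter fun i => k i < b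
  -- With more than m entries below b, their basis vectors span a space too large for L to be
  -- injective on it. A nonzero kernel vector there has form less than b times its squared norm.
  let T : (J → ℝ) →ₗ[ℝ] Euc n := ∑ i : J, (LinearMap.proj i).smulRight (v i)
  have hT : ∀ y, T y = ∑ i : J, y i • v i := fun y => by simp [T]
  have hker : LinearMap.ker (L ∘ₗ T) ≠ ⊥ := LinearMap.ker_ne_bot_of_finrank_lt (by simpa [hU] using hlt)
  obtain ⟨y, hy, hy0⟩ := (Submodule.ne_bot_iff _).1 hker
  let z : Fin n → ℝ := fun i => if h : i ∈ J then y ⟨i, h⟩ else 0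
  have hzJ : ∀ i : J, z i = y i := fun i => by simp [z]
  have hz0 : ∀ i ∉ J, z i = 0 := fun i hi => by simp [z, hi]
  have hsum : ∀ {X : Type} [AddCommMonoid X] (g : Fin n → X), (∀ i ∉ J, g i = 0) →
      ∑ i, g i = ∑ i : J, g i := fun g hg => by
    rw [Finset.sum_coe_sort J g]
    exact (Finset.sum_subset (Finset.subset_univ J) fun i _ hi => hg i hi).symm
  have hzT : ∑ i, z i • v i = T y := by
    rw [hT, hsum (fun i => z i • v i) fun i hi => by simp [hz0 i hi]]
    simp [hzJ]
  have h1 := h z (by rw [hzT]; exact hy)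
  rw [norm_sq_sum hv, Finset.mul_sum] at h1
  obtain ⟨j, hj⟩ := Function.ne_iff.1 hy0
  refine h1.not_gt (Finset.sum_lt_sum (fun i _ => ?_) ⟨j, Finset.mem_univ _, ?_⟩)
  · by_cases hi : i ∈ J
    · exact mul_le_mul_of_nonneg_right (Finset.mem_filter.1 hi).2.le (sq_nonneg _)
    · simp [hz0 i hi]
  · have : z j ≠ 0 := by rw [hzJ]; exact hj
    exact mul_lt_mul_of_pos_right (Finset.mem_filter.1 j.2).2 (by positivity)

variable {K : Euc n →ₗ[ℝ] Euc n}

lemma inner_proj_nonneg (hs : ∀ ξ η, inner ℝ (K ξ) η = inner ℝ ξ (K η))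
    (hi : ∀ ξ, K (K ξ) = K ξ) (ξ : Euc n) : 0 ≤ inner ℝ (K ξ) ξ := by
  have : inner ℝ (K ξ) ξ = inner ℝ (K ξ) (K ξ) := by rw [hs ξ (K ξ), hi, real_inner_comm]
  rw [this]
  exact real_inner_self_nonneg

lemma inner_proj_le (hs : ∀ ξ η, inner ℝ (K ξ) η = inner ℝ ξ (K η))
    (hi : ∀ ξ, K (K ξ) = K ξ) (ξ : Euc n) : inner ℝ (K ξ) ξ ≤ ‖ξ‖ ^ 2 := by
  have h1 : inner ℝ (K ξ) ξ = ‖K ξ‖ ^ 2 := by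
    rw [← real_inner_self_eq_norm_sq, hs ξ (K ξ), hi, real_inner_comm]
  have h2 := real_inner_le_norm (K ξ) ξ
  have h3 : ‖K ξ‖ ≤ ‖ξ‖ := by
    by_contra! hlt
    nlinarith [norm_nonneg ξ]
  nlinarith [norm_nonneg (K ξ)]

lemma eq_of_finrank_range (hi : ∀ ξ, K (K ξ) = K ξ)
    (hr : Module.finrank ℝ (LinearMap.range K) = n + 1) (ξ : Euc n) : K ξ = ξ := by
  have : LinearMap.range K = ⊤ := Submodule.eq_top_of_finrank_eq (by simp [hr])
  obtain ⟨η, rfl⟩ := LinearMap.range_eq_top.1 this ξ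
  exact hi η

lemma finrank_ker_proj (hr : Module.finrank ℝ (LinearMap.range K) = d) :
    Module.finrank ℝ (LinearMap.ker K) = n + 1 - d := by
  have := LinearMap.finrank_range_add_finrank_ker K
  simp at this
  omega

lemma finrank_range_inf {w : Euc n}
    (hw : ‖w‖ = 1) (hKw : K w = w) (hr : Module.finrank ℝ (LinearMap.range K) = d) :
    Module.finrank ℝ (LinearMap.range K ⊓ (ℝ ∙ w)ᗮ : Submodule ℝ (Euc n)) = d - 1 := by
  have h1 : (ℝ ∙ w) ≤ LinearMap.range K :=
    (Submodule.span_singleton_le_iff_mem _ _).2 ⟨w, hKw⟩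
  have h2 := Submodule.finrank_add_inf_finrank_orthogonal h1
  have h3 : w ≠ 0 := fun h => by simp [h] at hw
  rw [finrank_span_singleton h3, hr, inf_comm] at h2
  omega

/-- If the diagonal form `k` dominates the form with eigenvalue `b` on the range of the projection
`K` and `a` on its kernel, then the entries of `k` dominate those eigenvalues. -/
lemma exists_perm_ge (hv : Orthonormal ℝ v) (hs : ∀ ξ η, inner ℝ (K ξ) η = inner ℝ ξ (K η))
    (hi : ∀ ξ, K (K ξ) = K ξ) (hr : Module.finrank ℝ (LinearMap.range K) = d) (hd : d ≤ n + 1)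
    (hab : a ≤ b ∨ d = n + 1)
    (h : ∀ y : Fin n → ℝ, a * ‖∑ i, y i • v i‖ ^ 2 +
      (b - a) * inner ℝ (K (∑ i, y i • v i)) (∑ i, y i • v i) ≤ ∑ i, k i * y i ^ 2) :
    ∃ σ : Equiv.Perm (Fin n), ∀ i, twoValued n d a b i ≤ k (σ i) := by
  -- id - K maps into the kernel of K, of dimension n + 1 - d, and vanishes exactly on the range. So
  -- at most n + 1 - d of the n entries lie below b and at least d - 1 reach b: one less than the
  -- rank, since there are only n entries in ℝ^(n+1).
  have hcard := card_lt_le (k := k) (b := b) (finrank_ker_proj hr) hv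
    (LinearMap.codRestrict (LinearMap.ker K) (LinearMap.id - K) fun ξ => by simp [hi]) fun y hy => by
      have h1 : ∑ i, y i • v i - K (∑ i, y i • v i) = 0 := congrArg Subtype.val hy
      have h2 := h y
      rw [← sub_eq_zero.1 h1, real_inner_self_eq_norm_sq] at h2
      linarith
  have hcard' : d - 1 ≤ (Finset.univ.filter fun i => b ≤ k i).card := by
    have := Finset.card_filter_add_card_filter_not (s := (Finset.univ : Finset (Fin n)))
      (fun i => k i < b)
    simp only [not_lt, Finset.card_univ, Fintype.card_fin] at this
    omega
  obtain ⟨S, hS, hSc⟩ := Finset.exists_subset_card_eq hcard'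
  obtain ⟨σ, hσ⟩ := exists_perm_mem_iff S hSc
  refine ⟨σ, fun i => ?_⟩
  rw [twoValued]
  split_ifs with hlt
  · exact (Finset.mem_filter.1 (hS ((hσ i).2 hlt))).2
  -- If a ≤ b, testing on a single basis vector bounds every entry below by a. If d = n + 1, every
  -- index is below d - 1 = n.
  · rcases hab with hab | rfl
    · have h2 := h (Pi.single (σ i) 1)
      simp only [Pi.single_apply, ite_smul, one_smul, zero_smul, Finset.sum_ite_eq',
        Finset.mem_univ, if_true, hv.1, ite_pow, one_pow, mul_ite, mul_one] at h2
      have h3 := mul_nonneg (sub_nonneg.2 hab) (inner_proj_nonneg hs hi (v (σ i)))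
      simp at h2
      linarith
    · exact absurd i.2 hlt

/-- The analogue of `exists_perm_ge` for upper bounds, on the orthogonal complement of a unit vector
in the range of the projection. -/
lemma exists_perm_le (hv : Orthonormal ℝ v) (hs : ∀ ξ η, inner ℝ (K ξ) η = inner ℝ ξ (K η))
    (hi : ∀ ξ, K (K ξ) = K ξ) (hr : Module.finrank ℝ (LinearMap.range K) = d) (hd1 : 1 ≤ d)
    (hd : d ≤ n + 1) (hab : a ≤ b ∨ d = n + 1) {w : Euc n} (hw : ‖w‖ = 1) (hKw : K w = w)
    (hvw : ∀ i, inner ℝ w (v i) = 0)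
    (h : ∀ y : Fin n → ℝ, ∑ i, k i * y i ^ 2 ≤ a * ‖∑ i, y i • v i‖ ^ 2 +
      (b - a) * inner ℝ (K (∑ i, y i • v i)) (∑ i, y i • v i)) :
    ∃ σ : Equiv.Perm (Fin n), ∀ i, k (σ i) ≤ twoValued n d a b i := by
  have hww : inner ℝ w w = (1 : ℝ) := by rw [real_inner_self_eq_norm_sq, hw, one_pow]
  -- On the complement of w the map K - ⟨w, ·⟩w agrees with K, but its values lie in a space of
  -- dimension d - 1. So at most d - 1 entries exceed a.
  have hcard := card_lt_le (k := fun i => -k i) (b := -a) (finrank_range_inf hw hKw hr) hv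
    (LinearMap.codRestrict _ (K - (innerₗ (Euc n) w).smulRight w) fun ξ => by
      refine Submodule.mem_inf.2 ⟨⟨ξ - (inner ℝ w ξ : ℝ) • w, by simp [hKw]⟩, ?_⟩
      rw [Submodule.mem_orthogonal_singleton_iff_inner_right]
      simp only [LinearMap.sub_apply, LinearMap.smulRight_apply, innerₗ_apply_apply, inner_sub_right,
        real_inner_smul_right, hww, ← hs, hKw]
      ring) fun y hy => by
      have h1 : K (∑ i, y i • v i) - (inner ℝ w (∑ i, y i • v i) : ℝ) • w = 0 :=
        congrArg Subtype.val hy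
      have h2 : inner ℝ w (∑ i, y i • v i) = (0 : ℝ) := by
        simp [inner_sum, real_inner_smul_right, hvw]
      rw [h2, zero_smul, sub_zero] at h1
      have h3 := h y
      rw [h1, inner_zero_left] at h3
      simp only [neg_mul, Finset.sum_neg_distrib]
      linarith
  -- The exceptional entries are padded to exactly d - 1 indices. There the bound b is used, which
  -- holds for every entry.
  obtain ⟨S, hS, -, hSc⟩ := Finset.exists_subsuperset_card_eq
    (Finset.subset_univ (Finset.univ.filter fun i => -k i < -a)) hcard
    (by simp; omega)
  obtain ⟨σ, hσ⟩ := exists_perm_mem_iff S hSc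
  refine ⟨σ, fun i => ?_⟩
  rw [twoValued]
  split_ifs with hlt
  · have h2 := h (Pi.single (σ i) 1)
    simp only [Pi.single_apply, ite_smul, one_smul, zero_smul, Finset.sum_ite_eq',
      Finset.mem_univ, if_true, hv.1, ite_pow, one_pow, mul_ite, mul_one] at h2
    simp at h2
    rcases hab with hab | rfl
    · have h3 := mul_le_mul_of_nonneg_left (inner_proj_le hs hi (v (σ i))) (sub_nonneg.2 hab)
      rw [hv.1] at h3
      linarith
    · rw [eq_of_finrank_range hi hr, real_inner_self_eq_norm_sq, hv.1] at h2
      linarith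
  · by_contra! hk
    exact hlt ((hσ i).1 (hS (Finset.mem_filter.2 ⟨Finset.mem_univ _, neg_lt_neg hk⟩)))

end Count

/-! ### Monotonicity of Weingarten functions -/

namespace IsWeingarten

variable {n : ℕ} {Γ : Set (Fin n → ℝ)} {W : (Fin n → ℝ) → ℝ} (hW : IsWeingarten Γ W)
include hW

/-- Coordinates are raised one at a time. Starting in the positive cone, every intermediate segment
stays there, so monotonicity along segments suffices although Γ need not be convex. -/
lemma mono {k k' : Fin n → ℝ} (hk : ∀ i, 0 < k i) (hkk : ∀ i, k i ≤ k' i) : W k ≤ W k' := by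
  classical
  have key : ∀ s : Finset (Fin n), W k ≤ W (s.piecewise k' k) := fun s => by
    induction s using Finset.induction_on with
    | empty => simp
    | insert i s hi ih =>
      refine ih.trans ?_
      have hpos : ∀ j, 0 < s.piecewise k' k j := fun j => by
        by_cases hj : j ∈ s
        · simpa [hj] using (hk j).trans_le (hkk j)
        · simpa [hj] using hk j
      have e : (insert i s).piecewise k' k = s.piecewise k' k + Pi.single i (k' i - k i) := by
        ext j
        rcases eq_or_ne j i with rfl | hj
        · simp [hi]
        · by_cases hjs : j ∈ s <;> simp [hj, hjs]
      rw [e]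
      refine hW.increasing _ (hW.cone_subset hpos) i _ (sub_nonneg.2 (hkk i)) fun u hu => ?_
      refine hW.cone_subset fun j => add_pos_of_pos_of_nonneg (hpos j) ?_
      rcases eq_or_ne j i with rfl | hj
      · simpa using hu.1
      · simp [hj]
  simpa using key Finset.univ

/-- Only the smaller list has to be positive; the larger one then lies in the cone automatically. -/
lemma le_of_perm {k k' : Fin n → ℝ} (hk : ∀ i, 0 < k i) (σ : Equiv.Perm (Fin n))
    (h : ∀ i, k i ≤ k' (σ i)) : W k ≤ W k' := by
  have hpos : ∀ i, 0 < k' (σ i) := fun i => (hk i).trans_le (h i)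
  have hpos' : ∀ i, 0 < k' i := fun i => by simpa using hpos (σ.symm i)
  rw [← hW.symmetric k' (hW.cone_subset hpos') σ (hW.cone_subset hpos)]
  exact hW.mono hk h

lemma ge_of_perm {k k' : Fin n → ℝ} (hk' : ∀ i, 0 < k' i) (σ : Equiv.Perm (Fin n))
    (h : ∀ i, k' (σ i) ≤ k i) : W k' ≤ W k := by
  rw [← hW.symmetric k' (hW.cone_subset hk') σ (hW.cone_subset fun i => hk' _)]
  exact hW.mono (fun i => hk' _) h

end IsWeingarten

/-! ### Curves in the hypersurface. -/

section Hypersurface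

variable {n : ℕ} {M : Type*} [TopologicalSpace M] [ChartedSpace (EuclideanSpace ℝ (Fin n)) M]

/-- The coordinate line through `p` with velocity `X`. -/
def coordLine (p : M) (X : EuclideanSpace ℝ (Fin n)) (s : ℝ) : M :=
  (extChartAt (𝓡 n) p).symm (extChartAt (𝓡 n) p p + s • X)

@[simp] lemma coordLine_zero (p : M) (X : EuclideanSpace ℝ (Fin n)) : coordLine p X 0 = p := by
  rw [coordLine, zero_smul, add_zero, extChartAt_to_inv]

variable [IsManifold (𝓡 n) ∞ M] {V : Type*} [NormedAddCommGroup V] [NormedSpace ℝ V]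

lemma contMDiffAt_coordLine (p : M) (X : EuclideanSpace ℝ (Fin n)) :
    ContMDiffAt 𝓘(ℝ, ℝ) (𝓡 n) ∞ (coordLine p X) 0 := by
  have h1 : ContMDiffAt 𝓘(ℝ, EuclideanSpace ℝ (Fin n)) (𝓡 n) ∞ (extChartAt (𝓡 n) p).symm
      (extChartAt (𝓡 n) p p) :=
    (contMDiffOn_extChartAt_symm p).contMDiffAt (extChartAt_target_mem_nhds p)
  have h2 : ContMDiffAt 𝓘(ℝ, ℝ) 𝓘(ℝ, EuclideanSpace ℝ (Fin n)) ∞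
      (fun s : ℝ => extChartAt (𝓡 n) p p + s • X) 0 :=
    (contDiff_const.add (contDiff_id.smul contDiff_const)).contMDiff.contMDiffAt
  refine ContMDiffAt.comp (0 : ℝ) ?_ h2
  rw [zero_smul, add_zero]
  exact h1

lemma contDiffAt_comp_coordLine {g : M → V} (hg : ContMDiff (𝓡 n) 𝓘(ℝ, V) ∞ g) (p : M)
    (X : EuclideanSpace ℝ (Fin n)) : ContDiffAt ℝ ∞ (fun s => g (coordLine p X s)) 0 :=
  (ContMDiffAt.comp (0 : ℝ) hg.contMDiffAt (contMDiffAt_coordLine p X)).contDiffAt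

omit [IsManifold (𝓡 n) ∞ M] in
lemma hasDerivAt_comp_coordLine {g : M → V} (hg : ContMDiff (𝓡 n) 𝓘(ℝ, V) ∞ g) (p : M)
    (X : EuclideanSpace ℝ (Fin n)) :
    HasDerivAt (fun s => g (coordLine p X s)) (mfderiv (𝓡 n) 𝓘(ℝ, V) g p X) 0 := by
  have h := hg.mdifferentiable (by simp) p
  have h1 := h.hasMFDerivAt.2
  rw [ModelWithCorners.range_eq_univ] at h1
  have h2 : HasDerivAt (fun s : ℝ => extChartAt (𝓡 n) p p + s • X)
      X 0 := by
    simpa only [id, one_smul] using ((hasDerivAt_id (0 : ℝ)).smul_const X).const_add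
      (extChartAt (𝓡 n) p p)
  exact HasFDerivAt.comp_hasDerivAt_of_eq (0 : ℝ) (hasFDerivWithinAt_univ.1 h1) h2
    (by rw [zero_smul, add_zero])

/-- Near `0` the velocities of the image of a coordinate line are in the range of the
differential. -/
lemma eventually_deriv_comp_coordLine {g : M → V} (hg : ContMDiff (𝓡 n) 𝓘(ℝ, V) ∞ g) (p : M)
    (X : EuclideanSpace ℝ (Fin n)) : ∀ᶠ s in 𝓝 (0 : ℝ), ∃ Y : TangentSpace (𝓡 n) (coordLine p X s),
      deriv (fun s => g (coordLine p X s)) s = mfderiv (𝓡 n) 𝓘(ℝ, V) g (coordLine p X s) Y := by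
  have h1 : ContMDiffAt 𝓘(ℝ, ℝ) (𝓡 n) 1 (coordLine p X) 0 :=
    (contMDiffAt_coordLine p X).of_le (by norm_cast)
  filter_upwards [contMDiffAt_iff_contMDiffAt_nhds (by simp) |>.1 h1] with s hs
  have h2 := (hs.mdifferentiableAt (by simp)).hasMFDerivAt
  have h3 := (hg.mdifferentiable (by simp) (coordLine p X s)).hasMFDerivAt
  have h4 : HasFDerivAt (fun s => g (coordLine p X s)) (show ℝ →L[ℝ] V from
      (mfderiv (𝓡 n) 𝓘(ℝ, V) g (coordLine p X s)).comp
        (mfderiv 𝓘(ℝ, ℝ) (𝓡 n) (coordLine p X) s)) s :=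
    hasMFDerivAt_iff_hasFDerivAt.1 (h3.comp s h2)
  exact ⟨_, h4.hasDerivAt.deriv⟩

/-- Every tangent vector of `M` is the velocity of a smooth curve. -/
lemma exists_curve (A : Ambient) (p : M) (X : TangentSpace (𝓡 n) p) :
    ∃ c : ℝ → M, c 0 = p ∧ ContinuousAt c 0 ∧ ∀ g : M → A.V, ContMDiff (𝓡 n) 𝓘(ℝ, A.V) ∞ g →
      ContDiffAt ℝ ∞ (fun s => g (c s)) 0 ∧
      HasDerivAt (fun s => g (c s)) (differential n A g p X) 0 ∧
      ∀ᶠ s in 𝓝 (0 : ℝ), ∃ Y, deriv (fun s => g (c s)) s = differential n A g (c s) Y :=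
  ⟨coordLine p X, coordLine_zero p X, (contMDiffAt_coordLine p X).continuousAt, fun _ hg =>
    ⟨contDiffAt_comp_coordLine hg p X, hasDerivAt_comp_coordLine hg p X,
      eventually_deriv_comp_coordLine hg p X⟩⟩

end Hypersurface

/-- A positive second derivative would make 0 a local minimum as well, hence h locally constant and
its second derivative zero. -/
lemma deriv_deriv_nonpos_of_isLocalMax {h : ℝ → ℝ} (hmax : IsLocalMax h 0)
    (hc : ContinuousAt h 0) : deriv (deriv h) 0 ≤ 0 := by
  by_contra! hpos
  have hmin := isLocalMin_of_deriv_deriv_pos hpos hmax.deriv_eq_zero hc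
  have hconst : h =ᶠ[𝓝 0] fun _ => h 0 := by
    filter_upwards [hmax, hmin] with s h1 h2 using le_antisymm h1 h2
  have := hconst.deriv.deriv.eq_of_nhds
  simp at this
  linarith

/-! ### Second derivatives along curves. -/

section SecondOrder

variable {A : Ambient} [FiniteDimensional ℝ A.V]

omit [FiniteDimensional ℝ A.V] in
lemma _root_.ContDiffAt.eventually_hasDerivAt {c : ℝ → A.V} (hc : ContDiffAt ℝ ∞ c 0) :
    ∀ᶠ s in 𝓝 (0 : ℝ), HasDerivAt c (deriv c s) s := by
  have h1 : ContDiffAt ℝ 1 c 0 := hc.of_le (by norm_cast)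
  filter_upwards [h1.eventually (by simp)] with s hs using (hs.differentiableAt (by simp)).hasDerivAt

omit [FiniteDimensional ℝ A.V] in
lemma _root_.ContDiffAt.hasDerivAt_deriv {c : ℝ → A.V} (hc : ContDiffAt ℝ ∞ c 0) :
    HasDerivAt (deriv c) (deriv (deriv c) 0) 0 := by
  have h1 : ContDiffAt ℝ 1 (deriv c) 0 :=
    (hc.fderiv_right (m := 1) (by norm_cast)).clm_apply contDiffAt_const
  exact (h1.differentiableAt (by simp)).hasDerivAt

/-- Differentiating ⟨b, c'⟩ = 0 moves the second derivative from the curve to b. With b = N this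
turns information on dN into the normal acceleration. -/
lemma form_deriv_deriv_eq {c b : ℝ → A.V} (hc : ContDiffAt ℝ ∞ c 0) {b' : A.V}
    (hb : HasDerivAt b b' 0) (h : ∀ᶠ s in 𝓝 0, A.form (b s) (deriv c s) = 0) :
    A.form (b 0) (deriv (deriv c) 0) = -A.form b' (deriv c 0) := by
  have h1 := hasDerivAt_form hb hc.hasDerivAt_deriv
  have h2 : HasDerivAt (fun s => A.form (b s) (deriv c s)) 0 0 :=
    (hasDerivAt_const (0 : ℝ) (0 : ℝ)).congr_of_eventuallyEq h
  linarith [h1.unique h2]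

lemma hasDerivAt_chord (hsymm : ∀ x y, A.form x y = A.form y x) (o : A.V) {c : ℝ → A.V} {c' : A.V}
    {u : Set ℝ} {s : ℝ} (hc : HasDerivWithinAt c c' u s) :
    HasDerivWithinAt (fun s => A.chord o (c s)) (A.form (c s - o) c') u s := by
  have h := (hasDerivWithinAt_form (hc.sub_const o) (hc.sub_const o)).div_const 2
  refine h.congr_deriv ?_
  rw [hsymm c']
  ring

lemma deriv_deriv_chord (hsymm : ∀ x y, A.form x y = A.form y x) (o : A.V) {c : ℝ → A.V}
    (hc : ContDiffAt ℝ ∞ c 0) :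
    deriv (deriv fun s => A.chord o (c s)) 0 =
      A.form (deriv c 0) (deriv c 0) + A.form (c 0 - o) (deriv (deriv c) 0) := by
  have h1 : (deriv fun s => A.chord o (c s)) =ᶠ[𝓝 0] fun s => A.form (c s - o) (deriv c s) := by
    filter_upwards [hc.eventually_hasDerivAt] with s hs
    have := hasDerivAt_chord hsymm o hs.hasDerivWithinAt (u := univ)
    exact (hasDerivWithinAt_univ.1 this).deriv
  rw [h1.deriv_eq, (hasDerivAt_form (hc.eventually_hasDerivAt.self_of_nhds.sub_const o)
    hc.hasDerivAt_deriv).deriv, add_comm]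

end SecondOrder

/-! ### Contact of a hypersurface with a geodesic sphere. -/

section Touching

variable {n : ℕ} {A : Ambient} {G : Geometry A n} {M : Type*} [TopologicalSpace M]
  [ChartedSpace (EuclideanSpace ℝ (Fin n)) M] [IsManifold (𝓡 n) ∞ M] {f N : M → A.V}

lemma differential_mem_tangent (hmem : ∀ p, f p ∈ A.carrier)
    (hf : ContMDiff (𝓡 n) 𝓘(ℝ, A.V) ∞ f) (p : M) (X : TangentSpace (𝓡 n) p) :
    differential n A f p X ∈ A.tangent (f p) := by
  obtain ⟨c, h0, -, hc⟩ := exists_curve A p X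
  exact ⟨fun s => f (c s), fun s => hmem _, congrArg f h0, (hc f hf).2.1⟩

/-- An orthonormal family of `n` vectors in `ℝ^(n+1)` has at most two unit normals. -/
lemma eq_or_eq_neg_of_orthonormal {v : Fin n → Euc n} (hv : Orthonormal ℝ v) {w u : Euc n}
    (hw : ‖w‖ = 1) (hu : ‖u‖ = 1) (hwv : ∀ i, inner ℝ (v i) w = 0)
    (huv : ∀ i, inner ℝ (v i) u = 0) : u = w ∨ u = -w := by
  have h1 : Module.finrank ℝ (Submodule.span ℝ (range v))ᗮ = 1 := by
    have := Submodule.finrank_add_finrank_orthogonal (Submodule.span ℝ (range v))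
    rw [finrank_span_eq_card hv.linearIndependent] at this
    simp at this
    omega
  have hmem : ∀ {z : Euc n}, (∀ i, inner ℝ (v i) z = 0) → z ∈ (Submodule.span ℝ (range v))ᗮ := by
    intro z hz
    rw [Submodule.mem_orthogonal]
    intro y hy
    induction hy using Submodule.span_induction with
    | mem y hy => obtain ⟨i, rfl⟩ := hy; exact hz i
    | zero => simp
    | add x y _ _ hx hy => rw [inner_add_left, hx, hy, add_zero]
    | smul c x _ hx => rw [real_inner_smul_left, hx, mul_zero]
  have hw0 : w ≠ 0 := fun h => by simp [h] at hw
  obtain ⟨c, hc⟩ := (finrank_eq_one_iff_of_nonzero' (⟨w, hmem hwv⟩ : (Submodule.span ℝ (range v))ᗮ)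
    (fun h => hw0 (congrArg Subtype.val h))).1 h1 ⟨u, hmem huv⟩
  have hc' : c • w = u := congrArg Subtype.val hc
  have : |c| = 1 := by
    rw [← hc', norm_smul, hw, mul_one] at hu
    exact hu
  rcases eq_or_eq_neg_of_abs_eq this with rfl | rfl
  · left; simpa using hc'.symm
  · right; simpa using hc'.symm

variable (G)

/-- At a critical point of the distance from `o` on a hypersurface the normal points to or away
from `o`, and the second derivatives of the distance are given by the principal curvatures. -/
lemma touching (hH : IsOrientedHypersurface n A f N) (hf : ContMDiff (𝓡 n) 𝓘(ℝ, A.V) ∞ f)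
    (hN : ContMDiff (𝓡 n) 𝓘(ℝ, A.V) ∞ N) {p : M} (P : Polar A n G.profile G.d (f p)) {r : ℝ}
    (hr : r ∈ G.profile.I) {w : Euc n} (hw : ‖w‖ = 1) {o : A.V} (ho : o = P.exp w r)
    (hcrit : ∀ X, A.form (f p - o) (differential n A f p X) = 0) {k : Fin n → ℝ}
    (hk : IsPrincipalCurvatures A f N p k) :
    ∃ ε : ℝ, (ε = 1 ∨ ε = -1) ∧ N p = ε • P.ι w ∧ ∃ v : Fin n → Euc n, Orthonormal ℝ v ∧
      (∀ i, inner ℝ w (v i) = 0) ∧ ∀ y : Fin n → ℝ, ∃ c : ℝ → M, c 0 = p ∧ ContinuousAt c 0 ∧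
        deriv (deriv fun s => A.chord o (f (c s))) 0 = ‖∑ i, y i • v i‖ ^ 2 -
          G.profile.S r * (ε * ∑ i, k i * y i ^ 2) - G.profile.C r * (G.profile.κ / 2 *
          (‖∑ i, y i • v i‖ ^ 2 + inner ℝ (P.K w (∑ i, y i • v i)) (∑ i, y i • v i))) := by
  have := G.finiteDimensional
  obtain ⟨e, he, hke⟩ := hk
  have hrange : ∀ X, ∃ u, P.ι u = differential n A f p X := fun X => by
    have := differential_mem_tangent hH.mem hf p X
    rwa [P.tangent_eq] at this
  choose lift hlift using hrange
  obtain ⟨u, hu⟩ : ∃ u, P.ι u = N p := by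
    have := hH.tangent p
    rwa [P.tangent_eq] at this
  have hfo : f p - o = -(G.profile.S r • P.ι w + G.profile.C r • P.β w w) := by
    rw [ho, Polar.exp]; abel
  have hv : Orthonormal ℝ fun i => lift (e i) := by
    rw [orthonormal_iff_ite]
    intro i j
    rw [← P.form_ι, hlift, hlift, he]
  -- β w w is orthogonal to the tangent space, so criticality only sees S r ⟨w, lift X⟩, and S r >
  -- 0.
  have hwv : ∀ X, inner ℝ w (lift X) = 0 := fun X => by
    have h1 := hcrit X
    rw [hfo, ← hlift] at h1
    simp only [map_neg, map_add, map_smul, LinearMap.neg_apply, LinearMap.add_apply,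
      LinearMap.smul_apply, smul_eq_mul, P.form_ι, P.form_β_ι, mul_zero, add_zero,
      neg_eq_zero] at h1
    exact (mul_eq_zero.1 h1).resolve_left (G.profile.S_pos r hr).ne'
  have hu1 : ‖u‖ = 1 := by
    have h1 := hH.unit p
    rw [← hu, P.form_ι, real_inner_self_eq_norm_sq] at h1
    exact (pow_eq_one_iff_of_nonneg (norm_nonneg _) two_ne_zero).1 h1
  have huv : ∀ X, inner ℝ u (lift X) = 0 := fun X => by
    rw [← P.form_ι, hu, hlift, hH.normal]
  -- w and the unit normal are both orthogonal to the n lifted basis vectors in ℝ^(n+1), so they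
  -- agree up to sign.
  obtain ⟨ε, hε, huε⟩ : ∃ ε : ℝ, (ε = 1 ∨ ε = -1) ∧ u = ε • w := by
    rcases eq_or_eq_neg_of_orthonormal hv hw hu1 (fun i => by rw [real_inner_comm]; exact hwv _)
      (fun i => by rw [real_inner_comm]; exact huv _) with h | h
    · exact ⟨1, Or.inl rfl, by rw [one_smul, h]⟩
    · exact ⟨-1, Or.inr rfl, by rw [neg_smul, one_smul, h]⟩
  have hNw : N p = ε • P.ι w := by rw [← hu, huε, map_smul]
  have hε2 : ε * ε = 1 := by rcases hε with rfl | rfl <;> norm_num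
  refine ⟨ε, hε, hNw, _, hv, fun i => hwv _, fun y => ?_⟩
  let X : TangentSpace (𝓡 n) p := ∑ i, y i • e i
  have hX : ∀ g : M → A.V, differential n A g p X = ∑ i, y i • differential n A g p (e i) :=
    fun g => by simp only [X, map_sum, map_smul]
  have hξ : P.ι (∑ i, y i • lift (e i)) = differential n A f p X := by
    rw [hX, map_sum]
    exact Finset.sum_congr rfl fun i _ => by rw [map_smul, hlift]
  obtain ⟨c, hc0, hcc, hcg⟩ := exists_curve A p X
  obtain ⟨hc, hd, hev⟩ := hcg f hf
  have hb := (hcg N hN).2.1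
  have hII := form_deriv_deriv_eq hc hb (by
    filter_upwards [hev] with s ⟨Y, hY⟩
    rw [hY]
    exact hH.normal _ Y)
  refine ⟨c, hc0, hcc, ?_⟩
  rw [deriv_deriv_chord G.symm o hc, hd.deriv]
  -- Here f p - o = -(S ι w + C β w w). Paired with the acceleration, the ι w part gives the second
  -- fundamental form of the hypersurface and the β w w part the ambient term from `sff`.
  have hsff := P.sff _ (Eventually.of_forall fun s => hH.mem (c s)) (by rw [hc0])
    (hc.of_le (by norm_cast)) w (∑ i, y i • lift (e i)) (by rw [hd.deriv, hξ])
  have hkX : A.form (differential n A N p X) (differential n A f p X) = -∑ i, k i * y i ^ 2 := by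
    have h1 : ∀ i j, A.form (differential n A N p (e i)) (differential n A f p (e j)) =
        -if i = j then k i else 0 := fun i j => by rw [← hke i j, neg_neg]
    simp only [hX, map_sum, LinearMap.sum_apply, map_smul, LinearMap.smul_apply, smul_eq_mul, h1,
      ← Finset.sum_neg_distrib]
    refine Finset.sum_congr rfl fun i _ => ?_
    simp
    ring
  rw [hd.deriv] at hII
  have hII' : A.form (N p) (deriv (deriv fun s => f (c s)) 0) = ∑ i, k i * y i ^ 2 := by
    rw [← hc0, hII, hkX, neg_neg]
  have hw2 : A.form (P.ι w) (deriv (deriv fun s => f (c s)) 0) =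
      ε * ∑ i, k i * y i ^ 2 := by
    rw [← hII', hNw, map_smul, LinearMap.smul_apply, smul_eq_mul, ← mul_assoc, hε2, one_mul]
  have hnorm : A.form (differential n A f p X) (differential n A f p X) =
      ‖∑ i, y i • lift (e i)‖ ^ 2 := by
    rw [← real_inner_self_eq_norm_sq, ← P.form_ι, hξ]
  rw [hnorm, hc0, hfo]
  simp only [map_neg, map_add, map_smul, LinearMap.neg_apply, LinearMap.add_apply,
    LinearMap.smul_apply, smul_eq_mul, hw2, hsff, hw, one_pow, one_mul]
  ring

end Touching

/-! ### The radius of a shrinking sphere -/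

section Clock

/-- Smoothness of solutions of `ρ' = g ∘ ρ`. -/
lemma contDiffOn_of_autonomous {ρ g : ℝ → ℝ} {O U : Set ℝ} (hO : IsOpen O)
    (hmaps : MapsTo ρ O U) (hg : ContDiffOn ℝ ∞ g U) (hρ : ∀ t ∈ O, HasDerivAt ρ (g (ρ t)) t) :
    ContDiffOn ℝ ∞ ρ O := by
  rw [contDiffOn_infty]
  intro m
  -- Bootstrap: if ρ is C^m, so is its derivative g ∘ ρ.
  induction m with
  | zero => exact contDiffOn_zero.2 fun t ht => (hρ t ht).continuousAt.continuousWithinAt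
  | succ m ih =>
    rw [show ((m + 1 : ℕ) : WithTop ℕ∞) = (m : WithTop ℕ∞) + 1 by norm_cast,
      contDiffOn_succ_iff_deriv_of_isOpen hO]
    refine ⟨fun t ht => (hρ t ht).differentiableAt.differentiableWithinAt, by simp, ?_⟩
    exact ((hg.of_le (by norm_cast; exact le_top)).comp ih hmaps).congr fun t ht => (hρ t ht).deriv

/-- A solution of `ρ' = -f ∘ ρ` on its maximal interval, for a positive decreasing speed `f`, and
the time function `Φ`, a primitive of `1 / f`. -/
lemma exists_clock {f : ℝ → ℝ} {R R₁ : ℝ} (hR : 0 < R) (hRR : R < R₁)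
    (hpos : ∀ r ∈ Ioc 0 R₁, 0 < f r) (hanti : AntitoneOn f (Ioc 0 R₁))
    (hf : ContDiffOn ℝ ∞ f (Ioo 0 R₁)) :
    ∃ Φ ρ : ℝ → ℝ, Continuous Φ ∧ Φ 0 = 0 ∧ StrictMonoOn Φ (Ici 0) ∧
      (∀ r ∈ Ioo 0 R₁, HasDerivAt Φ (f r)⁻¹ r) ∧ ρ 0 = R ∧
      ∃ δ > 0, (∀ t ∈ Ioo (-δ) (Φ R), ρ t ∈ Ioo 0 R₁ ∧ Φ (ρ t) = Φ R - t ∧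
        HasDerivAt ρ (-f (ρ t)) t) ∧ ContDiffOn ℝ ∞ ρ (Ioo (-δ) (Φ R)) := by
  have hR₁ : 0 < R₁ := hR.trans hRR
  -- 1/f, continued by 0 on the left and by a constant on the right. It is monotone because f
  -- decreases, hence integrable even if f is unbounded near 0. This is why the collapsing time is
  -- finite.
  let inv : ℝ → ℝ := fun r => if 0 < r then (f (min r R₁))⁻¹ else 0
  have hmem : ∀ r, 0 < r → min r R₁ ∈ Ioc 0 R₁ := fun r hr => ⟨lt_min hr hR₁, min_le_right _ _⟩
  have hinv_pos : ∀ r, 0 < r → 0 < inv r := fun r hr => by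
    simp only [inv, hr, if_true]; exact inv_pos.2 (hpos _ (hmem r hr))
  have hinv_mono : Monotone inv := fun r s hrs => by
    by_cases hr : 0 < r
    · have hs := hr.trans_le hrs
      simp only [inv, hr, hs, if_true]
      exact inv_anti₀ (hpos _ (hmem s hs)) (hanti (hmem r hr) (hmem s hs) (min_le_min_right _ hrs))
    · by_cases hs : 0 < s
      · have := hinv_pos s hs
        simp only [inv, hr, if_false] at this ⊢
        exact this.le
      · simp [inv, hr, hs]
  have hint : ∀ a b, IntervalIntegrable inv MeasureTheory.volume a b :=
    fun a b => hinv_mono.intervalIntegrable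
  let Φ : ℝ → ℝ := fun r => ∫ s in (0 : ℝ)..r, inv s
  have hΦc : Continuous Φ := intervalIntegral.continuous_primitive hint 0
  have hΦ0 : Φ 0 = 0 := intervalIntegral.integral_same
  have hΦm : StrictMonoOn Φ (Ici 0) := fun r hr s _ hrs => by
    have h1 : Φ s - Φ r = ∫ u in r..s, inv u :=
      intervalIntegral.integral_interval_sub_left (hint _ _) (hint _ _)
    have h2 : 0 < ∫ u in r..s, inv u := intervalIntegral.intervalIntegral_pos_of_pos_on (hint _ _)
      (fun u hu => hinv_pos u (lt_of_le_of_lt hr hu.1)) hrs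
    linarith
  have hinv_eq : ∀ r ∈ Ioo 0 R₁, inv r = (f r)⁻¹ := fun r hr => by
    simp [inv, hr.1, min_eq_left hr.2.le]
  have hinv_cont : ∀ r ∈ Ioo 0 R₁, ContinuousAt inv r := fun r hr => by
    have h1 : ContinuousAt f r := hf.continuousOn.continuousAt (isOpen_Ioo.mem_nhds hr)
    refine (h1.inv₀ (hpos r ⟨hr.1, hr.2.le⟩).ne').congr ?_
    filter_upwards [isOpen_Ioo.mem_nhds hr] with s hs using (hinv_eq s hs).symm
  have hΦd : ∀ r ∈ Ioo 0 R₁, HasDerivAt Φ (f r)⁻¹ r := fun r hr => by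
    rw [← hinv_eq r hr]
    exact intervalIntegral.integral_hasDerivAt_right (hint _ _)
      (hinv_mono.measurable.stronglyMeasurable.stronglyMeasurableAtFilter) (hinv_cont r hr)
  -- Φ on [0, R₁], continued with slope 1 on both sides to an increasing bijection of the line, so
  -- that a global continuous inverse is available.
  let Ψ : ℝ → ℝ := fun r => Φ (max 0 (min r R₁)) + min r 0 + max (r - R₁) 0
  have hΦm' : ∀ {x y}, x ≤ y → Φ (max 0 (min x R₁)) ≤ Φ (max 0 (min y R₁)) := fun {x y} h =>
    hΦm.monotoneOn (mem_Ici.2 (le_max_left _ _)) (mem_Ici.2 (le_max_left _ _)) (max_le_max_left _ (min_le_min_right _ h))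
  have hΨm : StrictMono Ψ := fun x y hxy => by
    have h1 := hΦm' hxy.le
    have h2 : min x 0 ≤ min y 0 := min_le_min_right _ hxy.le
    have h3 : max (x - R₁) 0 ≤ max (y - R₁) 0 := max_le_max_right _ (by linarith)
    simp only [Ψ]
    rcases le_or_gt y 0 with hy | hy
    · have : min x 0 < min y 0 := by rwa [min_eq_left hy, min_eq_left (hxy.le.trans hy)]
      linarith
    · rcases le_or_gt R₁ x with hx | hx
      · have : max (x - R₁) 0 < max (y - R₁) 0 := by
          rw [max_eq_left (by linarith), max_eq_left (by linarith)]; linarith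
        linarith
      · have : Φ (max 0 (min x R₁)) < Φ (max 0 (min y R₁)) := by
          refine hΦm (mem_Ici.2 (le_max_left _ _)) (mem_Ici.2 (le_max_left _ _)) ?_
          rw [min_eq_left hx.le]
          refine lt_of_lt_of_le ?_ (le_max_right _ _)
          exact lt_min (max_lt hy hxy) (max_lt hR₁ hx)
        linarith
  have hΨc : Continuous Ψ := by
    refine Continuous.add (Continuous.add (hΦc.comp ?_) ?_) ?_ <;> fun_prop
  have hΨs : Function.Surjective Ψ := by
    refine hΨc.surjective ?_ ?_
    · refine tendsto_atTop_mono' _ ?_ (tendsto_atTop_add_const_right atTop (-R₁) tendsto_id)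
      filter_upwards [eventually_ge_atTop 0] with r hr
      have h1 : 0 ≤ Φ (max 0 (min r R₁)) := by
        exact hΦ0.ge.trans (hΦm.monotoneOn self_mem_Ici (mem_Ici.2 (le_max_left _ _)) (le_max_left _ _))
      have h2 := le_max_left (r - R₁) 0
      simp only [Ψ, min_eq_right hr, id]
      linarith
    · refine tendsto_id.congr' ?_
      filter_upwards [eventually_le_atBot 0] with r hr
      simp [Ψ, hr, hΦ0, (hr.trans hR₁.le)]
  have hΨΦ : ∀ r ∈ Icc 0 R₁, Ψ r = Φ r := fun r hr => by
    simp [Ψ, hr.1, hr.2]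
  let e := hΨm.orderIsoOfSurjective Ψ hΨs
  have he : ∀ r, e r = Ψ r := fun r => rfl
  have hes : ∀ r, e.symm (Ψ r) = r := fun r => by rw [← he, e.symm_apply_apply]
  -- Separation of variables: Φ(ρ) = Φ(R) - t. Since R < R₁ the solution also exists for small
  -- negative times, and its derivative at 0 is two-sided.
  let ρ : ℝ → ℝ := fun t => e.symm (Φ R - t)
  have hΦR : Φ R < Φ R₁ := hΦm hR.le hR₁.le hRR
  have hρmem : ∀ t ∈ Ioo (-(Φ R₁ - Φ R)) (Φ R), ρ t ∈ Ioo 0 R₁ := fun t ht => by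
    constructor
    · rw [← hes 0, hΨΦ 0 ⟨le_rfl, hR₁.le⟩, hΦ0]
      exact e.symm.lt_iff_lt.2 (by linarith [ht.2])
    · rw [← hes R₁, hΨΦ R₁ ⟨hR₁.le, le_rfl⟩]
      exact e.symm.lt_iff_lt.2 (by linarith [ht.1])
  have hρd : ∀ t ∈ Ioo (-(Φ R₁ - Φ R)) (Φ R), HasDerivAt ρ (-f (ρ t)) t := fun t ht => by
    have hm := hρmem t ht
    have h1 : HasDerivAt Ψ (f (ρ t))⁻¹ (ρ t) := (hΦd _ hm).congr_of_eventuallyEq <| by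
      filter_upwards [isOpen_Ioo.mem_nhds hm] with s hs using hΨΦ s ⟨hs.1.le, hs.2.le⟩
    have h2 : HasDerivAt e.symm (f (ρ t))⁻¹⁻¹ (Φ R - t) :=
      HasDerivAt.of_local_left_inverse e.symm.continuous.continuousAt h1
        (inv_ne_zero (hpos _ ⟨hm.1, hm.2.le⟩).ne') (Eventually.of_forall fun y => e.apply_symm_apply y)
    rw [inv_inv] at h2
    exact (h2.comp t ((hasDerivAt_id t).const_sub (Φ R))).congr_deriv (by simp)
  refine ⟨Φ, ρ, hΦc, hΦ0, hΦm, hΦd, ?_, Φ R₁ - Φ R, sub_pos.2 hΦR, fun t ht =>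
    ⟨hρmem t ht, ?_, hρd t ht⟩, contDiffOn_of_autonomous isOpen_Ioo hρmem hf.neg hρd⟩
  · simp only [ρ, sub_zero, ← hΨΦ R ⟨hR.le, hRR.le⟩, hes]
  · rw [← hΨΦ _ ⟨(hρmem t ht).1.le, (hρmem t ht).2.le⟩]
    exact e.apply_symm_apply _

end Clock

/-! ### Principal curvatures and speed of geodesic spheres -/

namespace Geometry

variable {A : Ambient} {n : ℕ} (G : Geometry A n)

/-- The principal curvatures of the geodesic sphere of radius `r` with inward orientation. -/
def curv (r : ℝ) : Fin n → ℝ :=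
  twoValued n G.d ((1 - G.profile.κ * G.profile.C r / 2) / G.profile.S r)
    ((1 - G.profile.κ * G.profile.C r) / G.profile.S r)

variable {G}

lemma curv_pos {r : ℝ} (hr : r ∈ G.profile.I) (i : Fin n) : 0 < G.curv r i := by
  rw [curv, twoValued]
  split_ifs
  · exact div_pos (G.profile.cos_pos r hr) (G.profile.S_pos r hr)
  · exact div_pos (G.profile.half_pos hr) (G.profile.S_pos r hr)

/-- For κ ≤ 0 the directions of extremal curvature have the larger principal curvature; otherwise d
= n + 1 and only one value occurs. `exists_perm_ge` and `exists_perm_le` need this order. -/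
lemma curv_le (r : ℝ) (hr : r ∈ G.profile.I) :
    ((1 - G.profile.κ * G.profile.C r / 2) / G.profile.S r) ≤
    ((1 - G.profile.κ * G.profile.C r) / G.profile.S r) ∨ G.d = n + 1 := by
  refine G.d_eq.imp_left fun h => ?_
  have h1 := mul_nonneg (neg_nonneg.2 h) (G.profile.C_pos hr).le
  exact div_le_div_of_nonneg_right (by linarith) (G.profile.S_pos r hr).le

/-- The quotients occurring as curvatures decrease. -/
lemma antitoneOn_quotient {c : ℝ} (hc : c = 1 ∨ c = 1 / 2) :
    AntitoneOn (fun r => (1 - G.profile.κ * G.profile.C r * c) / G.profile.S r) G.profile.I := by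
  intro r hr s hs hrs
  have hsub : Icc r s ⊆ G.profile.I := fun u hu =>
    G.profile.mem_I s hs u ((G.profile.pos r hr).trans_le hu.1) hu.2
  have hd : ∀ u ∈ Icc r s, HasDerivAt (fun r => (1 - G.profile.κ * G.profile.C r * c) / G.profile.S r)
      ((-(G.profile.κ * G.profile.S u * c) * G.profile.S u -
        (1 - G.profile.κ * G.profile.C u * c) * (1 - G.profile.κ * G.profile.C u)) /
        G.profile.S u ^ 2) u := fun u hu =>
    ((((G.profile.hasDerivAt_C u).const_mul G.profile.κ).mul_const c).const_sub 1).div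
      (G.profile.hasDerivAt_S u) (G.profile.S_pos u (hsub hu)).ne'
  refine antitoneOn_of_deriv_nonpos (convex_Icc r s)
    (fun u hu => (hd u hu).continuousAt.continuousWithinAt)
    (fun u hu => (hd u (interior_subset hu)).differentiableAt.differentiableWithinAt)
    (fun u hu => ?_) (left_mem_Icc.2 hrs) (right_mem_Icc.2 hrs) hrs
  have hu' := interior_subset hu
  rw [(hd u hu').deriv]
  refine div_nonpos_of_nonpos_of_nonneg ?_ (sq_nonneg _)
  have h1 := G.profile.S_sq u
  have h2 := G.profile.half_pos (hsub hu')
  -- By `S_sq` the numerator is -1 for c = 1 and -(1 - κC/2) for c = 1/2.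
  rcases hc with rfl | rfl
  · refine le_of_eq_of_le (b := -1) ?_ (by norm_num)
    linear_combination -G.profile.κ * h1
  · refine le_of_eq_of_le (b := -(1 - G.profile.κ * G.profile.C u / 2)) ?_ (by linarith)
    linear_combination -G.profile.κ / 2 * h1

lemma curv_antitone {r s : ℝ} (hr : r ∈ G.profile.I) (hs : s ∈ G.profile.I) (hrs : r ≤ s)
    (i : Fin n) : G.curv s i ≤ G.curv r i := by
  have h1 := antitoneOn_quotient (G := G) (Or.inl rfl) hr hs hrs
  have h2 := antitoneOn_quotient (G := G) (Or.inr rfl) hr hs hrs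
  simp only [mul_one, mul_one_div] at h1 h2
  rw [curv, curv, twoValued, twoValued]
  split_ifs
  · exact h1
  · exact h2

lemma contDiffOn_curv : ContDiffOn ℝ ∞ (fun r => G.curv r) G.profile.I := by
  rw [contDiffOn_pi]
  intro i
  have hS := G.profile.contDiff_S.contDiffOn (s := G.profile.I)
  have hC := G.profile.contDiff_C.contDiffOn (s := G.profile.I)
  simp only [curv, twoValued]
  split_ifs
  · exact (contDiffOn_const.sub (contDiffOn_const.mul hC)).div hS
      fun r hr => (G.profile.S_pos r hr).ne'
  · exact (contDiffOn_const.sub ((contDiffOn_const.mul hC).div_const 2)).div hS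
      fun r hr => (G.profile.S_pos r hr).ne'

variable {Γ : Set (Fin n → ℝ)} {W : (Fin n → ℝ) → ℝ} (hW : IsWeingarten Γ W)
include hW

lemma speed_pos {r : ℝ} (hr : r ∈ G.profile.I) : 0 < W (G.curv r) :=
  hW.pos _ (curv_pos hr)

/-- Larger spheres are less curved, and W is monotone on the positive cone. -/
lemma speed_antitone : AntitoneOn (fun r => W (G.curv r)) G.profile.I := fun _ hr _ hs hrs =>
  hW.mono (curv_pos hs) (curv_antitone hr hs hrs)

lemma contDiffOn_speed : ContDiffOn ℝ ∞ (fun r => W (G.curv r)) G.profile.I :=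
  hW.smooth.comp contDiffOn_curv fun _ hr => hW.cone_subset (curv_pos hr)

omit hW in
variable (G) in
/-- Everything that is needed about the shrinking spheres starting at radius `R`: the time function
`Φ` and the radius `ρ` at time `t`, which vanishes at time `Φ R`. -/
structure Clock (G : Geometry A n) (W : (Fin n → ℝ) → ℝ) (R : ℝ) where
  Φ : ℝ → ℝ
  ρ : ℝ → ℝ
  δ : ℝ
  δ_pos : 0 < δ
  mem : R ∈ G.profile.I
  continuous : Continuous Φ
  zero : Φ 0 = 0
  strictMono : StrictMonoOn Φ (Ici 0)
  hasDerivAt : ∀ r ∈ G.profile.I, r ≤ R → HasDerivAt Φ (W (G.curv r))⁻¹ r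
  ρ_zero : ρ 0 = R
  ρ_mem : ∀ t ∈ Ioo (-δ) (Φ R), ρ t ∈ G.profile.I
  Φ_ρ : ∀ t ∈ Ioo (-δ) (Φ R), Φ (ρ t) = Φ R - t
  ρ_deriv : ∀ t ∈ Ioo (-δ) (Φ R), HasDerivAt ρ (-W (G.curv (ρ t))) t
  ρ_smooth : ContDiffOn ℝ ∞ ρ (Ioo (-δ) (Φ R))

lemma nonempty_clock {R : ℝ} (hR : R ∈ G.profile.I) : Nonempty (Clock G W R) := by
  obtain ⟨R₁, hR₁, hlt⟩ := G.profile.exists_larger hR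
  have hsub : ∀ r ∈ Ioc 0 R₁, r ∈ G.profile.I := fun r hr => G.profile.mem_I R₁ hR₁ r hr.1 hr.2
  obtain ⟨Φ, ρ, h1, h2, h3, h4, h5, δ, h6, h7, h8⟩ := exists_clock (G.profile.pos R hR) hlt
    (fun r hr => speed_pos hW (hsub r hr)) ((speed_antitone hW).mono hsub)
    ((contDiffOn_speed hW).mono fun r hr => hsub r ⟨hr.1, hr.2.le⟩)
  exact ⟨⟨Φ, ρ, δ, h6, hR, h1, h2, h3, fun r hr hle => h4 r ⟨G.profile.pos r hr, hle.trans_lt hlt⟩,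
    h5, fun t ht => hsub _ ⟨(h7 t ht).1.1, (h7 t ht).1.2.le⟩, fun t ht => (h7 t ht).2.1,
    fun t ht => (h7 t ht).2.2, h8⟩⟩

end Geometry

/-! ### Touching spheres -/

section Touching

variable {n : ℕ} {A : Ambient} (G : Geometry A n) {M : Type*} [TopologicalSpace M]
  [ChartedSpace (EuclideanSpace ℝ (Fin n)) M] [IsManifold (𝓡 n) ∞ M] {f N : M → A.V}

include G in
lemma critical_of_isLocalMax (hf : ContMDiff (𝓡 n) 𝓘(ℝ, A.V) ∞ f) {p : M} (o : A.V)
    (hmax : IsLocalMax (fun q => A.chord o (f q)) p) (X : TangentSpace (𝓡 n) p) :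
    A.form (f p - o) (differential n A f p X) = 0 := by
  have := G.finiteDimensional
  obtain ⟨c, h0, hc, hg⟩ := exists_curve A p X
  have h1 := hasDerivAt_chord G.symm o (hg f hf).2.1.hasDerivWithinAt (u := univ)
  rw [hasDerivWithinAt_univ, h0] at h1
  have h2 : IsLocalMax (fun s => A.chord o (f (c s))) 0 := by
    have := hc.tendsto
    rw [h0] at this
    have h3 := this.eventually hmax
    simpa only [IsLocalMax, IsMaxFilter, h0] using h3
  exact h2.hasDerivAt_eq_zero h1

variable (hH : IsOrientedHypersurface n A f N) (hf : ContMDiff (𝓡 n) 𝓘(ℝ, A.V) ∞ f)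
  (hN : ContMDiff (𝓡 n) 𝓘(ℝ, A.V) ∞ N) {p : M} (P : Polar A n G.profile G.d (f p)) {r : ℝ}
  (hr : r ∈ G.profile.I) {w : Euc n} (hw : ‖w‖ = 1) {o : A.V} (ho : o = P.exp w r)
  {k : Fin n → ℝ} (hk : IsPrincipalCurvatures A f N p k)
include hH hf hN hr hw ho hk

/-- At a point of a hypersurface at maximal distance `r` from `o`, the principal curvatures are at
least those of the sphere of radius `r`. -/
lemma curv_le_of_isLocalMax (hmax : IsLocalMax (fun q => A.chord o (f q)) p) :
    ∃ ε : ℝ, (ε = 1 ∨ ε = -1) ∧ N p = ε • P.ι w ∧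
      ∃ σ : Equiv.Perm (Fin n), ∀ i, G.curv r i ≤ ε * k (σ i) := by
  have := G.finiteDimensional
  obtain ⟨ε, hε, hNε, v, hv, hwv, h⟩ := touching G hH hf hN P hr hw ho
    (critical_of_isLocalMax G hf o hmax) hk
  refine ⟨ε, hε, hNε, exists_perm_ge (k := fun i => ε * k i) hv (P.K_symm w) (P.K_idem w hw)
    (P.K_rank w hw) G.d_le (Geometry.curv_le r hr) fun y => ?_⟩
  obtain ⟨c, hc0, hcc, hc⟩ := h y
  have h1 : IsLocalMax (fun s => A.chord o (f (c s))) 0 := by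
    have := hcc.tendsto
    rw [hc0] at this
    have h3 := this.eventually hmax
    simpa only [IsLocalMax, IsMaxFilter, hc0] using h3
  have h2 : ContinuousAt (fun s => A.chord o (f (c s))) 0 := by
    have h3 : ContinuousAt (fun s => f (c s)) 0 :=
      ContinuousAt.comp (g := f) hf.continuous.continuousAt hcc
    exact (continuous_form.continuousAt.comp
      ((h3.sub continuousAt_const).prodMk (h3.sub continuousAt_const))).div_const 2
  -- After division by S r > 0, the sign of the second derivative says that the form of the sphere
  -- is dominated by ε times that of the hypersurface.
  have h3 := deriv_deriv_nonpos_of_isLocalMax h1 h2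
  rw [hc] at h3
  have hS := G.profile.S_pos r hr
  simp only [mul_assoc, ← Finset.mul_sum]
  rw [← sub_div, div_mul_eq_mul_div, div_mul_eq_mul_div, ← add_div, div_le_iff₀ hS]
  linarith

/-- The principal curvatures of a hypersurface contained in a sphere. -/
lemma curv_eq_of_const (hconst : ∀ q, A.chord o (f q) = A.chord o (f p)) :
    ∃ ε : ℝ, (ε = 1 ∨ ε = -1) ∧ N p = ε • P.ι w ∧
      (∃ σ : Equiv.Perm (Fin n), ∀ i, G.curv r i ≤ ε * k (σ i)) ∧
      ∃ σ : Equiv.Perm (Fin n), ∀ i, ε * k (σ i) ≤ G.curv r i := by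
  have hmax : IsLocalMax (fun q => A.chord o (f q)) p :=
    Eventually.of_forall fun q => (hconst q).le
  obtain ⟨ε, hε, hNε, v, hv, hwv, h⟩ := touching G hH hf hN P hr hw ho
    (critical_of_isLocalMax G hf o hmax) hk
  have heq : ∀ y : Fin n → ℝ, (1 - G.profile.κ * G.profile.C r / 2) / G.profile.S r *
      ‖∑ i, y i • v i‖ ^ 2 + ((1 - G.profile.κ * G.profile.C r) / G.profile.S r -
      (1 - G.profile.κ * G.profile.C r / 2) / G.profile.S r) *
      inner ℝ (P.K w (∑ i, y i • v i)) (∑ i, y i • v i) = ∑ i, ε * k i * y i ^ 2 := fun y => by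
    obtain ⟨c, hc0, hcc, hc⟩ := h y
    -- The chord is constant, so its second derivative vanishes and the two forms agree. The
    -- comparison then works in both directions.
    simp only [hconst (c _), deriv_const', deriv_const] at hc
    have hS := G.profile.S_pos r hr
    simp only [mul_assoc, ← Finset.mul_sum]
    rw [← sub_div, div_mul_eq_mul_div, div_mul_eq_mul_div, ← add_div, div_eq_iff hS.ne']
    linarith
  exact ⟨ε, hε, hNε, exists_perm_ge (k := fun i => ε * k i) hv (P.K_symm w) (P.K_idem w hw)
    (P.K_rank w hw) G.d_le (Geometry.curv_le r hr) fun y => (heq y).le,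
    exists_perm_le (k := fun i => ε * k i) hv (P.K_symm w) (P.K_idem w hw)
      (P.K_rank w hw) G.one_le_d G.d_le (Geometry.curv_le r hr) hw (P.K_self w hw) hwv fun y => (heq y).ge⟩

end Touching

/-! ### The avoidance principle -/

/-- At the right endpoint the backward direction 0 - t is tangent to the interval, and at a maximum
the derivative along it is nonpositive. -/
lemma nonneg_of_max_right {h : ℝ → ℝ} {a t : ℝ} (ht : 0 < t)
    (hd : HasDerivWithinAt h a (Icc 0 t) t) (hmax : ∀ s ∈ Icc 0 t, h s ≤ h t) : 0 ≤ a := by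
  have h1 : IsLocalMaxOn h (Icc 0 t) t :=
    eventually_nhdsWithin_of_forall fun s hs => hmax s hs
  have h2 := h1.hasFDerivWithinAt_nonpos hd.hasFDerivWithinAt (y := 0 - t)
    (sub_mem_posTangentConeAt_of_segment_subset (by
      rw [segment_symm, segment_eq_Icc ht.le]))
  simp at h2
  nlinarith

/-- A maximum principle: if the spatial maxima below the threshold `c'` do not increase, then the
maximum remains below its initial bound `c < c'`. -/
lemma le_of_max_nonincreasing {M : Type*} [TopologicalSpace M] [CompactSpace M] {t₁ c c' : ℝ}
    {g : ℝ → M → ℝ} (hg : ContinuousOn (fun z : ℝ × M => g z.1 z.2) (Icc 0 t₁ ×ˢ univ))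
    (hc : c < c') (h0 : ∀ p, g 0 p ≤ c)
    (hd : ∀ t ∈ Ioc 0 t₁, ∀ p, (∀ q, g t q ≤ g t p) → g t p < c' →
      ∃ a ≤ 0, HasDerivWithinAt (fun s => g s p) a (Icc 0 t) t) :
    ∀ t ∈ Icc 0 t₁, ∀ p, g t p ≤ c := by
  by_contra! hcon
  obtain ⟨t, ht, p, hp⟩ := hcon
  obtain ⟨b, hb, hb'⟩ := exists_between (lt_min hc hp)
  have hbc := hb'.trans_le (min_le_left _ _)
  have hbg := hb'.trans_le (min_le_right _ _)
  have hcomp : IsCompact (Icc 0 t₁ ×ˢ (univ : Set M)) := isCompact_Icc.prod isCompact_univ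
  have hline : ∀ q, ContinuousOn (fun s => g s q) (Icc 0 t₁) := fun q =>
    hg.comp (by fun_prop : Continuous fun s : ℝ => (s, q)).continuousOn fun s hs => ⟨hs, mem_univ _⟩
  -- The first time at which the level b is reached exists because [0, t₁] × M is compact.
  obtain ⟨t₀, ht₀, p₀, hp₀, hfirst⟩ : ∃ t₀ ∈ Icc 0 t₁, ∃ p₀, b ≤ g t₀ p₀ ∧
      ∀ s ∈ Icc 0 t₁, s < t₀ → ∀ q, g s q < b := by
    let U : Set ((Icc (0 : ℝ) t₁) × M) := {z | b ≤ g z.1 z.2}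
    have hU : IsClosed U := isClosed_le continuous_const
      (hg.comp_continuous (by fun_prop : Continuous fun z : (Icc (0 : ℝ) t₁) × M => ((z.1 : ℝ), z.2))
        fun z => ⟨z.1.2, mem_univ _⟩)
    obtain ⟨z, hz, hmin⟩ := hU.isCompact.exists_isMinOn ⟨(⟨t, ht⟩, p), hbg.le⟩
      (by fun_prop : Continuous fun z : (Icc (0 : ℝ) t₁) × M => (z.1 : ℝ)).continuousOn
    refine ⟨z.1, z.1.2, z.2, hz, fun s hs hlt q => ?_⟩
    by_contra! hbs
    exact hlt.not_ge (hmin (show ((⟨s, hs⟩, q) : (Icc (0 : ℝ) t₁) × M) ∈ U from hbs))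
  have ht₀pos : 0 < t₀ := by
    rcases ht₀.1.eq_or_lt with h | h
    · rw [← h] at hp₀
      linarith [h0 p₀]
    · exact h
  have hsub : Icc 0 t₀ ⊆ Icc 0 t₁ := Icc_subset_Icc_right ht₀.2
  have hle : ∀ s ∈ Icc 0 t₀, ∀ q, g s q ≤ b := fun s hs q => by
    rw [← closure_Ico ht₀pos.ne] at hs
    refine le_on_closure (fun u hu => (hfirst u (hsub ⟨hu.1, hu.2.le⟩) hu.2 q).le) ?_
      continuousOn_const hs
    rw [closure_Ico ht₀pos.ne]
    exact (hline q).mono hsub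
  -- The penalty ε s makes the contradiction strict; ε t₀ < b - c keeps the maximum of g - ε s away
  -- from time 0.
  obtain ⟨ε, hε, hεt⟩ : ∃ ε > 0, ε * t₀ < b - c :=
    ⟨(b - c) / (2 * t₀), div_pos (sub_pos.2 hb) (by positivity), by
      have := sub_pos.2 hb
      field_simp
      linarith⟩
  obtain ⟨z, hz, hmax⟩ := (isCompact_Icc.prod isCompact_univ).exists_isMaxOn
    (⟨(t₀, p₀), ⟨ht₀pos.le, le_rfl⟩, mem_univ _⟩ : (Icc 0 t₀ ×ˢ (univ : Set M)).Nonempty)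
    ((hg.mono (prod_mono hsub Subset.rfl)).sub
      (by fun_prop : Continuous fun z : ℝ × M => ε * z.1).continuousOn)
  have hmax' : ∀ s ∈ Icc 0 t₀, ∀ q, g s q - ε * s ≤ g z.1 z.2 - ε * z.1 := fun s hs q =>
    hmax (show (s, q) ∈ Icc 0 t₀ ×ˢ (univ : Set M) from ⟨hs, mem_univ _⟩)
  have hzpos : 0 < z.1 := by
    rcases hz.1.1.eq_or_lt with h | h
    · have h1 := hmax' t₀ ⟨ht₀pos.le, le_rfl⟩ p₀
      rw [← h] at h1
      linarith [h0 z.2]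
    · exact h
  obtain ⟨a, ha, hda⟩ := hd z.1 ⟨hzpos, (hsub hz.1).2⟩ z.2
    (fun q => by linarith [hmax' z.1 hz.1 q]) ((hle z.1 hz.1 z.2).trans_lt hbc)
  -- At this maximum a - ε ≥ 0, against a ≤ 0 < ε.
  have h2 := nonneg_of_max_right hzpos (hda.sub ((hasDerivWithinAt_id z.1 _).const_mul ε))
    fun s hs => hmax' s ⟨hs.1, hs.2.trans hz.1.2⟩ z.2
  linarith

lemma eventually_gt_of_hasDerivAt_pos {h : ℝ → ℝ} {a : ℝ} (hd : HasDerivAt h a 0) (ha : 0 < a) :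
    ∀ᶠ s in 𝓝[>] (0 : ℝ), h 0 < h s := by
  have h1 := (hasDerivAt_iff_tendsto_slope.1 hd).eventually (lt_mem_nhds ha)
  have h2 : 𝓝[>] (0 : ℝ) ≤ 𝓝[≠] 0 := nhdsWithin_mono _ fun s hs => ne_of_gt hs
  filter_upwards [h2 h1, self_mem_nhdsWithin] with s hs hs0
  rw [slope_def_field, sub_zero] at hs
  have := (div_pos_iff_of_pos_right hs0).1 hs
  linarith

lemma chord_comm (A : Ambient) (x y : A.V) : A.chord x y = A.chord y x := by
  rw [Ambient.chord, Ambient.chord, ← neg_sub x y]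
  simp only [map_neg, LinearMap.neg_apply, neg_neg]

section Avoidance

variable {n : ℕ} {A : Ambient} {G : Geometry A n} {M : Type*} [TopologicalSpace M]
  [ChartedSpace (EuclideanSpace ℝ (Fin n)) M] [IsManifold (𝓡 n) ∞ M]

omit [IsManifold (𝓡 n) ∞ M] in
/-- An immersion of a manifold of positive dimension is not constant. -/
lemma IsOrientedHypersurface.exists_ne [Nonempty M] (hn : 1 ≤ n) {f N : M → A.V}
    (h : IsOrientedHypersurface n A f N) (o : A.V) : ∃ p, f p ≠ o := by
  by_contra! hcon
  obtain rfl : f = fun _ => o := funext hcon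
  obtain ⟨p⟩ := ‹Nonempty M›
  have h1 := h.immersion p
  have h2 : differential n A (fun _ : M => o) p = 0 := mfderiv_const
  have : Nontrivial (EuclideanSpace ℝ (Fin n)) := by
    have : Nonempty (Fin n) := ⟨⟨0, hn⟩⟩
    infer_instance
  obtain ⟨X, hX⟩ := _root_.exists_ne (0 : EuclideanSpace ℝ (Fin n))
  exact hX (h1 (a₁ := (show TangentSpace (𝓡 n) p from X)) (a₂ := 0) (by rw [h2]; rfl))

/-- The normal of an inward oriented hypersurface does not point away from the centre at a point of
maximal distance. -/
lemma not_isInward {o : A.V} (Po : Polar A n G.profile G.d o) {R r : ℝ} (hR : R ∈ G.profile.I)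
    {M : Type*} {f N : M → A.V} {p : M} (P : Polar A n G.profile G.d (f p))
    (hr : r ∈ G.profile.I) {w : Euc n} (hw : ‖w‖ = 1) (ho : o = P.exp w r)
    (hmax : ∀ q, A.chord o (f q) ≤ A.chord o (f p))
    (hN : N p = -P.ι w) : ¬ IsInward A (A.geodesicBall o R) f N := by
  have := G.finiteDimensional
  intro hin
  obtain ⟨c, hc, hc0, hcd, hcin⟩ := hin p
  have hfo : f p - o = -(G.profile.S r • P.ι w + G.profile.C r • P.β w w) := by
    rw [ho, Polar.exp]; abel
  have hd := hasDerivAt_chord G.symm o hcd.hasDerivWithinAt (u := univ)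
  rw [hasDerivWithinAt_univ, hc0, hN, hfo] at hd
  -- Moving with velocity N = -ι w increases the chord at the rate S r > 0, so c s is farther from o
  -- than every point of f.
  have h1 := eventually_gt_of_hasDerivAt_pos hd (by
    simp only [map_neg, map_add, map_smul, LinearMap.neg_apply, LinearMap.add_apply,
      LinearMap.smul_apply, smul_eq_mul, P.form_ι, P.form_β_ι, real_inner_self_eq_norm_sq, hw]
    simpa using G.profile.S_pos r hr)
  obtain ⟨s, hs1, hs2⟩ := (h1.and hcin).exists
  have hCr : A.chord o (f p) = G.profile.C r := by
    rw [ho, chord_comm]; exact Geometry.chord_exp P hw r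
  rw [hc0, hCr] at hs1
  obtain ⟨u, hu, η, hη, hcs⟩ := Po.surj _ (hc s)
  have hcs' : c s = Po.exp η u := hcs
  have hball := (Geometry.mem_geodesicBall_iff Po hR _).1
    (hs2.2 (mem_connectedComponentIn hs2.1))
  have hCu : A.chord o (c s) = G.profile.C u := by rw [hcs', Geometry.chord_exp Po hη]
  rw [hCu] at hs1
  have hlt : u < R := G.profile.lt_of_C_lt (G.profile.I_subset hR) hu (hCu ▸ hball.2)
  have hu0 : 0 < u := by
    refine lt_of_le_of_ne (G.profile.nonneg u hu) ?_
    rintro rfl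
    rw [G.profile.C_zero] at hs1
    exact (G.profile.C_pos hr).not_gt hs1
  have hI : ∀ v ∈ Icc u R, v ∈ G.profile.I := fun v hv =>
    G.profile.mem_I R hR v (hu0.trans_le hv.1) hv.2
  -- The radial segment from c s out to distance R stays beyond f, so it lies in the component of c
  -- s. Its endpoint is not in the open ball.
  have hconn : IsPreconnected (Po.exp η '' Icc u R) := isPreconnected_Icc.image _
    fun v _ => (Po.hasDerivAt_exp η v).continuousAt.continuousWithinAt
  have hsub : Po.exp η '' Icc u R ⊆ A.carrier \ range f := by
    rintro _ ⟨v, hv, rfl⟩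
    refine ⟨Po.mem hη v, ?_⟩
    rintro ⟨q, hq⟩
    have h2 := hmax q
    rw [hq, Geometry.chord_exp Po hη, hCr] at h2
    have h3 := (G.profile.strictMonoOn_C.le_iff_le hu (G.profile.I_subset (hI v hv))).2 hv.1
    linarith
  have h4 := hconn.subset_connectedComponentIn ⟨u, left_mem_Icc.2 hlt.le, hcs'.symm⟩ hsub
    ⟨R, right_mem_Icc.2 hlt.le, rfl⟩
  have h5 := (Geometry.mem_geodesicBall_iff Po hR _).1 (hs2.2 h4)
  rw [Geometry.chord_exp Po hη] at h5
  exact h5.2.false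

variable {Γ : Set (Fin n → ℝ)} {W : (Fin n → ℝ) → ℝ} {T : EReal} {F N : ℝ → M → A.V}

omit [IsManifold (𝓡 n) ∞ M] in
lemma contMDiff_slice {Q : ℝ → M → A.V} (hQ : ContMDiffOn (𝓘(ℝ, ℝ).prod (𝓡 n)) 𝓘(ℝ, A.V) ∞
    (fun z : ℝ × M => Q z.1 z.2) (timeInterval T ×ˢ univ)) {t : ℝ} (ht : t ∈ timeInterval T) :
    ContMDiff (𝓡 n) 𝓘(ℝ, A.V) ∞ (Q t) := by
  have h : ContMDiff (𝓡 n) (𝓘(ℝ, ℝ).prod (𝓡 n)) ∞ fun p : M => (t, p) :=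
    contMDiff_const.prodMk contMDiff_id
  rw [← contMDiffOn_univ]
  exact hQ.comp h.contMDiffOn fun p _ => ⟨ht, mem_univ _⟩

lemma chord_pos {o x : A.V} (Po : Polar A n G.profile G.d o) (hx : x ∈ A.carrier) (hne : x ≠ o) :
    0 < A.chord o x := by
  obtain ⟨s, hs, w, hw, e⟩ := Po.surj x hx
  obtain rfl : x = Po.exp w s := e
  rw [Geometry.chord_exp Po hw, ← G.profile.C_zero]
  refine G.profile.strictMonoOn_C G.profile.zero_mem hs (lt_of_le_of_ne (G.profile.nonneg s hs) ?_)
  rintro rfl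
  exact hne (Po.exp_zero w)

/-- A point of `carrier` as seen from another one in the ball of radius `R`. -/
lemma exists_radius {o x : A.V} (Po : Polar A n G.profile G.d o) (P : Polar A n G.profile G.d x)
    (ho : o ∈ A.carrier) (hx : x ∈ A.carrier) (hne : x ≠ o) {R : ℝ} (hR : R ∈ G.profile.I)
    (hle : A.chord o x ≤ G.profile.C R) :
    ∃ r ∈ G.profile.I, r ≤ R ∧ A.chord o x = G.profile.C r ∧ ∃ w, ‖w‖ = 1 ∧ o = P.exp w r := by
  obtain ⟨r, hr, w, hw, e⟩ := P.surj o ho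
  have e' : o = P.exp w r := e
  have h1 : A.chord o x = G.profile.C r := by
    rw [chord_comm]
    conv_lhs => rw [e']
    exact Geometry.chord_exp P hw r
  have h2 := chord_pos Po hx hne
  obtain ⟨h3, h4⟩ := G.profile.mem_I_of_lt hR hr (h1 ▸ h2.ne') (h1 ▸ hle)
  exact ⟨r, h3, h4, h1, w, hw, e'⟩

/-- The farthest point of the flow from `o` approaches `o` at least as fast as the sphere through
it. -/
lemma speed_at_max [Nonempty M] (hn : 1 ≤ n) (hW : IsWeingarten Γ W) (hF : IsWFlow A Γ W T F N)
    {o : A.V} (ho : o ∈ A.carrier) {R : ℝ} (hR : R ∈ G.profile.I)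
    (horient : IsOdd Γ W ∨ ∀ t ∈ timeInterval T, IsEmbedding (F t) ∧
      (range (F t) ⊆ A.geodesicBall o R → IsInward A (A.geodesicBall o R) (F t) (N t)))
    {t : ℝ} (ht : t ∈ timeInterval T) {p : M}
    (hmax : ∀ q, A.chord o (F t q) ≤ A.chord o (F t p))
    (hlt : A.chord o (F t p) < G.profile.C R) :
    ∃ r ∈ G.profile.I, r ≤ R ∧ A.chord o (F t p) = G.profile.C r ∧ ∃ v, W (G.curv r) ≤ v ∧
      HasDerivWithinAt (fun s => A.chord o (F s p)) (-(G.profile.S r * v)) (timeInterval T) t := by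
  have := G.finiteDimensional
  have hH := hF.hypersurface t ht
  have Po := G.polar o ho
  let P := G.polar (F t p) (hH.mem p)
  -- If the farthest point were o itself, the whole immersed hypersurface would be the point o.
  have hne : F t p ≠ o := fun h => by
    obtain ⟨q, hq⟩ := hH.exists_ne hn o
    have h1 := chord_pos Po (hH.mem q) hq
    have h2 := hmax q
    rw [h] at h2
    simp [Ambient.chord] at h1 h2
    linarith
  obtain ⟨r, hr, hrR, hCr, w, hw, how⟩ := exists_radius Po P ho (hH.mem p) hne hR hlt.le
  obtain ⟨k, hkΓ, hk, hdt⟩ := hF.evolution t ht p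
  have hf := contMDiff_slice hF.smooth ht
  have hNs := contMDiff_slice hF.smooth_normal ht
  obtain ⟨ε, hε, hNε, σ, hσ⟩ := curv_le_of_isLocalMax G hH hf hNs P hr hw how hk
    (Eventually.of_forall hmax)
  refine ⟨r, hr, hrR, hCr, ε * W k, ?_, ?_⟩
  · rcases hε with rfl | rfl
    · simp only [one_mul] at hσ ⊢
      exact hW.le_of_perm (Geometry.curv_pos hr) σ hσ
    -- Here the normal points away from o. If W is odd, reversing it replaces k by -k, which
    -- dominates `curv r` and so lies in the positive cone. In the embedded case inwardness is
    -- violated.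
    · rcases horient with ⟨W', hW', hodd⟩ | hemb
      · have h1 : W (G.curv r) ≤ W (-k) := hW.le_of_perm (Geometry.curv_pos hr) σ fun i => by
          simpa using hσ i
        have hpos : ∀ i, 0 < (-k) i := fun i => by
          have := (Geometry.curv_pos hr (σ.symm i)).trans_le (hσ (σ.symm i))
          simpa using this
        have hneg : -k ∈ Γ := hW.cone_subset hpos
        have h2 := hodd (-k) hneg
        rw [neg_neg, hW' k hkΓ, hW' (-k) hneg] at h2
        linarith
      · refine absurd ((hemb t ht).2 ?_) (not_isInward Po hR P hr hw how hmax (by simpa using hNε))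
        rintro _ ⟨q, rfl⟩
        exact (Geometry.mem_geodesicBall_iff Po hR _).2 ⟨hH.mem q, (hmax q).trans_lt hlt⟩
  · refine (hasDerivAt_chord G.symm o hdt).congr_deriv ?_
    have hfo : F t p - o = -(G.profile.S r • P.ι w + G.profile.C r • P.β w w) := by
      rw [how, Polar.exp]; abel
    rw [hfo, hNε]
    simp only [map_neg, map_add, map_smul, LinearMap.neg_apply, LinearMap.add_apply,
      LinearMap.smul_apply, smul_eq_mul, P.form_ι, P.form_β_ι, real_inner_self_eq_norm_sq, hw]
    ring

lemma zero_mem_timeInterval (hT : 0 < T) : (0 : ℝ) ∈ timeInterval T := ⟨le_rfl, by simpa using hT⟩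

lemma Icc_subset_timeInterval {t : ℝ} (ht : t ∈ timeInterval T) : Icc 0 t ⊆ timeInterval T :=
  fun _ hs => ⟨hs.1, lt_of_le_of_lt (EReal.coe_le_coe_iff.2 hs.2) ht.2⟩

/-- The avoidance principle: the flow stays strictly inside the shrinking sphere. -/
theorem avoidance [CompactSpace M] [Nonempty M] (hn : 1 ≤ n) (hW : IsWeingarten Γ W)
    (hF : IsWFlow A Γ W T F N)
    {o : A.V} (ho : o ∈ A.carrier) {R : ℝ} (c : Geometry.Clock G W R)
    (hball : range (F 0) ⊆ A.geodesicBall o R)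
    (horient : IsOdd Γ W ∨ ∀ t ∈ timeInterval T, IsEmbedding (F t) ∧
      (range (F t) ⊆ A.geodesicBall o R → IsInward A (A.geodesicBall o R) (F t) (N t)))
    {t : ℝ} (ht : t ∈ timeInterval T) (p : M) :
    c.Φ (G.profile.D (A.chord o (F t p))) + t < c.Φ R := by
  have := G.finiteDimensional
  have hR := c.mem
  have Po := G.polar o ho
  have hD : ∀ {x}, x ∈ A.carrier → G.profile.D (A.chord o x) ∈ G.profile.J ∧
      G.profile.C (G.profile.D (A.chord o x)) = A.chord o x := fun {x} hx => by
    obtain ⟨s, hs, w, hw, e⟩ := Po.surj x hx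
    obtain rfl : x = Po.exp w s := e
    rw [Geometry.chord_exp Po hw, G.profile.D_C s hs]
    exact ⟨hs, rfl⟩
  have hlt : ∀ {x}, x ∈ A.carrier → (c.Φ (G.profile.D (A.chord o x)) < c.Φ R ↔
      A.chord o x < G.profile.C R) := fun {x} hx => by
    rw [c.strictMono.lt_iff_lt (G.profile.nonneg _ (hD hx).1) (G.profile.pos R hR).le,
      ← G.profile.strictMonoOn_C.lt_iff_lt (hD hx).1 (G.profile.I_subset hR), (hD hx).2]
  -- For the shrinking sphere itself this quantity is constantly Φ R; the point is that its maximum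
  -- over the flow never rises.
  let g : ℝ → M → ℝ := fun s q => c.Φ (G.profile.D (A.chord o (F s q))) + s
  have hcont : ContinuousOn (fun z : ℝ × M => g z.1 z.2) (Icc 0 t ×ˢ univ) := by
    have h1 : ContinuousOn (fun z : ℝ × M => F z.1 z.2) (Icc 0 t ×ˢ univ) :=
      hF.smooth.continuousOn.mono (prod_mono (Icc_subset_timeInterval ht) Subset.rfl)
    have h2 : Continuous fun x : A.V => A.chord o x :=
      (continuous_form.comp (by fun_prop : Continuous fun x : A.V => (x - o, x - o))).div_const 2
    exact ((c.continuous.comp (G.profile.continuous_D.comp h2)).comp_continuousOn h1).add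
      continuous_fst.continuousOn
  -- By compactness the initial hypersurface keeps a fixed margin from the boundary of the open
  -- ball.
  obtain ⟨b, hb, hb0⟩ : ∃ b < c.Φ R, ∀ q, g 0 q ≤ b := by
    have hsl : Continuous fun q => g 0 q := hcont.comp_continuous
      (by fun_prop : Continuous fun q : M => ((0 : ℝ), q)) fun q => ⟨⟨le_rfl, ht.1⟩, mem_univ _⟩
    obtain ⟨q, hq⟩ := (isCompact_univ (X := M)).exists_isMaxOn univ_nonempty hsl.continuousOn
    refine ⟨g 0 q, ?_, fun q' => hq.2 (mem_univ q')⟩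
    have h1 := (Geometry.mem_geodesicBall_iff Po hR _).1 (hball (mem_range_self q))
    simpa [g] using (hlt h1.1).2 h1.2
  refine lt_of_le_of_lt (le_of_max_nonincreasing hcont hb hb0 ?_ t ⟨ht.1, le_rfl⟩ p) hb
  intro s hs q hmax hgs
  have hs' : s ∈ timeInterval T := Icc_subset_timeInterval ht ⟨hs.1.le, hs.2⟩
  have hmem := (hF.hypersurface s hs').mem
  have hmax' : ∀ q', A.chord o (F s q') ≤ A.chord o (F s q) := fun q' => by
    have h1 := hmax q'
    simp only [g, add_le_add_iff_right] at h1
    have h2 := (c.strictMono.le_iff_le (G.profile.nonneg _ (hD (hmem q')).1)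
      (G.profile.nonneg _ (hD (hmem q)).1)).1 h1
    have h3 := G.profile.strictMonoOn_C.monotoneOn (hD (hmem q')).1 (hD (hmem q)).1 h2
    rwa [(hD (hmem q')).2, (hD (hmem q)).2] at h3
  have hlt' : A.chord o (F s q) < G.profile.C R := (hlt (hmem q)).1 (by
    simp only [g] at hgs
    linarith [hs.1])
  obtain ⟨r, hr, hrR, hCr, v, hv, hd⟩ := speed_at_max hn hW hF ho hR horient hs' hmax' hlt'
  have hWr := Geometry.speed_pos hW hr
  have hSr := G.profile.S_pos r hr
  have hDr := G.profile.hasDerivAt_D hr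
  rw [← hCr] at hDr
  have hΦ := c.hasDerivAt r hr hrR
  rw [← G.profile.D_C r (G.profile.I_subset hr), ← hCr] at hΦ
  -- By the chain rule the derivative of g is 1 - v / W(curv r), which is nonpositive because v ≥
  -- W(curv r).
  have h5 := (hΦ.comp_hasDerivWithinAt s (hDr.comp_hasDerivWithinAt s hd)).add
    (hasDerivWithinAt_id s _)
  refine ⟨_, ?_, h5.mono ((Icc_subset_Icc_right hs.2).trans (Icc_subset_timeInterval ht))⟩
  rw [hCr, G.profile.D_C r (G.profile.I_subset hr)]
  have h6 : (W (G.curv r))⁻¹ * ((G.profile.S r)⁻¹ * -(G.profile.S r * v)) = -(v / W (G.curv r)) := by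
    field_simp
  rw [h6]
  linarith [(one_le_div hWr).2 hv]

end Avoidance

/-! ### Geodesic spheres -/

/-- An orthonormal eigenbasis of a projection, orthogonal to a unit vector in its range. -/
lemma exists_eigenbasis {n d : ℕ} {K : Euc n →ₗ[ℝ] Euc n}
    (hs : ∀ ξ η, inner ℝ (K ξ) η = inner ℝ ξ (K η)) (hi : ∀ ξ, K (K ξ) = K ξ)
    (hr : Module.finrank ℝ (LinearMap.range K) = d) (hd1 : 1 ≤ d) (hd : d ≤ n + 1)
    {w : Euc n} (hw : ‖w‖ = 1) (hKw : K w = w) :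
    ∃ v : Fin n → Euc n, Orthonormal ℝ v ∧ (∀ i, inner ℝ w (v i) = 0) ∧
      ∀ i, K (v i) = if (i : ℕ) < d - 1 then v i else 0 := by
  let U : Submodule ℝ (Euc n) := LinearMap.range K ⊓ (ℝ ∙ w)ᗮ
  let Z : Submodule ℝ (Euc n) := LinearMap.ker K
  have hU : Module.finrank ℝ U = d - 1 := finrank_range_inf hw hKw hr
  have hZ : Module.finrank ℝ Z = n + 1 - d := finrank_ker_proj hr
  let bU := (stdOrthonormalBasis ℝ U).reindex (finCongr hU)
  let bZ := (stdOrthonormalBasis ℝ Z).reindex (finCongr hZ)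
  have hKU : ∀ u : U, K u = u := fun u => by
    obtain ⟨y, hy⟩ := (Submodule.mem_inf.1 u.2).1
    rw [← hy, hi]
  have hKZ : ∀ z : Z, K z = 0 := fun z => z.2
  have hwU : ∀ u : U, inner ℝ w (u : Euc n) = 0 := fun u =>
    (Submodule.mem_orthogonal_singleton_iff_inner_right).1 (Submodule.mem_inf.1 u.2).2
  have hUZ : ∀ (u : U) (z : Z), inner ℝ (u : Euc n) (z : Euc n) = 0 := fun u z => by
    rw [← hKU u, hs, hKZ, inner_zero_right]
  -- First a basis of the part of the range of K orthogonal to w, then one of the kernel. The d - 1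
  -- and n + 1 - d vectors add up to n, since w takes one dimension of the range.
  let v : Fin n → Euc n := fun i => if h : (i : ℕ) < d - 1 then (bU ⟨i, h⟩ : Euc n)
    else (bZ ⟨i - (d - 1), by omega⟩ : Euc n)
  have hv1 : ∀ i : Fin n, ∀ h : (i : ℕ) < d - 1, v i = bU ⟨i, h⟩ := fun i h => by simp [v, h]
  have hv2 : ∀ i : Fin n, ∀ h : ¬ (i : ℕ) < d - 1, v i = bZ ⟨i - (d - 1), by omega⟩ := fun i h => by
    simp [v, h]
  have hbU := orthonormal_iff_ite.1 bU.orthonormal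
  have hbZ := orthonormal_iff_ite.1 bZ.orthonormal
  refine ⟨v, ?_, fun i => ?_, fun i => ?_⟩
  · rw [orthonormal_iff_ite]
    intro i j
    by_cases h1 : (i : ℕ) < d - 1 <;> by_cases h2 : (j : ℕ) < d - 1
    · rw [hv1 i h1, hv1 j h2, ← Submodule.coe_inner, hbU]
      simp [Fin.ext_iff]
    · rw [hv1 i h1, hv2 j h2, hUZ, if_neg]
      rintro rfl; exact h2 h1
    · rw [hv2 i h1, hv1 j h2, real_inner_comm, hUZ, if_neg]
      rintro rfl; exact h1 h2
    · rw [hv2 i h1, hv2 j h2, ← Submodule.coe_inner, hbZ]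
      simp only [Fin.ext_iff]
      congr 1
      simp only [eq_iff_iff]
      omega
  · by_cases h : (i : ℕ) < d - 1
    · rw [hv1 i h, hwU]
    · rw [hv2 i h, ← hKw, hs, hKZ, inner_zero_right]
  · by_cases h : (i : ℕ) < d - 1
    · rw [if_pos h, hv1 i h, hKU]
    · rw [if_neg h, hv2 i h, hKZ]

/-! ### Polarization of the second fundamental form. -/

namespace Polar

variable {A : Ambient} {n : ℕ} {p : Profile} {d : ℕ} {x : A.V} (P : Polar A n p d x)

lemma form_β_ι' (w ξ v : Euc n) : A.form (P.β w ξ) (P.ι v) = 0 := by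
  have h1 := P.form_β_ι (w + ξ) v
  simp only [map_add, LinearMap.add_apply, P.form_β_ι, P.β_symm ξ w, zero_add, add_zero] at h1
  linarith

variable (hsymm : ∀ x y, A.form x y = A.form y x)
include hsymm

/-- The identity ⟨β(v, v), β(v, v)⟩ = κ|v|⁴ at v = w + tξ, with the pure terms cancelled. Its
coefficients in t contain the mixed products of β. -/
lemma form_β_polar {w ξ : Euc n} (hw : ‖w‖ = 1) (hwξ : inner ℝ w ξ = 0) (t : ℝ) :
    4 * t * A.form (P.β w w) (P.β w ξ) + 4 * t ^ 2 * A.form (P.β w ξ) (P.β w ξ) +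
      2 * t ^ 2 * A.form (P.β w w) (P.β ξ ξ) + 4 * t ^ 3 * A.form (P.β w ξ) (P.β ξ ξ) =
      2 * p.κ * t ^ 2 * ‖ξ‖ ^ 2 := by
  have h1 := P.form_β_β_self (w + t • ξ)
  have h2 : ‖w + t • ξ‖ ^ 4 = (1 + t ^ 2 * ‖ξ‖ ^ 2) ^ 2 := by
    have : ‖w + t • ξ‖ ^ 2 = 1 + t ^ 2 * ‖ξ‖ ^ 2 := by
      rw [norm_add_sq_real, real_inner_smul_right, hwξ, hw, norm_smul, mul_pow, Real.norm_eq_abs,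
        sq_abs]
      ring
    rw [← this]; ring
  rw [h2] at h1
  have h3 := P.form_β_β_self w
  have h4 := P.form_β_β_self ξ
  rw [hw] at h3
  simp only [map_add, map_smul, LinearMap.add_apply, LinearMap.smul_apply, smul_eq_mul,
    P.β_symm ξ w, hsymm (P.β w ξ) (P.β w w), hsymm (P.β ξ ξ) (P.β w w),
    hsymm (P.β ξ ξ) (P.β w ξ)] at h1
  linear_combination h1 - h3 - t ^ 4 * h4

/-- The polynomial identity at t = 1, -1, 2 isolates the coefficient of t. -/
lemma form_β_cross {w ξ : Euc n} (hw : ‖w‖ = 1) (hwξ : inner ℝ w ξ = 0) :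
    A.form (P.β w w) (P.β w ξ) = 0 := by
  have h1 := P.form_β_polar hsymm hw hwξ 1
  have h2 := P.form_β_polar hsymm hw hwξ (-1)
  have h3 := P.form_β_polar hsymm hw hwξ 2
  linarith

/-- The part even in t determines ⟨β(w, ξ), β(w, ξ)⟩ from ⟨β(w, w), β(ξ, ξ)⟩, which `form_β_β`
expresses through K. -/
lemma form_β_sq {w ξ : Euc n} (hw : ‖w‖ = 1) (hwξ : inner ℝ w ξ = 0) :
    4 * A.form (P.β w ξ) (P.β w ξ) = p.κ * (inner ℝ ξ ξ - inner ℝ (P.K w ξ) ξ) := by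
  have h1 := P.form_β_polar hsymm hw hwξ 1
  have h2 := P.form_β_polar hsymm hw hwξ (-1)
  rw [P.form_β_β hw] at h1 h2
  rw [real_inner_self_eq_norm_sq]
  linarith

lemma form_β_mixed {w ξ ζ : Euc n} (hw : ‖w‖ = 1) (hwξ : inner ℝ w ξ = 0)
    (hwζ : inner ℝ w ζ = 0) :
    4 * A.form (P.β w ξ) (P.β w ζ) = p.κ * (inner ℝ ξ ζ - inner ℝ (P.K w ξ) ζ) := by
  have h1 := P.form_β_sq hsymm hw hwξ
  have h2 := P.form_β_sq hsymm hw hwζ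
  have h3 := P.form_β_sq hsymm hw (ξ := ξ + ζ) (by rw [inner_add_right, hwξ, hwζ, add_zero])
  have h4 : inner ℝ (P.K w ζ) ξ = inner ℝ (P.K w ξ) ζ := by rw [P.K_symm, real_inner_comm]
  simp only [map_add, LinearMap.add_apply, inner_add_left, inner_add_right, h4,
    hsymm (P.β w ζ) (P.β w ξ), real_inner_comm ξ ζ] at h3
  linarith

omit hsymm
variable [FiniteDimensional ℝ A.V]

omit [FiniteDimensional ℝ A.V] in
/-- The derivative of `w ↦ a ι w + b β w w`. -/
lemma hasFDerivAt_quadratic (y : A.V) (a b : ℝ) (w : Euc n) :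
    HasFDerivAt (fun w => y + a • P.ι w + b • P.β w w)
      (LinearMap.toContinuousLinearMap (a • P.ι + (2 * b) • P.β w)) w := by
  have h1 : HasFDerivAt P.ι (LinearMap.toContinuousLinearMap P.ι) w :=
    (LinearMap.toContinuousLinearMap P.ι).hasFDerivAt
  have h2 := (LinearMap.toContinuousBilinearMap P.β).hasFDerivAt_of_bilinear
    (hasFDerivAt_id w) (hasFDerivAt_id w)
  refine (((h1.const_smul a).const_add y).add (h2.const_smul b)).congr_fderiv ?_
  ext v
  simp only [add_apply, smul_apply,
    ContinuousLinearMap.precompR_apply, ContinuousLinearMap.precompL_apply,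
    ContinuousLinearMap.compL_apply, ContinuousLinearMap.comp_apply,
    LinearMap.coe_toContinuousLinearMap', LinearMap.add_apply, LinearMap.smul_apply, id]
  have e : ∀ u v, (LinearMap.toContinuousBilinearMap P.β u) v = P.β u v := fun _ _ => rfl
  simp only [e, ContinuousLinearMap.coe_id', id, P.β_symm v w]
  module

omit [FiniteDimensional ℝ A.V] in
lemma contDiff_exp : ContDiff ℝ ∞ fun z : ℝ × Euc n => P.exp z.2 z.1 := by
  have h1 : ContDiff ℝ ∞ fun z : ℝ × Euc n => P.ι z.2 :=
    (LinearMap.toContinuousLinearMap P.ι).contDiff.comp contDiff_snd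
  have h2 : ContDiff ℝ ∞ fun z : ℝ × Euc n => P.β z.2 z.2 :=
    (((LinearMap.toContinuousBilinearMap P.β).contDiff).comp contDiff_snd).clm_apply contDiff_snd
  exact (contDiff_const.add ((p.contDiff_S.comp contDiff_fst).smul h1)).add
    ((p.contDiff_C.comp contDiff_fst).smul h2)

omit [FiniteDimensional ℝ A.V] in
lemma contDiff_vel : ContDiff ℝ ∞ fun z : ℝ × Euc n => P.vel z.2 z.1 := by
  have h1 : ContDiff ℝ ∞ fun z : ℝ × Euc n => P.ι z.2 :=
    (LinearMap.toContinuousLinearMap P.ι).contDiff.comp contDiff_snd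
  have h2 : ContDiff ℝ ∞ fun z : ℝ × Euc n => P.β z.2 z.2 :=
    (((LinearMap.toContinuousBilinearMap P.β).contDiff).comp contDiff_snd).clm_apply contDiff_snd
  exact ((contDiff_const.sub (contDiff_const.mul (p.contDiff_C.comp contDiff_fst))).smul h1).add
    ((p.contDiff_S.comp contDiff_fst).smul h2)

/-- The adjoint of `ι`. -/
def adj : A.V →L[ℝ] Euc n :=
  LinearMap.toContinuousLinearMap (∑ i, (LinearMap.flip A.form (P.ι (EuclideanSpace.single i 1))).smulRight
    (EuclideanSpace.single i (1 : ℝ)))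

/-- β is orthogonal to the image of ι, so a fixed linear map reads S(s) w off the point. This makes
geodesic spheres embedded and lets the direction of a point depend smoothly on it. -/
lemma adj_exp_sub (w : Euc n) (s : ℝ) : P.adj (P.exp w s - x) = p.S s • w := by
  have h : ∀ v, A.form (P.exp w s - x) (P.ι v) = p.S s * inner ℝ w v := fun v => by
    have : P.exp w s - x = p.S s • P.ι w + p.C s • P.β w w := by
      simp only [Polar.exp]; abel
    rw [this]
    simp [P.form_β_ι, P.form_ι]
  ext i
  simp only [adj, LinearMap.coe_toContinuousLinearMap', LinearMap.sum_apply,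
    LinearMap.smulRight_apply, LinearMap.flip_apply, h]
  simp [Pi.single_apply]
  exact Or.inl (by simp [PiLp.inner_apply])

end Polar

/-! ### Parametrized geodesic spheres and their curvatures. -/

section SphericalFlow

variable {n : ℕ} {A : Ambient} {G : Geometry A n} {M : Type*} [TopologicalSpace M]
  [ChartedSpace (EuclideanSpace ℝ (Fin n)) M]
  {o : A.V} (Po : Polar A n G.profile G.d o) {η : M → Euc n}

/-- The hypersurface `p ↦ exp_o (r η p)`. -/
def sphereMap (r : ℝ) (η : M → Euc n) (p : M) : A.V := Po.exp (η p) r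

/-- The inward unit normal of `sphereMap`. -/
def sphereNormal (r : ℝ) (η : M → Euc n) (p : M) : A.V := -Po.vel (η p) r

/-- The differential of a map to `ℝ^(n+1)`. -/
def diffE (η : M → Euc n) (p : M) : TangentSpace (𝓡 n) p →L[ℝ] Euc n :=
  mfderiv (𝓡 n) 𝓘(ℝ, Euc n) η p

variable (hη : ContMDiff (𝓡 n) 𝓘(ℝ, Euc n) ∞ η) (hη1 : ∀ p, ‖η p‖ = 1)
  (hηi : ∀ p, Function.Injective (diffE η p))

include hη

lemma differential_quadratic (y : A.V) (a b : ℝ) (p : M) (X : TangentSpace (𝓡 n) p) :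
    differential n A (fun p => y + a • Po.ι (η p) + b • Po.β (η p) (η p)) p X =
      a • Po.ι (diffE η p X) +
        (2 * b) • Po.β (η p) (diffE η p X) := by
  have := G.finiteDimensional
  have h1 := (hη.mdifferentiable (by simp) p).hasMFDerivAt
  have h2 := (Po.hasFDerivAt_quadratic y a b (η p)).hasMFDerivAt
  have h3 := (h2.comp p h1).mfderiv
  exact congrArg (fun L => L X) h3

lemma differential_sphereMap (r : ℝ) (p : M) (X : TangentSpace (𝓡 n) p) :
    differential n A (sphereMap Po r η) p X =
      G.profile.S r • Po.ι (diffE η p X) +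
      (2 * G.profile.C r) • Po.β (η p) (diffE η p X) :=
  differential_quadratic Po hη o _ _ p X

lemma differential_sphereNormal (r : ℝ) (p : M) (X : TangentSpace (𝓡 n) p) :
    differential n A (sphereNormal Po r η) p X =
      -((1 - G.profile.κ * G.profile.C r) • Po.ι (diffE η p X) +
      (2 * G.profile.S r) • Po.β (η p) (diffE η p X)) := by
  have h : sphereNormal Po r η = fun p => (0 : A.V) + (-(1 - G.profile.κ * G.profile.C r)) •
      Po.ι (η p) + (-G.profile.S r) • Po.β (η p) (η p) := funext fun p => by
    rw [sphereNormal, Polar.vel]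
    module
  rw [h, differential_quadratic Po hη]
  module

include hη1 in
lemma inner_mfderiv_eq_zero (p : M) (X : TangentSpace (𝓡 n) p) :
    inner ℝ (η p) (diffE η p X) = 0 := by
  have key : ∀ X : EuclideanSpace ℝ (Fin n), inner ℝ (η p) (diffE η p X) = 0 := fun X => by
    have h1 : HasDerivAt (fun s => η (coordLine p X s)) (diffE η p X) 0 :=
      hasDerivAt_comp_coordLine hη p X
    have h2 := h1.inner ℝ h1
    simp only [real_inner_self_eq_norm_sq, hη1, one_pow, coordLine_zero] at h2
    have h4 := h2.unique (hasDerivAt_const _ _)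
    rw [real_inner_comm (η p)] at h4
    linarith
  exact key X

-- The range of the differential lies in the complement of η p, and both have dimension n.
include hη1 hηi in
lemma mem_range_mfderiv {p : M} {v : Euc n} (hv : inner ℝ (η p) v = 0) :
    ∃ X, diffE η p X = v := by
  let L : EuclideanSpace ℝ (Fin n) →ₗ[ℝ] Euc n := (diffE η p).toLinearMap
  have h1 : LinearMap.range L ≤ (ℝ ∙ η p)ᗮ := by
    rintro _ ⟨X, rfl⟩
    exact Submodule.mem_orthogonal_singleton_iff_inner_right.2 (inner_mfderiv_eq_zero hη hη1 p X)
  have h2 : Module.finrank ℝ (LinearMap.range L) = n := by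
    rw [LinearMap.finrank_range_of_inj (f := L) (hηi p)]; simp
  have h3 : Module.finrank ℝ ((ℝ ∙ η p)ᗮ : Submodule ℝ (Euc n)) = n := by
    have := Submodule.finrank_add_finrank_orthogonal (ℝ ∙ η p)
    rw [finrank_span_singleton (fun h => by simpa [h] using hη1 p)] at this
    simp at this
    omega
  have h4 := Submodule.eq_of_le_of_finrank_eq h1 (h2.trans h3.symm)
  have h5 : v ∈ (ℝ ∙ η p)ᗮ := Submodule.mem_orthogonal_singleton_iff_inner_right.2 hv
  rw [← h4] at h5
  exact h5

include hη1 hηi in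
lemma isOrientedHypersurface_sphere {r : ℝ} (hr : r ∈ G.profile.I) :
    IsOrientedHypersurface n A (sphereMap Po r η) (sphereNormal Po r η) where
  mem p := Po.mem (hη1 p) r
  immersion p := by
    refine (injective_iff_map_eq_zero _).2 fun X hX => hηi p ?_
    rw [map_zero]
    rw [differential_sphereMap Po hη] at hX
    have h1 := congrArg (fun v => A.form v (Po.ι (diffE η p X))) hX
    simp only [map_add, map_smul, LinearMap.add_apply, LinearMap.smul_apply, smul_eq_mul,
      Po.form_ι, Po.form_β_ι', mul_zero, add_zero, map_zero, LinearMap.zero_apply] at h1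
    exact inner_self_eq_zero.1 ((mul_eq_zero.1 h1).resolve_left (G.profile.S_pos r hr).ne')
  tangent p := by
    obtain ⟨h1, h2⟩ := (Po.isUnitGeodesic_exp (hη1 p)).reverse r
    have h3 := h1.deriv_mem_tangent 0
    rw [h2] at h3
    rw [sub_zero, Po.deriv_exp] at h3
    exact h3
  unit p := by
    have h := (Po.isUnitGeodesic_exp (hη1 p)).unit r
    rw [Po.deriv_exp] at h
    simpa [sphereNormal] using h
  normal p X := by
    have h0 := inner_mfderiv_eq_zero hη hη1 p X
    rw [differential_sphereMap Po hη, sphereNormal, Polar.vel]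
    simp only [map_neg, map_add, map_smul, LinearMap.neg_apply, LinearMap.add_apply,
      LinearMap.smul_apply, smul_eq_mul, Po.form_ι, Po.form_β_ι, G.symm (Po.ι _) (Po.β _ _),
      Po.form_β_ι', h0, Po.form_β_cross G.symm (hη1 p) h0]
    ring

-- Eigenvectors of K orthogonal to η p diagonalize both fundamental forms. Where K v = v the
-- differential stretches by S and the curvature is (1 - κC)/S. On the kernel of K it stretches by
-- √(2C), because S² + κC² = 2C, and the curvature is S/(2C) = (1 - κC/2)/S.
include hη1 hηi in
lemma isPrincipalCurvatures_sphere {r : ℝ} (hr : r ∈ G.profile.I) (p : M) :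
    IsPrincipalCurvatures A (sphereMap Po r η) (sphereNormal Po r η) p (G.curv r) := by
  obtain ⟨v, hv, hwv, hK⟩ := exists_eigenbasis (Po.K_symm (η p)) (Po.K_idem (η p) (hη1 p))
    (Po.K_rank (η p) (hη1 p)) G.one_le_d G.d_le (hη1 p) (Po.K_self (η p) (hη1 p))
  have hS := G.profile.S_pos r hr
  have hC := G.profile.C_pos hr
  have hSC := G.profile.S_sq r
  obtain ⟨X, hX⟩ : ∃ X : Fin n → TangentSpace (𝓡 n) p, ∀ i, diffE η p (X i) = v i :=
    ⟨fun i => (mem_range_mfderiv hη hη1 hηi (hwv i)).choose,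
      fun i => (mem_range_mfderiv hη hη1 hηi (hwv i)).choose_spec⟩
  let μ : Fin n → ℝ := fun i => if (i : ℕ) < G.d - 1 then (G.profile.S r)⁻¹
    else (Real.sqrt (2 * G.profile.C r))⁻¹
  have hμ : ∀ i, μ i ^ 2 = if (i : ℕ) < G.d - 1 then (G.profile.S r ^ 2)⁻¹
      else (2 * G.profile.C r)⁻¹ := fun i => by
    simp only [μ]
    split_ifs
    · rw [inv_pow]
    · rw [inv_pow, Real.sq_sqrt (by positivity)]
  have hvv := orthonormal_iff_ite.1 hv
  have hform : ∀ a b a' b' : ℝ, ∀ i j, A.form (a • Po.ι (μ i • v i) + b • Po.β (η p) (μ i • v i))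
      (a' • Po.ι (μ j • v j) + b' • Po.β (η p) (μ j • v j)) = if i = j then μ i ^ 2 * (a * a' +
        b * b' * (G.profile.κ / 4 * (if (i : ℕ) < G.d - 1 then 0 else 1))) else 0 := by
    intro a b a' b' i j
    have h1 := Po.form_β_mixed G.symm (hη1 p) (hwv i) (hwv j)
    have h2 : A.form (Po.β (η p) (v i)) (Po.β (η p) (v j)) =
        if i = j then G.profile.κ / 4 * (if (i : ℕ) < G.d - 1 then 0 else 1) else 0 := by
      rw [hK] at h1
      by_cases h4 : (i : ℕ) < G.d - 1
      · simp only [h4, if_true, sub_self, mul_zero, ite_self] at h1 ⊢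
        linarith
      · simp only [h4, if_false, inner_zero_left, sub_zero, hvv] at h1 ⊢
        split_ifs at h1 ⊢ <;> linarith
    simp only [map_add, map_smul, LinearMap.add_apply, LinearMap.smul_apply, smul_eq_mul,
      Po.form_ι, Po.form_β_ι', G.symm (Po.ι _) (Po.β _ _), hvv, h2]
    split_ifs with h3 <;> [subst h3; subst h3; skip] <;> ring
  refine ⟨fun i => μ i • X i, fun i j => ?_, fun i j => ?_⟩
  · rw [differential_sphereMap Po hη, differential_sphereMap Po hη]
    simp only [map_smul (diffE η p), hX]
    rw [hform, hμ]
    split_ifs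
    · field_simp; ring
    · field_simp; linarith
    · rfl
  · rw [differential_sphereMap Po hη, differential_sphereNormal Po hη]
    simp only [map_smul (diffE η p), hX, Geometry.curv, twoValued]
    rw [map_neg, LinearMap.neg_apply, neg_neg, hform, hμ]
    split_ifs
    · field_simp; ring
    · field_simp; linarith
    · rfl

end SphericalFlow

/-! ### Spherical flows -/

section SphericalFlow

variable {n : ℕ} {A : Ambient} {G : Geometry A n} {M : Type*} [TopologicalSpace M]
  [ChartedSpace (EuclideanSpace ℝ (Fin n)) M]
  {o : A.V} (Po : Polar A n G.profile G.d o) {Γ : Set (Fin n → ℝ)} {W : (Fin n → ℝ) → ℝ} {R : ℝ}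

lemma le_of_forall_timeInterval {T : EReal} {a : ℝ} (ha : 0 ≤ a)
    (h : ∀ t ∈ timeInterval T, t < a) : T ≤ a := by
  by_contra! hT
  exact lt_irrefl a (h a ⟨ha, hT⟩)

lemma timeInterval_subset (c : Geometry.Clock G W R) {T : EReal} (hT : T ≤ c.Φ R) :
    timeInterval T ⊆ Ioo (-c.δ) (c.Φ R) := fun t ht =>
  ⟨by linarith [c.δ_pos, ht.1], EReal.coe_lt_coe_iff.1 (ht.2.trans_le hT)⟩

lemma Clock_pos (c : Geometry.Clock G W R) : 0 < c.Φ R := by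
  rw [← c.zero]
  exact c.strictMono self_mem_Ici (G.profile.pos R c.mem).le (G.profile.pos R c.mem)

/-- The parametrization η is left general, because a competing flow may parametrize the initial
sphere differently and has to be continued with its own η. -/
lemma isWFlow_sphere (hW : IsWeingarten Γ W) (c : Geometry.Clock G W R) {η : M → Euc n}
    (hη : ContMDiff (𝓡 n) 𝓘(ℝ, Euc n) ∞ η) (hη1 : ∀ p, ‖η p‖ = 1)
    (hηi : ∀ p, Function.Injective (diffE η p)) {T : EReal} (hT : T ≤ c.Φ R) :
    IsWFlow A Γ W T (fun t => sphereMap Po (c.ρ t) η) (fun t => sphereNormal Po (c.ρ t) η) := by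
  have hsub := timeInterval_subset c hT
  have hpair : ContMDiffOn (𝓘(ℝ, ℝ).prod (𝓡 n)) 𝓘(ℝ, ℝ × Euc n) ∞
      (fun z : ℝ × M => (c.ρ z.1, η z.2)) (timeInterval T ×ˢ univ) := by
    refine ContMDiffOn.prodMk_space ?_ ?_
    · exact (c.ρ_smooth.mono hsub).contMDiffOn.comp contMDiffOn_fst fun z hz => hz.1
    · exact (hη.comp contMDiff_snd).contMDiffOn
  exact {
    smooth := Po.contDiff_exp.contMDiff.comp_contMDiffOn hpair
    smooth_normal := Po.contDiff_vel.neg.contMDiff.comp_contMDiffOn hpair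
    hypersurface := fun t ht =>
      isOrientedHypersurface_sphere Po hη hη1 hηi (c.ρ_mem t (hsub ht))
    evolution := fun t ht p => ⟨G.curv (c.ρ t),
      hW.cone_subset (Geometry.curv_pos (c.ρ_mem t (hsub ht))),
      isPrincipalCurvatures_sphere Po hη hη1 hηi (c.ρ_mem t (hsub ht)) p, by
        have h := (Po.hasDerivAt_exp (η p) (c.ρ t)).scomp t (c.ρ_deriv t (hsub ht))
        refine h.hasDerivWithinAt.congr_deriv ?_
        rw [sphereNormal, neg_smul, smul_neg]⟩ }

lemma isParallelFlow_sphere (c : Geometry.Clock G W R) {M : Type*} {η : M → Euc n}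
    (hη1 : ∀ p, ‖η p‖ = 1) {T : EReal} (hT : T ≤ c.Φ R) :
    IsParallelFlow A T (fun t => R - c.ρ t) (fun t => sphereMap Po (c.ρ t) η)
      (fun t => sphereNormal Po (c.ρ t) η) where
  smooth := contDiffOn_const.sub (c.ρ_smooth.mono (timeInterval_subset c hT))
  zero := by simp [c.ρ_zero]
  parallel p t _ := by
    obtain ⟨h1, h2⟩ := (Po.isUnitGeodesic_exp (hη1 p)).reverse R
    refine ⟨_, h1, ?_, ?_, ?_, ?_⟩
    · simp [sphereMap, c.ρ_zero]
    · rw [h2, Po.deriv_exp, sphereNormal, c.ρ_zero, sub_zero]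
    · simp [sphereMap]
    · rw [h2, Po.deriv_exp, sphereNormal, sub_sub_cancel]

/-- The standard embedding of a geodesic sphere. -/
lemma sphereMap_embedding (hR : R ∈ G.profile.I) :
    IsEmbedding (sphereMap Po R ((↑) : UnitSphere n → Euc n)) := by
  have := G.finiteDimensional
  refine (Continuous.isClosedEmbedding ?_ fun p q hpq => ?_).isEmbedding
  · exact Po.contDiff_exp.continuous.comp
      (continuous_const.prodMk continuous_subtype_val : Continuous fun p : UnitSphere n => (R, (p : Euc n)))
  · have h := congrArg (fun v => Po.adj (v - o)) hpq
    simp only [sphereMap, Po.adj_exp_sub] at h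
    exact Subtype.ext (smul_right_injective _ (G.profile.S_pos R hR).ne' h)

lemma range_sphereMap : range (sphereMap Po R ((↑) : UnitSphere n → Euc n)) =
    A.geodesicSphere o R := by
  rw [Geometry.geodesicSphere_eq Po]
  ext x
  constructor
  · rintro ⟨p, rfl⟩
    exact ⟨p, by simp, rfl⟩
  · rintro ⟨w, hw, rfl⟩
    exact ⟨⟨w, by simpa using hw⟩, rfl⟩

/-- The inward radial geodesic enters the ball. Its component of the complement cannot leave the
ball: on a connected set the chord would take the value C R, and every point of the space with that
chord lies on the sphere. -/
lemma sphereMap_inward (hR : R ∈ G.profile.I) :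
    IsInward A (A.geodesicBall o R) (sphereMap Po R ((↑) : UnitSphere n → Euc n))
      (sphereNormal Po R (↑)) := by
  have := G.finiteDimensional
  intro p
  have hp : ‖(p : Euc n)‖ = 1 := by simp
  obtain ⟨h1, h2⟩ := (Po.isUnitGeodesic_exp hp).reverse R
  refine ⟨_, h1.mem, by simp [sphereMap], ?_, ?_⟩
  · have h3 := h1.smooth.hasDerivAt_deriv 0
    rwa [h2, sub_zero, Po.deriv_exp] at h3
  have hJ := G.profile.I_subset hR
  have hchord : ∀ q : UnitSphere n, A.chord o (sphereMap Po R (↑) q) = G.profile.C R := fun q =>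
    Geometry.chord_exp Po (by simp) R
  filter_upwards [Ioo_mem_nhdsGT (G.profile.pos R hR)] with s hs
  have hlt : G.profile.C (R - s) < G.profile.C R :=
    G.profile.strictMonoOn_C (G.profile.I_subset (G.profile.mem_I R hR _ (by linarith [hs.2])
      (by linarith [hs.1]))) hJ (by linarith [hs.1])
  have hmem : Po.exp p (R - s) ∈ A.carrier \ range (sphereMap Po R ((↑) : UnitSphere n → Euc n)) := by
    refine ⟨Po.mem hp _, ?_⟩
    rintro ⟨q, hq⟩
    have h3 := hchord q
    rw [hq, Geometry.chord_exp Po hp] at h3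
    exact hlt.ne h3
  refine ⟨hmem, fun y hy => ?_⟩
  have hsub := connectedComponentIn_subset (A.carrier \ range (sphereMap Po R
    ((↑) : UnitSphere n → Euc n))) (Po.exp p (R - s))
  refine (Geometry.mem_geodesicBall_iff Po hR y).2 ⟨(hsub hy).1, ?_⟩
  by_contra! hle
  have hcont : Continuous fun x : A.V => A.chord o x :=
    (continuous_form.comp (by fun_prop : Continuous fun x : A.V => (x - o, x - o))).div_const 2
  obtain ⟨z, hz, hzC⟩ := isPreconnected_connectedComponentIn.intermediate_value
    (mem_connectedComponentIn hmem) hy hcont.continuousOn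
    ⟨(Geometry.chord_exp Po hp (R - s)).trans_le hlt.le, hle⟩
  obtain ⟨s', hs', w, hw, e⟩ := Po.surj z (hsub hz).1
  have e' : z = Po.exp w s' := e
  simp only [e', Geometry.chord_exp Po hw] at hzC
  obtain rfl := G.profile.strictMonoOn_C.injOn hs' hJ hzC
  exact (hsub hz).2 ⟨⟨w, by simpa using hw⟩, e'.symm⟩

lemma diffE_coe_injective (p : UnitSphere n) :
    Function.Injective (diffE ((↑) : UnitSphere n → Euc n) p) :=
  have := Fact.mk (@finrank_euclideanSpace_fin ℝ _ (n + 1))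
  injective_mvfderiv_subtypeVal_sphere p

lemma contMDiff_unitSphere_coe :
    ContMDiff (𝓡 n) 𝓘(ℝ, Euc n) ∞ ((↑) : UnitSphere n → Euc n) :=
  have := Fact.mk (@finrank_euclideanSpace_fin ℝ _ (n + 1))
  contMDiff_coe_sphere

/-- The flow of standard geodesic spheres. -/
lemma isSphericalFlow_sphere (hW : IsWeingarten Γ W) (c : Geometry.Clock G W R) :
    IsSphericalFlow A Γ W o R (c.Φ R) (fun t => R - c.ρ t)
      (fun t => sphereMap Po (c.ρ t) (↑)) (fun t => sphereNormal Po (c.ρ t) (↑)) where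
  pos := EReal.coe_pos.2 (Clock_pos c)
  embedding := by rw [c.ρ_zero]; exact sphereMap_embedding Po c.mem
  initial := by rw [c.ρ_zero]; exact range_sphereMap Po
  inward := by rw [c.ρ_zero]; exact sphereMap_inward Po c.mem
  parallel := isParallelFlow_sphere Po c (fun p => by simp) le_rfl
  flow := isWFlow_sphere Po hW c contMDiff_unitSphere_coe (fun p => by simp)
    diffE_coe_injective le_rfl

/-- The centre of a geodesic sphere, as seen from one of its points. -/
lemma exists_center {v : Euc n} (hv : ‖v‖ = 1) (r : ℝ) (P : Polar A n G.profile G.d (Po.exp v r)) :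
    ∃ w, ‖w‖ = 1 ∧ o = P.exp w r ∧ P.ι w = -Po.vel v r := by
  obtain ⟨h1, h2⟩ := (Po.isUnitGeodesic_exp hv).reverse r
  obtain ⟨w, hw, hd, he⟩ := Geometry.exists_eq_exp P h1 (by simp)
  refine ⟨w, hw, ?_, ?_⟩
  · rw [← he]; simp
  · rw [← hd, h2, Po.deriv_exp, sub_zero]

lemma nonempty_unitSphere (n : ℕ) : Nonempty (UnitSphere n) :=
  ((NormedSpace.sphere_nonempty (E := Euc n)).2 zero_le_one).to_subtype

/-- Parallel flows starting at a geodesic sphere consist of geodesic spheres. -/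
lemma IsSphericalFlow.exists_param {T : EReal} {φ : ℝ → ℝ} {P N : ℝ → UnitSphere n → A.V}
    (h : IsSphericalFlow A Γ W o R T φ P N) (hR : R ∈ G.profile.I) :
    ∃ η : UnitSphere n → Euc n, ContMDiff (𝓡 n) 𝓘(ℝ, Euc n) ∞ η ∧ (∀ p, ‖η p‖ = 1) ∧
      (∀ p, Function.Injective (diffE η p)) ∧ ∀ t ∈ timeInterval T,
        P t = sphereMap Po (R - φ t) η ∧ N t = sphereNormal Po (R - φ t) η := by
  have := G.finiteDimensional
  have h0 : (0 : ℝ) ∈ timeInterval T := zero_mem_timeInterval h.pos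
  have hS := G.profile.S_pos R hR
  -- The direction is recovered from the initial position by the linear map `adj`, hence it is
  -- smooth.
  let η : UnitSphere n → Euc n := fun p => (G.profile.S R)⁻¹ • Po.adj (P 0 p - o)
  have hP : ∀ p, ‖η p‖ = 1 ∧ Po.exp (η p) R = P 0 p := fun p => by
    have h1 : P 0 p ∈ A.geodesicSphere o R := h.initial ▸ mem_range_self p
    rw [Geometry.geodesicSphere_eq Po] at h1
    obtain ⟨w, hw, he⟩ := h1
    have h2 : η p = w := by
      simp only [η]
      rw [← he, Po.adj_exp_sub, smul_smul, inv_mul_cancel₀ hS.ne', one_smul]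
    rw [h2]
    exact ⟨hw, he⟩
  have hsm := contMDiff_slice h.flow.smooth h0
  have hsmN := contMDiff_slice h.flow.smooth_normal h0
  have hη : ContMDiff (𝓡 n) 𝓘(ℝ, Euc n) ∞ η := by
    have h1 : ContDiff ℝ ∞ fun x : A.V => (G.profile.S R)⁻¹ • Po.adj (x - o) :=
      (Po.adj.contDiff.comp (contDiff_id.sub contDiff_const)).const_smul _
    exact h1.contMDiff.comp hsm
  have hP0 : P 0 = sphereMap Po R η := funext fun p => (hP p).2.symm
  have hH := h.flow.hypersurface 0 h0
  have hN0 : ∀ p, N 0 p = -Po.vel (η p) R := fun p => by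
    obtain ⟨k, -, hk, -⟩ := h.flow.evolution 0 h0 p
    have hc : ∀ q, A.chord o (P 0 q) = G.profile.C R := fun q => by
      rw [← (hP q).2, Geometry.chord_exp Po (hP q).1]
    have PP : Polar A n G.profile G.d (P 0 p) := G.polar _ (hH.mem p)
    obtain ⟨w, hw, ho, hιw⟩ : ∃ w, ‖w‖ = 1 ∧ o = PP.exp w R ∧ PP.ι w = -Po.vel (η p) R := by
      have h2 := fun PP => exists_center Po (hP p).1 R PP
      rw [(hP p).2] at h2
      exact h2 PP
    -- All of P 0 lies at one distance from o, so its normal is radial; inwardness excludes the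
    -- outward sign.
    obtain ⟨ε, hε, hNε, -⟩ := curv_eq_of_const G hH hsm hsmN PP hR hw ho hk
      fun q => (hc q).trans (hc p).symm
    rcases hε with rfl | rfl
    · rw [hNε, one_smul, hιw]
    · exact absurd h.inward (not_isInward Po hR PP hR hw ho
        (fun q => ((hc q).trans (hc p).symm).le) (by simpa using hNε))
  refine ⟨η, hη, fun p => (hP p).1, fun p X Y hXY => hH.immersion p ?_, fun t ht => ?_⟩
  · rw [hP0, differential_sphereMap Po hη, differential_sphereMap Po hη, hXY]
  · have key : ∀ p, P t p = Po.exp (η p) (R - φ t) ∧ N t p = -Po.vel (η p) (R - φ t) := fun p => by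
      obtain ⟨γ, hγ, hγ0, hγ1, hγP, hγN⟩ := h.parallel.parallel p t ht
      obtain ⟨h1, h2⟩ := (Po.isUnitGeodesic_exp (hP p).1).reverse R
      -- The normal geodesic of the parallel flow is the radial geodesic traversed from the sphere
      -- to o.
      have h3 := G.geodesic_unique hγ h1 (by rw [hγ0, sub_zero, (hP p).2])
        (by rw [hγ1, h2, hN0, Po.deriv_exp, sub_zero])
      rw [hγP, hγN, h3, h2, Po.deriv_exp]
      exact ⟨rfl, rfl⟩
    exact ⟨funext fun p => (key p).1, funext fun p => (key p).2⟩

lemma timeInterval_mem_nhdsGE {T : EReal} {t b : ℝ} (ht : 0 ≤ t) (hb : b ∈ timeInterval T)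
    (htb : t < b) : timeInterval T ∈ 𝓝[≥] t :=
  mem_of_superset (Icc_mem_nhdsGE htb)
    ((Icc_subset_Icc_left ht).trans (Icc_subset_timeInterval hb))

/-- The radius of a spherical flow satisfies `r' = -W(curv r)`. -/
lemma IsSphericalFlow.hasDerivWithinAt_radius (hW : IsWeingarten Γ W) {T : EReal}
    {φ : ℝ → ℝ} {P N : ℝ → UnitSphere n → A.V} (h : IsSphericalFlow A Γ W o R T φ P N)
    {η : UnitSphere n → Euc n} (hη1 : ∀ p, ‖η p‖ = 1) (hPN : ∀ t ∈ timeInterval T,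
        P t = sphereMap Po (R - φ t) η ∧ N t = sphereNormal Po (R - φ t) η)
    {t : ℝ} (ht : t ∈ timeInterval T) (hr : R - φ t ∈ G.profile.I) :
    HasDerivWithinAt (fun s => R - φ s) (-W (G.curv (R - φ t))) (timeInterval T) t := by
  have := G.finiteDimensional
  obtain ⟨p⟩ := nonempty_unitSphere n
  have hH := h.flow.hypersurface t ht
  obtain ⟨k, hkΓ, hk, hd⟩ := h.flow.evolution t ht p
  have hc : ∀ s ∈ timeInterval T, ∀ q, A.chord o (P s q) = G.profile.C (R - φ s) := fun s hs q => by
    rw [(hPN s hs).1]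
    exact Geometry.chord_exp Po (hη1 q) _
  have PP : Polar A n G.profile G.d (P t p) := G.polar _ (hH.mem p)
  obtain ⟨w, hw, ho, hιw⟩ : ∃ w, ‖w‖ = 1 ∧ o = PP.exp w (R - φ t) ∧
      PP.ι w = -Po.vel (η p) (R - φ t) := by
    have h2 := fun PP => exists_center Po (hη1 p) (R - φ t) PP
    have h3 : P t p = Po.exp (η p) (R - φ t) := congrFun (hPN t ht).1 p
    rw [← h3] at h2
    exact h2 PP
  obtain ⟨ε, hε, hNε, ⟨σ, hσ⟩, σ', hσ'⟩ := curv_eq_of_const G hH (contMDiff_slice h.flow.smooth ht)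
    (contMDiff_slice h.flow.smooth_normal ht) PP hr hw ho hk
    fun q => (hc t ht q).trans (hc t ht p).symm
  have hNι : N t p = PP.ι w := by rw [hιw, (hPN t ht).2]; rfl
  -- At every time the normal is known to be the inward radial velocity, so the sign needs no
  -- orientation argument here.
  obtain rfl : ε = 1 := by
    rw [hNι] at hNε
    have h1 := congrArg (fun v => A.form (PP.ι w) v) hNε
    simp only [map_smul, smul_eq_mul, PP.form_ι, real_inner_self_eq_norm_sq, hw] at h1
    linarith
  simp only [one_mul] at hσ hσ'
  have hk0 : ∀ i, 0 < k i := fun i => by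
    have := (Geometry.curv_pos hr (σ.symm i)).trans_le (hσ (σ.symm i))
    simpa using this
  -- Comparison from both sides, each up to a permutation, identifies W k without identifying the
  -- list k.
  have hWk : W k = W (G.curv (R - φ t)) :=
    le_antisymm (hW.ge_of_perm hk0 σ' hσ') (hW.le_of_perm (Geometry.curv_pos hr) σ hσ)
  have h1 := hasDerivAt_chord G.symm o hd
  have hfo : P t p - o = -(G.profile.S (R - φ t) • PP.ι w + G.profile.C (R - φ t) • PP.β w w) := by
    conv_lhs => rw [ho, Polar.exp]
    abel
  have h2 : A.form (P t p - o) (W k • N t p) = -(G.profile.S (R - φ t) * W k) := by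
    rw [hfo, hNι]
    simp only [map_neg, map_add, map_smul, LinearMap.neg_apply, LinearMap.add_apply,
      LinearMap.smul_apply, smul_eq_mul, PP.form_ι, PP.form_β_ι, real_inner_self_eq_norm_sq, hw]
    ring
  rw [h2] at h1
  have hD := G.profile.hasDerivAt_D hr
  rw [← hc t ht p] at hD
  have h3 := hD.comp_hasDerivWithinAt t h1
  -- Near t the radius stays in the open set I, where it equals D of the chord.
  refine HasDerivWithinAt.congr_of_eventuallyEq_of_mem (h3.congr_deriv ?_) ?_ ht
  · have := (G.profile.S_pos _ hr).ne'
    rw [hWk]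
    field_simp
  · have h4 : ContinuousWithinAt (fun s => R - φ s) (timeInterval T) t :=
      continuousWithinAt_const.sub (h.parallel.smooth.continuousOn t ht)
    filter_upwards [h4 (G.profile.isOpen_I.mem_nhds hr), self_mem_nhdsWithin] with s hs hsT
    simp only [Function.comp, hc s hsT p]
    exact (G.profile.D_C _ (G.profile.I_subset hs)).symm

/-- Spherical flows are unique up to parametrization. -/
lemma IsSphericalFlow.unique (hn : 1 ≤ n) (hW : IsWeingarten Γ W) (c : Geometry.Clock G W R)
    {T : EReal} {φ : ℝ → ℝ} {P N : ℝ → UnitSphere n → A.V}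
    (h : IsSphericalFlow A Γ W o R T φ P N) :
    T ≤ c.Φ R ∧ ∃ η : UnitSphere n → Euc n, ContMDiff (𝓡 n) 𝓘(ℝ, Euc n) ∞ η ∧
      (∀ p, ‖η p‖ = 1) ∧ (∀ p, Function.Injective (diffE η p)) ∧ ∀ t ∈ timeInterval T,
        P t = sphereMap Po (c.ρ t) η ∧ N t = sphereNormal Po (c.ρ t) η := by
  have hne := nonempty_unitSphere n
  obtain ⟨η, hη, hη1, hηi, hPN⟩ := h.exists_param Po c.mem
  have hder := fun t ht => h.hasDerivWithinAt_radius Po hW hη1 hPN (t := t) ht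
  let r : ℝ → ℝ := fun t => R - φ t
  have hr0 : r 0 = R := by simp [r, h.parallel.zero]
  have hRpos := G.profile.pos R c.mem
  have hrc : ContinuousOn r (timeInterval T) := continuousOn_const.sub h.parallel.smooth.continuousOn
  -- At radius 0 the map would be constant, which an immersion in positive dimension is not.
  -- Starting from R > 0, the radius then stays positive by continuity.
  have hrne : ∀ t ∈ timeInterval T, r t ≠ 0 := fun t ht hrt => by
    obtain ⟨p, hp⟩ := (h.flow.hypersurface t ht).exists_ne hn o
    rw [(hPN t ht).1] at hp
    refine hp ?_
    have : R - φ t = 0 := hrt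
    rw [this, sphereMap, Po.exp_zero]
  have hrpos : ∀ t ∈ timeInterval T, 0 < r t := fun t ht => by
    by_contra! hle
    obtain ⟨s, hs, hs0⟩ := intermediate_value_Icc' ht.1 (hrc.mono (Icc_subset_timeInterval ht))
      ⟨hle, hr0.symm ▸ hRpos.le⟩
    exact hrne s (Icc_subset_timeInterval ht hs) hs0
  have hdiff : ∀ t ∈ timeInterval T, ∃ a, HasDerivWithinAt r a (timeInterval T) t ∧
      (r t = R → a < 0) := fun t ht => by
    by_cases hrt : r t = R
    · have hI : R - φ t ∈ G.profile.I := by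
        have : R - φ t = R := hrt
        rw [this]
        exact c.mem
      exact ⟨_, hder t ht hI, fun _ => neg_lt_zero.2 (Geometry.speed_pos hW hI)⟩
    · exact ⟨_, (((h.parallel.smooth t ht).differentiableWithinAt (by simp)).const_sub R).hasDerivWithinAt,
        fun h => absurd h hrt⟩
  -- The radius equation is only known for radii in I, so a barrier argument comes first: wherever
  -- the radius equals R its right derivative is negative, hence it never exceeds R.
  have hrle : ∀ b ∈ timeInterval T, r b ≤ R := fun b hb => by
    choose! a ha ha' using hdiff
    have hsub := Icc_subset_timeInterval hb
    refine image_le_of_deriv_right_lt_deriv_boundary' (f' := a) (B := fun _ => R) (B' := fun _ => 0)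
      (hrc.mono hsub) (fun s hs => ?_) hr0.le continuousOn_const
      (fun s _ => hasDerivWithinAt_const _ _ _) (fun s hs => ha' s (hsub ⟨hs.1, hs.2.le⟩))
      (right_mem_Icc.2 hb.1)
    exact (ha s (hsub ⟨hs.1, hs.2.le⟩)).mono_of_mem_nhdsWithin
      (timeInterval_mem_nhdsGE hs.1 hb hs.2)
  have hrI : ∀ t ∈ timeInterval T, r t ∈ G.profile.I := fun t ht =>
    G.profile.mem_I R c.mem _ (hrpos t ht) (hrle t ht)
  -- Separation of variables: Φ(r) + t has right derivative zero. Injectivity of Φ then identifies r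
  -- with ρ.
  have hΦ : ∀ b ∈ timeInterval T, c.Φ (r b) + b = c.Φ R := fun b hb => by
    have hsub := Icc_subset_timeInterval hb
    have h1 := constant_of_has_deriv_right_zero (f := fun t => c.Φ (r t) + t) (a := 0) (b := b)
      ((c.continuous.comp_continuousOn (hrc.mono hsub)).add continuousOn_id) (fun s hs => ?_)
      b (right_mem_Icc.2 hb.1)
    · rw [h1, hr0, add_zero]
    · have hs' := hsub ⟨hs.1, hs.2.le⟩
      have h2 := ((c.hasDerivAt _ (hrI s hs') (hrle s hs')).comp_hasDerivWithinAt s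
        ((hder s hs' (hrI s hs')).mono_of_mem_nhdsWithin
          (timeInterval_mem_nhdsGE hs.1 hb hs.2))).add (hasDerivWithinAt_id s _)
      refine h2.congr_deriv ?_
      have := (Geometry.speed_pos hW (hrI s hs')).ne'
      simp only [r] at this ⊢
      field_simp
      ring
  have hlt : ∀ t ∈ timeInterval T, t < c.Φ R := fun t ht => by
    have h1 := c.strictMono self_mem_Ici (hrpos t ht).le (hrpos t ht)
    rw [c.zero] at h1
    linarith [hΦ t ht]
  refine ⟨le_of_forall_timeInterval (Clock_pos c).le hlt, η, hη, hη1, hηi, fun t ht => ?_⟩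
  have hmem : t ∈ Ioo (-c.δ) (c.Φ R) := ⟨by linarith [c.δ_pos, ht.1], hlt t ht⟩
  have heq : R - φ t = c.ρ t := c.strictMono.injOn (hrpos t ht).le
    (G.profile.pos _ (c.ρ_mem t hmem)).le (by rw [c.Φ_ρ t hmem]; linarith [hΦ t ht])
  rw [← heq]
  exact hPN t ht

end SphericalFlow

/-- Flows and shrinking spheres in a space with geodesic polar coordinates. -/
theorem main_of_geometry {n : ℕ} (hn : 1 ≤ n) {A : Ambient} (G : Geometry A n)
    {M : Type*} [TopologicalSpace M] [ChartedSpace (EuclideanSpace ℝ (Fin n)) M]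
    [IsManifold (𝓡 n) ∞ M] [CompactSpace M] [Nonempty M]
    {Γ : Set (Fin n → ℝ)} {W : (Fin n → ℝ) → ℝ} (hW : IsWeingarten Γ W)
    {T : EReal} {F N : ℝ → M → A.V} (hF : IsWFlow A Γ W T F N)
    {o : A.V} (ho : o ∈ A.carrier) {R : ℝ} (hR : R ∈ G.profile.I)
    (hball : range (F 0) ⊆ A.geodesicBall o R)
    (horient : IsOdd Γ W ∨ ∀ t ∈ timeInterval T, IsEmbedding (F t) ∧
      (range (F t) ⊆ A.geodesicBall o R → IsInward A (A.geodesicBall o R) (F t) (N t))) :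
    (∃ T_R φ P ν, IsMaximalSphericalFlow A Γ W o R T_R φ P ν) ∧
    ∀ T_R φ P ν, IsMaximalSphericalFlow A Γ W o R T_R φ P ν →
      (∀ t ∈ timeInterval T, Disjoint (range (F t)) (range (P t))) ∧ T ≤ T_R ∧ T_R < ⊤ := by
  obtain ⟨c⟩ := Geometry.nonempty_clock (G := G) hW hR
  have Po := G.polar o ho
  have havoid := fun t ht p => avoidance hn hW hF ho c hball horient (t := t) ht p
  have hΦ0 : ∀ x ∈ A.carrier, 0 ≤ c.Φ (G.profile.D (A.chord o x)) := fun x hx => by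
    obtain ⟨s, hs, w, hw, e⟩ := Po.surj x hx
    obtain rfl : x = Po.exp w s := e
    rw [Geometry.chord_exp Po hw, G.profile.D_C s hs, ← c.zero]
    exact c.strictMono.monotoneOn self_mem_Ici (G.profile.nonneg s hs) (G.profile.nonneg s hs)
  -- M is nonempty and Φ of a distance is nonnegative, so the avoidance inequality leaves no time
  -- from Φ R on.
  have hlt : ∀ t ∈ timeInterval T, t < c.Φ R := fun t ht => by
    obtain ⟨p⟩ := ‹Nonempty M›
    linarith [havoid t ht p, hΦ0 _ ((hF.hypersurface t ht).mem p)]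
  have hTle : T ≤ c.Φ R := le_of_forall_timeInterval (Clock_pos c).le hlt
  refine ⟨⟨_, _, _, _, isSphericalFlow_sphere Po hW c, fun T' φ' P' N' h _ =>
    (h.unique Po hn hW c).1⟩, fun T_R φ P ν hP => ?_⟩
  obtain ⟨hle, η, hη, hη1, hηi, hPν⟩ := hP.isSphericalFlow.unique Po hn hW c
  have h0 := hPν 0 (zero_mem_timeInterval hP.isSphericalFlow.pos)
  -- With its own parametrization η the given flow continues up to Φ R, and maximality forces T_R to
  -- be that time.
  obtain rfl : T_R = c.Φ R := le_antisymm hle <| hP.maximal (c.Φ R) (fun t => R - c.ρ t)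
    (fun t => sphereMap Po (c.ρ t) η) (fun t => sphereNormal Po (c.ρ t) η)
    ⟨EReal.coe_pos.2 (Clock_pos c), h0.1 ▸ hP.isSphericalFlow.embedding,
      h0.1 ▸ hP.isSphericalFlow.initial, h0.1 ▸ h0.2 ▸ hP.isSphericalFlow.inward,
      isParallelFlow_sphere Po c hη1 le_rfl, isWFlow_sphere Po hW c hη hη1 hηi le_rfl⟩
    fun t ht => ((hPν t ht).1).symm
  refine ⟨fun t ht => ?_, hTle, EReal.coe_lt_top _⟩
  have ht' := timeInterval_subset c hTle ht
  have ht'' : t ∈ timeInterval (c.Φ R) := ⟨ht.1, ht.2.trans_le hTle⟩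
  rw [Set.disjoint_left]
  rintro _ ⟨p, rfl⟩ ⟨q, hq⟩
  have h1 := havoid t ht p
  -- At a common point the distance is ρ t, and Φ(ρ t) + t = Φ R contradicts the strict inequality.
  rw [← hq, (hPν t ht'').1, sphereMap, Geometry.chord_exp Po (hη1 q),
    G.profile.D_C _ (G.profile.I_subset (c.ρ_mem t ht')), c.Φ_ρ t ht'] at h1
  linarith

/-! ### The generalized trigonometric functions -/

/-- Curvature `0`. -/
def Profile.flat : Profile where
  κ := 0
  S := id
  C s := s ^ 2 / 2
  D y := √(2 * y)
  J := Ici 0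
  I := Ioi 0
  S_zero := rfl
  C_zero := by simp
  hasDerivAt_S s := by simpa using hasDerivAt_id s
  hasDerivAt_C s := ((hasDerivAt_pow 2 s).div_const 2).congr_deriv (by simp)
  contDiff_S := contDiff_id
  contDiff_C := (contDiff_id.pow 2).div_const 2
  continuous_D := by fun_prop
  D_C s hs := by rw [mul_div_cancel₀ _ two_ne_zero, Real.sqrt_sq hs]
  C_D r (hr : 0 < r) := by
    filter_upwards [lt_mem_nhds (show 0 < r ^ 2 / 2 by positivity)] with y hy
    rw [Real.sq_sqrt (by linarith)]
    ring
  strictMonoOn_C s (hs : 0 ≤ s) t _ hst := by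
    have : s ^ 2 < t ^ 2 := by gcongr
    simp only
    linarith
  zero_mem := self_mem_Ici
  nonneg _ hs := hs
  I_subset := Ioi_subset_Ici_self
  isOpen_I := isOpen_Ioi
  pos _ hr := hr
  mem_I _ _ _ hs _ := hs
  S_pos _ hr := hr
  cos_pos _ _ := by simp

/-- Curvature `1`. -/
def Profile.spherical : Profile where
  κ := 1
  S := Real.sin
  C s := 1 - Real.cos s
  -- Half-angle formula: 1 - cos s = 2 sin²(s/2).
  D y := 2 * Real.arcsin √(y / 2)
  J := Icc 0 Real.pi
  -- Beyond π/2 the distance spheres are no longer convex towards their centre, while J has to reach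
  -- the antipode.
  I := Ioo 0 (Real.pi / 2)
  S_zero := Real.sin_zero
  C_zero := by simp
  hasDerivAt_S s := by simpa using Real.hasDerivAt_sin s
  hasDerivAt_C s := ((Real.hasDerivAt_cos s).const_sub 1).congr_deriv (by simp)
  contDiff_S := Real.contDiff_sin
  contDiff_C := contDiff_const.sub Real.contDiff_cos
  continuous_D := continuous_const.mul (Real.continuous_arcsin.comp (by fun_prop))
  D_C s hs := by
    have h1 : (1 - Real.cos s) / 2 = Real.sin (s / 2) ^ 2 := by
      have h := Real.cos_two_mul (s / 2)
      rw [mul_div_cancel₀ _ two_ne_zero, Real.cos_sq'] at h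
      linarith
    have hpi := Real.pi_pos
    rw [h1, Real.sqrt_sq (Real.sin_nonneg_of_nonneg_of_le_pi (by linarith [hs.1])
      (by linarith [hs.2])), Real.arcsin_sin (by linarith [hs.1]) (by linarith [hs.2])]
    ring
  C_D r hr := by
    have hpi := Real.pi_pos
    have h1 : 0 < Real.cos r := Real.cos_pos_of_mem_Ioo ⟨by linarith [hr.1], hr.2⟩
    have h2 : Real.cos r < 1 := by
      simpa using Real.cos_lt_cos_of_nonneg_of_le_pi le_rfl (by linarith [hr.2]) hr.1
    filter_upwards [Ioo_mem_nhds (show 0 < 1 - Real.cos r by linarith)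
      (show 1 - Real.cos r < 1 by linarith)] with y hy
    have h3 : √(y / 2) ≤ 1 := Real.sqrt_le_one.2 (by linarith [hy.2])
    have h4 := Real.sqrt_nonneg (y / 2)
    rw [Real.cos_two_mul, Real.cos_sq', Real.sin_arcsin (by linarith) h3,
      Real.sq_sqrt (by linarith [hy.1])]
    ring
  strictMonoOn_C s hs t ht hst := sub_lt_sub_left (Real.strictAntiOn_cos hs ht hst) 1
  zero_mem := ⟨le_rfl, Real.pi_pos.le⟩
  nonneg _ hs := hs.1
  I_subset _ hs := ⟨hs.1.le, by linarith [hs.1, hs.2]⟩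
  isOpen_I := isOpen_Ioo
  pos _ hr := hr.1
  mem_I _ hr _ hs hsr := ⟨hs, hsr.trans_lt hr.2⟩
  S_pos _ hr := Real.sin_pos_of_pos_of_lt_pi hr.1 (by linarith [hr.1, hr.2])
  cos_pos r hr := by
    have := Real.cos_pos_of_mem_Ioo (x := r) ⟨by linarith [hr.1, hr.2], hr.2⟩
    linarith

/-- Curvature `-1`. -/
def Profile.hyperbolic : Profile where
  κ := -1
  S := Real.sinh
  C s := Real.cosh s - 1
  -- Half-angle formula: cosh s - 1 = 2 sinh²(s/2).
  D y := 2 * Real.arsinh √(y / 2)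
  J := Ici 0
  I := Ioi 0
  S_zero := Real.sinh_zero
  C_zero := by simp
  hasDerivAt_S s := by simpa using Real.hasDerivAt_sinh s
  hasDerivAt_C s := (Real.hasDerivAt_cosh s).sub_const 1
  contDiff_S := Real.contDiff_sinh
  contDiff_C := Real.contDiff_cosh.sub contDiff_const
  continuous_D := continuous_const.mul (Real.continuous_arsinh.comp (by fun_prop))
  D_C s (hs : 0 ≤ s) := by
    have h1 : (Real.cosh s - 1) / 2 = Real.sinh (s / 2) ^ 2 := by
      have h := Real.cosh_two_mul (s / 2)
      rw [mul_div_cancel₀ _ two_ne_zero, Real.cosh_sq] at h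
      linarith
    rw [h1, Real.sqrt_sq (Real.sinh_nonneg_iff.2 (by linarith)), Real.arsinh_sinh]
    ring
  C_D r (hr : 0 < r) := by
    filter_upwards [lt_mem_nhds (sub_pos.2 (Real.one_lt_cosh.2 hr.ne'))] with y hy
    rw [Real.cosh_two_mul, Real.cosh_sq, Real.sinh_arsinh, Real.sq_sqrt (by linarith)]
    ring
  strictMonoOn_C s (hs : 0 ≤ s) t (ht : 0 ≤ t) hst := by
    refine sub_lt_sub_right (Real.cosh_lt_cosh.2 ?_) 1
    rwa [abs_of_nonneg hs, abs_of_nonneg ht]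
  zero_mem := self_mem_Ici
  nonneg _ hs := hs
  I_subset := Ioi_subset_Ici_self
  isOpen_I := isOpen_Ioi
  pos _ hr := hr
  mem_I _ _ _ hs _ := hs
  S_pos _ hr := Real.sinh_pos_iff.2 hr
  cos_pos r _ := by linarith [Real.cosh_pos r]

lemma Profile.contDiff_curve (p : Profile) {A : Ambient} (x a b : A.V) :
    ContDiff ℝ ∞ fun s => x + p.S s • a + p.C s • b :=
  (contDiff_const.add (p.contDiff_S.smul contDiff_const)).add (p.contDiff_C.smul contDiff_const)

lemma Profile.deriv_curve (p : Profile) {A : Ambient} (x a b : A.V) :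
    (deriv fun s => x + p.S s • a + p.C s • b) = fun s => (1 - p.κ * p.C s) • a + p.S s • b :=
  funext fun s => ((((p.hasDerivAt_S s).smul_const a).const_add x).add
    ((p.hasDerivAt_C s).smul_const b)).deriv

lemma Profile.deriv_deriv_curve (p : Profile) {A : Ambient} (x a b : A.V) (s : ℝ) :
    deriv (deriv fun s => x + p.S s • a + p.C s • b) s =
      -(p.κ * p.S s) • a + (1 - p.κ * p.C s) • b := by
  rw [p.deriv_curve]
  exact (((((p.hasDerivAt_C s).const_mul p.κ).const_sub 1).smul_const a).add
    ((p.hasDerivAt_S s).smul_const b)).deriv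

/-- Initial velocities of curves of the form `x + S ι w + C β w w`, up to scaling. -/
lemma Profile.range_subset_tangent (p : Profile) {A : Ambient} {n : ℕ} {x : A.V}
    {ι : Euc n →ₗ[ℝ] A.V} {β : Euc n → A.V} (hx : x ∈ A.carrier)
    (h : ∀ w, ‖w‖ = 1 → ∀ s, x + p.S s • ι w + p.C s • β w ∈ A.carrier) :
    range ι ⊆ A.tangent x := by
  rintro _ ⟨ξ, rfl⟩
  rcases eq_or_ne ξ 0 with rfl | hξ
  · exact ⟨fun _ => x, fun _ => hx, rfl, by simpa using hasDerivAt_const (0 : ℝ) x⟩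
  have hw : ‖(‖ξ‖⁻¹ • ξ : Euc n)‖ = 1 := by
    rw [norm_smul, norm_inv, norm_norm, inv_mul_cancel₀ (norm_ne_zero_iff.2 hξ)]
  have h1 := ((p.contDiff_curve x (ι (‖ξ‖⁻¹ • ξ)) (β (‖ξ‖⁻¹ • ξ))).differentiable
    (by simp) (0 * ‖ξ‖)).hasDerivAt
  rw [p.deriv_curve] at h1
  refine ⟨fun s => x + p.S (s * ‖ξ‖) • ι (‖ξ‖⁻¹ • ξ) + p.C (s * ‖ξ‖) • β (‖ξ‖⁻¹ • ξ),
    fun s => h _ hw _, by simp [p.S_zero, p.C_zero], ?_⟩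
  refine (h1.scomp 0 ((hasDerivAt_id (0 : ℝ)).mul_const ‖ξ‖)).congr_deriv ?_
  simp [p.S_zero, p.C_zero, smul_smul, norm_ne_zero_iff.2 hξ]

lemma finrank_range_id (n : ℕ) :
    Module.finrank ℝ (LinearMap.range (LinearMap.id : Euc n →ₗ[ℝ] Euc n)) = n + 1 := by
  rw [LinearMap.range_id, finrank_top]
  simp

lemma exists_unit (n : ℕ) : ∃ w : Euc n, ‖w‖ = 1 :=
  ⟨EuclideanSpace.single 0 1, by simp⟩

lemma exists_unit_smul {n : ℕ} (v : Euc n) : ∃ w : Euc n, ‖w‖ = 1 ∧ v = ‖v‖ • w := by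
  rcases eq_or_ne v 0 with rfl | hv
  · obtain ⟨w, hw⟩ := exists_unit n
    exact ⟨w, hw, by simp⟩
  · have h := norm_ne_zero_iff.2 hv
    exact ⟨‖v‖⁻¹ • v, by rw [norm_smul, norm_inv, norm_norm, inv_mul_cancel₀ h],
      by rw [smul_smul, mul_inv_cancel₀ h, one_smul]⟩

/-! ### Euclidean space -/

lemma euclidean_tangent {n : ℕ} (x : (euclidean n).V) : (euclidean n).tangent x = univ :=
  eq_univ_of_forall fun v => ⟨fun s => x + s • v, fun _ => mem_univ _, by simp, by
    simpa using ((hasDerivAt_id (0 : ℝ)).smul_const v).const_add x⟩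

lemma euclidean_geodesic {n : ℕ} {γ : ℝ → (euclidean n).V} (hγ : (euclidean n).IsUnitGeodesic γ)
    (s : ℝ) : deriv (deriv γ) s = 0 := by
  have h := hγ.geodesic s (deriv (deriv γ) s) (by rw [euclidean_tangent]; trivial)
  exact inner_self_eq_zero (𝕜 := ℝ) (E := Euc n).1 h

/-- Polar coordinates of Euclidean space. -/
def euclideanPolar (n : ℕ) (x : (euclidean n).V) :
    Polar (euclidean n) n Profile.flat (n + 1) x where
  ι := LinearMap.id
  β := 0
  K _ := LinearMap.id
  form_ι _ _ := rfl
  β_symm _ _ := rfl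
  form_β_ι _ _ := by simp
  tangent_eq := by rw [euclidean_tangent]; exact (range_id (α := Euc n)).symm
  sff c _ _ _ w ξ _ := by simp [Profile.flat]
  K_symm _ _ _ := rfl
  K_self _ _ := rfl
  K_idem _ _ _ := rfl
  K_rank _ _ := finrank_range_id n
  isGeodesic w hw := by
    refine ⟨Profile.flat.contDiff_curve _ _ _, fun _ => mem_univ _, fun s => ?_, fun s v _ => ?_⟩
    · rw [Profile.deriv_curve]
      have : inner ℝ w w = (1 : ℝ) := by rw [real_inner_self_eq_norm_sq, hw, one_pow]
      simp only [Profile.flat, zero_mul, sub_zero, one_smul, LinearMap.zero_apply, smul_zero,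
        add_zero]
      exact this
    · rw [Profile.deriv_deriv_curve]
      simp [Profile.flat]
  geodesic_second γ hγ _ w _ := euclidean_geodesic hγ 0
  surj y _ := by
    obtain ⟨w, hw, h⟩ := exists_unit_smul (n := n) (y - x)
    refine ⟨‖(y - x : Euc n)‖, norm_nonneg (y - x : Euc n), w, hw, ?_⟩
    refine (eq_add_of_sub_eq' h).trans ?_
    simp [Profile.flat]
    rfl

/-- The geometry of Euclidean space. -/
def euclideanGeometry (n : ℕ) : Geometry (euclidean n) n where
  profile := Profile.flat
  d := n + 1
  finiteDimensional := inferInstanceAs (FiniteDimensional ℝ (Euc n))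
  symm x y := real_inner_comm (F := Euc n) y x
  one_le_d := by omega
  d_le := le_rfl
  d_eq := Or.inr rfl
  third γ hγ s := by
    have : deriv (deriv γ) = fun _ => 0 := funext fun s => euclidean_geodesic hγ s
    rw [this]
    simp [Profile.flat]
  polar x _ := euclideanPolar n x

/-! ### Quadrics -/

section Quadric

variable {A : Ambient} [FiniteDimensional ℝ A.V] {n : ℕ} {p : Profile}
  (hκ : p.κ = 1 ∨ p.κ = -1) (hsymm : ∀ x y, A.form x y = A.form y x)
  (hcar : ∀ x ∈ A.carrier, A.form x x = p.κ)
include hsymm hcar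

lemma quadric_deriv {x v : A.V} (hv : v ∈ A.tangent x) : A.form x v = 0 := by
  obtain ⟨c, hc, rfl, hd⟩ := hv
  have h1 := hasDerivAt_form hd hd
  have h2 : HasDerivAt (fun s => A.form (c s) (c s)) 0 0 :=
    (hasDerivAt_const (0 : ℝ) p.κ).congr_of_eventuallyEq
      (Eventually.of_forall fun s => hcar _ (hc s))
  have h3 := h1.unique h2
  rw [hsymm v] at h3
  linarith

/-- ⟨c, c⟩ = κ differentiated twice: the component of the acceleration along the position vector is
fixed by the speed. -/
lemma quadric_second {c : ℝ → A.V} {s : ℝ} (hc : ∀ᶠ u in 𝓝 s, c u ∈ A.carrier)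
    (hd : ContDiffAt ℝ 2 c s) :
    A.form (c s) (deriv (deriv c) s) = -A.form (deriv c s) (deriv c s) := by
  have hev : ∀ᶠ u in 𝓝 s, HasDerivAt c (deriv c u) u := by
    filter_upwards [(hd.of_le one_le_two : ContDiffAt ℝ 1 c s).eventually (by simp)] with u hu
    exact (hu.differentiableAt (by simp)).hasDerivAt
  have h1 : ∀ᶠ u in 𝓝 s, A.form (c u) (deriv c u) = 0 := by
    filter_upwards [hc.eventually_nhds, hev] with u hu hdu
    have h1 := hasDerivAt_form hdu hdu
    have h2 : HasDerivAt (fun s => A.form (c s) (c s)) 0 u :=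
      (hasDerivAt_const u p.κ).congr_of_eventuallyEq (hu.mono fun s hs => hcar _ hs)
    have h3 := h1.unique h2
    rw [hsymm (deriv c u)] at h3
    linarith
  have h2 : HasDerivAt (deriv c) (deriv (deriv c) s) s :=
    (((hd.fderiv_right (m := 1) (by norm_num)).clm_apply contDiffAt_const).differentiableAt
      (by simp)).hasDerivAt
  have h3 := hasDerivAt_form hev.self_of_nhds h2
  have h4 := h3.unique ((hasDerivAt_const s (0 : ℝ)).congr_of_eventuallyEq h1)
  linarith

omit [FiniteDimensional ℝ A.V] in
include hκ in
lemma quadric_form_curve {x a : A.V} (hx : x ∈ A.carrier) (ha : A.form a a = 1)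
    (hxa : A.form x a = 0) (s : ℝ) : A.form (x + p.S s • a + p.C s • (-(p.κ • x)))
      (x + p.S s • a + p.C s • (-(p.κ • x))) = p.κ := by
  simp only [map_neg, map_add, map_smul, LinearMap.neg_apply, LinearMap.add_apply,
    LinearMap.smul_apply, smul_eq_mul, ha, hsymm a x, hxa, hcar x hx]
  have hκ2 : p.κ * p.κ = 1 := by rcases hκ with h | h <;> rw [h] <;> norm_num
  linear_combination p.S_sq s + (p.κ * p.C s ^ 2 - 2 * p.C s) * hκ2

variable (ι : ∀ x ∈ A.carrier, Euc n →ₗ[ℝ] A.V)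
  (hι : ∀ x hx v w, A.form (ι x hx v) (ι x hx w) = inner ℝ v w)
  (hxι : ∀ x hx v, A.form x (ι x hx v) = 0)
  (hrange : ∀ x hx y, A.form x y = 0 → ∃ v, ι x hx v = y)
  (hmem : ∀ x hx w, ‖w‖ = 1 → ∀ s, x + p.S s • ι x hx w + p.C s • (-(p.κ • x)) ∈ A.carrier)
  (hdist : ∀ x ∈ A.carrier, ∀ y ∈ A.carrier, ∃ s ∈ p.J, 0 ≤ p.S s ∧ A.form x y = p.κ - p.C s)

include hrange hmem in
lemma quadric_tangent {x : A.V} (hx : x ∈ A.carrier) : A.tangent x = range (ι x hx) := by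
  refine Subset.antisymm (fun v hv => hrange x hx v (quadric_deriv hsymm hcar hv)) ?_
  exact p.range_subset_tangent hx (β := fun _ => -(p.κ • x)) (hmem x hx)

-- γ'' + κγ is orthogonal to γ, hence in the range of ι. The geodesic equation makes it orthogonal
-- to that range, on which the form is definite, so it vanishes.
include hκ hι hxι hrange hmem in
lemma quadric_geodesic {γ : ℝ → A.V} (hγ : A.IsUnitGeodesic γ) (s : ℝ) :
    deriv (deriv γ) s = -(p.κ • γ s) := by
  have h1 := quadric_second hsymm hcar (c := γ) (s := s) (Eventually.of_forall hγ.mem)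
    (hγ.smooth.contDiffAt.of_le (by norm_cast))
  rw [hγ.unit] at h1
  have h2 : A.form (γ s) (deriv (deriv γ) s + p.κ • γ s) = 0 := by
    rw [map_add, map_smul, smul_eq_mul, hcar _ (hγ.mem s), h1]
    rcases hκ with h | h <;> rw [h] <;> norm_num
  obtain ⟨u, hu⟩ := hrange _ (hγ.mem s) _ h2
  have h3 : inner ℝ u u = (0 : ℝ) := by
    have h4 : A.form (ι _ (hγ.mem s) u) (ι _ (hγ.mem s) u) = 0 := by
      conv_lhs => enter [1]; rw [hu]
      rw [map_add, map_smul, LinearMap.add_apply, LinearMap.smul_apply, hxι, smul_zero, add_zero]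
      refine hγ.geodesic s _ ?_
      rw [quadric_tangent hsymm hcar ι hrange hmem (hγ.mem s)]
      exact mem_range_self _
    rwa [hι] at h4
  rw [inner_self_eq_zero.1 h3, map_zero] at hu
  exact eq_neg_of_add_eq_zero_left hu.symm

/-- Polar coordinates of a quadric. -/
def quadricPolar {x : A.V} (hx : x ∈ A.carrier) : Polar A n p (n + 1) x where
  ι := ι x hx
  β := LinearMap.mk₂ ℝ (fun v w => -(inner ℝ v w • p.κ • x))
    (fun u v w => by rw [inner_add_left]; module)
    (fun c v w => by rw [real_inner_smul_left]; module)
    (fun u v w => by rw [inner_add_right]; module)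
    (fun c v w => by rw [real_inner_smul_right]; module)
  -- In constant curvature K is the identity at unit vectors. The factor makes `sff` hold for all w,
  -- quadratically like β w w.
  K w := ‖w‖ ^ 2 • LinearMap.id
  form_ι := hι x hx
  β_symm v w := by simp only [LinearMap.mk₂_apply, real_inner_comm]
  form_β_ι w v := by simp [hxι]
  tangent_eq := quadric_tangent hsymm hcar ι hrange hmem hx
  sff c hc h0 hd w ξ hξ := by
    have h1 := quadric_second hsymm hcar hc hd
    rw [h0, hξ, hι] at h1
    simp only [LinearMap.mk₂_apply, map_neg, map_smul, LinearMap.neg_apply, LinearMap.smul_apply,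
      smul_eq_mul, h1, LinearMap.id_apply, real_inner_smul_left, real_inner_self_eq_norm_sq]
    ring
  K_symm w ξ η := by
    simp only [LinearMap.smul_apply, LinearMap.id_apply, real_inner_smul_left,
      real_inner_smul_right]
  K_self w hw := by simp [hw]
  K_idem w hw ξ := by simp [hw]
  K_rank w hw := by
    rw [hw, one_pow, one_smul]
    exact finrank_range_id n
  isGeodesic w hw := by
    have hww : inner ℝ w w = (1 : ℝ) := by rw [real_inner_self_eq_norm_sq, hw, one_pow]
    have hκ2 : p.κ * p.κ = 1 := by rcases hκ with h | h <;> rw [h] <;> norm_num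
    simp only [LinearMap.mk₂_apply, hww, one_smul]
    refine ⟨p.contDiff_curve _ _ _, hmem x hx w hw, fun s => ?_, fun s v hv => ?_⟩
    · rw [p.deriv_curve]
      simp only [map_neg, map_add, map_smul, LinearMap.neg_apply, LinearMap.add_apply,
        LinearMap.smul_apply, smul_eq_mul, hι, hww, hsymm (ι x hx w) x, hxι, hcar x hx]
      linear_combination p.κ * p.S_sq s + p.S s ^ 2 * p.κ * hκ2
    · have h1 := quadric_deriv hsymm hcar hv
      rw [p.deriv_deriv_curve]
      have h2 : -(p.κ * p.S s) • ι x hx w + (1 - p.κ * p.C s) • -(p.κ • x) =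
          (-p.κ) • (x + p.S s • ι x hx w + p.C s • -(p.κ • x)) := by module
      rw [h2, map_smul, LinearMap.smul_apply, h1, smul_zero]
  geodesic_second γ hγ h0 w hw := by
    have h1 := hγ.unit 0
    rw [hw, hι] at h1
    rw [quadric_geodesic hκ hsymm hcar ι hι hxι hrange hmem hγ, h0, LinearMap.mk₂_apply, h1,
      one_smul]
  surj y hy := by
    obtain ⟨s, hs, hS, hf⟩ := hdist x hx y hy
    have hκ2 : p.κ * p.κ = 1 := by rcases hκ with h | h <;> rw [h] <;> norm_num
    -- The part of y orthogonal to x, namely y - (1 - κC)x, is tangent of norm S; this is the polar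
    -- decomposition of y.
    obtain ⟨u, hu⟩ := hrange x hx (y - (1 - p.κ * p.C s) • x) (by
      rw [map_sub, map_smul, smul_eq_mul, hf, hcar x hx]
      linear_combination p.C s * hκ2)
    have hnorm : ‖u‖ = p.S s := by
      have h1 := hι x hx u u
      rw [hu, real_inner_self_eq_norm_sq] at h1
      simp only [map_sub, map_smul, LinearMap.sub_apply, LinearMap.smul_apply, smul_eq_mul,
        hcar x hx, hcar y hy, hsymm y x, hf] at h1
      have h2 : ‖u‖ ^ 2 = p.S s ^ 2 := by
        rw [← h1, p.S_sq]
        linear_combination p.κ * p.C s ^ 2 * hκ2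
      exact (pow_left_inj₀ (norm_nonneg u) hS two_ne_zero).1 h2
    obtain ⟨w, hw, hw'⟩ := exists_unit_smul u
    refine ⟨s, hs, w, hw, ?_⟩
    rw [hnorm] at hw'
    rw [← map_smul, ← hw', hu, LinearMap.mk₂_apply, real_inner_self_eq_norm_sq, hw]
    module

include hκ hι hxι hrange hmem hdist in
/-- The geometry of a quadric. -/
def quadricGeometry : Geometry A n where
  profile := p
  d := n + 1
  finiteDimensional := inferInstance
  symm := hsymm
  one_le_d := by omega
  d_le := le_rfl
  d_eq := Or.inr rfl
  third γ hγ s := by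
    have : deriv (deriv γ) = fun s => -(p.κ • γ s) :=
      funext fun s => quadric_geodesic hκ hsymm hcar ι hι hxι hrange hmem hγ s
    rw [this, deriv.fun_neg, deriv_fun_const_smul _ (hγ.smooth.differentiable (by simp) s), neg_smul]
  polar x hx := quadricPolar hκ hsymm hcar ι hι hxι hrange hmem hdist hx

end Quadric

/-! ### The sphere -/

lemma exists_isometry_orthogonal {n : ℕ} {x : EuclideanSpace ℝ (Fin (n + 2))} (hx : ‖x‖ = 1) :
    ∃ L : Euc n →ₗ[ℝ] EuclideanSpace ℝ (Fin (n + 2)), (∀ v w, inner ℝ (L v) (L w) = inner ℝ v w) ∧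
      (∀ v, inner ℝ x (L v) = 0) ∧ ∀ y, inner ℝ x y = 0 → ∃ v, L v = y := by
  let U : Submodule ℝ (EuclideanSpace ℝ (Fin (n + 2))) := (ℝ ∙ x)ᗮ
  have hU : Module.finrank ℝ U = n + 1 := by
    have := Submodule.finrank_add_finrank_orthogonal (ℝ ∙ x)
    rw [finrank_span_singleton (fun h => by simp [h] at hx)] at this
    simp only [finrank_euclideanSpace_fin] at this
    change Module.finrank ℝ (ℝ ∙ x)ᗮ = n + 1
    omega
  let e := ((stdOrthonormalBasis ℝ U).reindex (finCongr hU)).repr.symm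
  refine ⟨U.subtype ∘ₗ e.toLinearEquiv.toLinearMap, fun v w => e.inner_map_map v w,
    fun v => Submodule.mem_orthogonal_singleton_iff_inner_right.1 (e v).2, fun y hy =>
    ⟨e.symm ⟨y, Submodule.mem_orthogonal_singleton_iff_inner_right.2 hy⟩, ?_⟩⟩
  change ((e (e.symm _) : U) : EuclideanSpace ℝ (Fin (n + 2))) = y
  rw [e.apply_symm_apply]

lemma inner_mem_Icc {E : Type*} [NormedAddCommGroup E] [InnerProductSpace ℝ E] {x y : E}
    (hx : ‖x‖ = 1) (hy : ‖y‖ = 1) : inner ℝ x y ∈ Icc (-1 : ℝ) 1 := by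
  have h := abs_le.1 (abs_real_inner_le_norm x y)
  rwa [hx, hy, one_mul] at h

/-- The geometry of the sphere. -/
lemma exists_geometry_sphere (n : ℕ) :
    ∃ G : Geometry (sphere n) n, G.profile = Profile.spherical := by
  have : FiniteDimensional ℝ (sphere n).V :=
    inferInstanceAs (FiniteDimensional ℝ (EuclideanSpace ℝ (Fin (n + 2))))
  have hsymm : ∀ x y, (sphere n).form x y = (sphere n).form y x := fun x y =>
    real_inner_comm (F := EuclideanSpace ℝ (Fin (n + 2))) y x
  have hnorm : ∀ x, (sphere n).form x x = ‖(x : EuclideanSpace ℝ (Fin (n + 2)))‖ ^ 2 := fun x =>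
    real_inner_self_eq_norm_sq (F := EuclideanSpace ℝ (Fin (n + 2))) x
  have hcar : ∀ x ∈ (sphere n).carrier, (sphere n).form x x = Profile.spherical.κ := fun x hx => by
    have hx' : ‖(x : EuclideanSpace ℝ (Fin (n + 2)))‖ = 1 := hx
    rw [hnorm, hx']
    norm_num [Profile.spherical]
  choose ι hι hxι hrange using fun x (hx : x ∈ (sphere n).carrier) =>
    exists_isometry_orthogonal (n := n) (x := x) hx
  refine ⟨quadricGeometry (p := Profile.spherical) (Or.inl rfl) hsymm hcar ι hι hxι hrange
    (fun x hx w hw s => ?_) (fun x hx y hy => ?_), rfl⟩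
  · have h := quadric_form_curve (p := Profile.spherical) (Or.inl rfl) hsymm hcar hx
      (a := ι x hx w) ((hι x hx w w).trans (by rw [real_inner_self_eq_norm_sq, hw, one_pow]))
      (hxι x hx w) s
    rw [hnorm] at h
    exact (pow_eq_one_iff_of_nonneg (norm_nonneg _) two_ne_zero).1 h
  · obtain ⟨h1, h2⟩ := inner_mem_Icc hx hy
    exact ⟨Real.arccos (inner ℝ (E := EuclideanSpace ℝ (Fin (n + 2))) x y),
      ⟨Real.arccos_nonneg _, Real.arccos_le_pi _⟩,
      Real.sin_nonneg_of_nonneg_of_le_pi (Real.arccos_nonneg _) (Real.arccos_le_pi _),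
      (Real.cos_arccos h1 h2).symm.trans (sub_sub_cancel _ _).symm⟩

/-! ### Real hyperbolic space -/

/-- The spatial part of a vector of Minkowski space. -/
def spatial {n : ℕ} (x : EuclideanSpace ℝ (Fin (n + 2))) : Euc n := WithLp.toLp 2 fun i => x i.succ

lemma lorentzForm_eq {n : ℕ} (x y : EuclideanSpace ℝ (Fin (n + 2))) :
    lorentzForm (n + 1) x y = -(x 0 * y 0) + inner ℝ (spatial x) (spatial y) := by
  simp only [lorentzForm, LinearMap.mk₂_apply]
  rw [Fin.sum_univ_succ]
  simp [signature, spatial, PiLp.inner_apply, Fin.succ_ne_zero, mul_comm]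

lemma lorentzForm_comm {n : ℕ} (x y : EuclideanSpace ℝ (Fin (n + 2))) :
    lorentzForm (n + 1) x y = lorentzForm (n + 1) y x := by
  rw [lorentzForm_eq, lorentzForm_eq, real_inner_comm]
  ring

/-- The parallel transport from the tangent space at the origin of the hyperboloid. -/
def boost {n : ℕ} (x : EuclideanSpace ℝ (Fin (n + 2))) : Euc n →ₗ[ℝ] EuclideanSpace ℝ (Fin (n + 2)) where
  toFun v := WithLp.toLp 2 (Fin.cons (inner ℝ (spatial x) v)
    fun i => v i + inner ℝ (spatial x) v / (1 + x 0) * spatial x i)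
  map_add' u v := by
    ext i
    refine Fin.cases ?_ (fun i => ?_) i
    · simp [inner_add_right]
    · simp [inner_add_right]; ring
  map_smul' c v := by
    ext i
    refine Fin.cases ?_ (fun i => ?_) i
    · simp [real_inner_smul_right]
    · simp [real_inner_smul_right]; ring

lemma boost_zero {n : ℕ} (x : EuclideanSpace ℝ (Fin (n + 2))) (v : Euc n) :
    boost x v 0 = inner ℝ (spatial x) v := rfl

lemma spatial_boost {n : ℕ} (x : EuclideanSpace ℝ (Fin (n + 2))) (v : Euc n) :
    spatial (boost x v) = v + (inner ℝ (spatial x) v / (1 + x 0)) • spatial x := by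
  ext i
  simp [spatial, boost]

section Boost

variable {n : ℕ} {x : EuclideanSpace ℝ (Fin (n + 2))} (hx : x ∈ (realHyperbolic n).carrier)
include hx

lemma norm_spatial_sq : ‖spatial x‖ ^ 2 = x 0 ^ 2 - 1 := by
  have h := hx.1
  rw [lorentzForm_eq, real_inner_self_eq_norm_sq] at h
  linarith

lemma norm_spatial_lt : ‖spatial x‖ < x 0 :=
  lt_of_pow_lt_pow_left₀ 2 hx.2.le (by rw [norm_spatial_sq hx]; linarith)

lemma form_boost (v w : Euc n) : lorentzForm (n + 1) (boost x v) (boost x w) = inner ℝ v w := by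
  have h1 := norm_spatial_sq hx
  have h2 : 1 + x 0 ≠ 0 := by linarith [hx.2]
  rw [lorentzForm_eq, boost_zero, boost_zero, spatial_boost, spatial_boost]
  simp only [inner_add_left, inner_add_right, real_inner_smul_left, real_inner_smul_right,
    real_inner_self_eq_norm_sq, h1, real_inner_comm (spatial x) v]
  field_simp
  ring

lemma form_boost_right (v : Euc n) : lorentzForm (n + 1) x (boost x v) = 0 := by
  have h1 := norm_spatial_sq hx
  have h2 : 1 + x 0 ≠ 0 := by linarith [hx.2]
  rw [lorentzForm_eq, boost_zero, spatial_boost]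
  simp only [inner_add_right, real_inner_smul_right, real_inner_self_eq_norm_sq, h1]
  field_simp
  ring

lemma exists_boost_eq {y : EuclideanSpace ℝ (Fin (n + 2))} (hy : lorentzForm (n + 1) x y = 0) :
    ∃ v, boost x v = y := by
  have h1 := norm_spatial_sq hx
  have h2 : 1 + x 0 ≠ 0 := by linarith [hx.2]
  rw [lorentzForm_eq] at hy
  have h3 : inner ℝ (spatial x) (spatial y - (y 0 / (1 + x 0)) • spatial x) = y 0 := by
    rw [inner_sub_right, real_inner_smul_right, real_inner_self_eq_norm_sq, h1]
    field_simp
    linear_combination (1 + x 0) * hy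
  refine ⟨spatial y - (y 0 / (1 + x 0)) • spatial x, ?_⟩
  ext i
  refine Fin.cases ?_ (fun i => ?_) i
  · rw [boost_zero, h3]
  · have h4 := congrArg (fun z : Euc n => z i)
      (spatial_boost x (spatial y - (y 0 / (1 + x 0)) • spatial x))
    rw [h3, sub_add_cancel] at h4
    exact h4

/-- Keeps the radial curve on the upper sheet: |sinh s| < cosh s, and |⟨x', w⟩| ≤ |x'| < x₀ for the
spatial part x' of x. -/
lemma boost_upper {w : Euc n} (hw : ‖w‖ = 1) (s : ℝ) :
    0 < Real.cosh s * x 0 + Real.sinh s * boost x w 0 := by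
  have h1 : |inner ℝ (spatial x) w| < x 0 :=
    (abs_real_inner_le_norm _ _).trans_lt (by rw [hw, mul_one]; exact norm_spatial_lt hx)
  have h2 : |Real.sinh s| < Real.cosh s := abs_lt.2
    ⟨by have := Real.cosh_add_sinh s; have := Real.exp_pos s; linarith, Real.sinh_lt_cosh s⟩
  have h3 : |Real.sinh s * inner ℝ (spatial x) w| < Real.cosh s * x 0 := by
    rw [abs_mul]
    exact mul_lt_mul'' h2 h1 (abs_nonneg _) (abs_nonneg _)
  rw [boost_zero]
  linarith [(abs_lt.1 h3).1]

/-- The reversed Cauchy-Schwarz inequality; it makes the distance arcosh(-⟨x, y⟩) meaningful. -/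
lemma one_le_neg_lorentzForm {y : EuclideanSpace ℝ (Fin (n + 2))}
    (hy : y ∈ (realHyperbolic n).carrier) : 1 ≤ -lorentzForm (n + 1) x y := by
  have h2 := real_inner_le_norm (spatial x) (spatial y)
  have hx2 := norm_spatial_sq hx
  have hy2 := norm_spatial_sq hy
  have hx0 : 0 < x 0 := hx.2
  have hy0 : 0 < y 0 := hy.2
  rw [lorentzForm_eq]
  have h4 : (1 + ‖spatial x‖ * ‖spatial y‖) ^ 2 ≤ (x 0 * y 0) ^ 2 := by
    have h5 : (x 0 * y 0) ^ 2 = (1 + ‖spatial x‖ ^ 2) * (1 + ‖spatial y‖ ^ 2) := by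
      rw [hx2, hy2]; ring
    rw [h5]
    nlinarith [sq_nonneg (‖spatial x‖ - ‖spatial y‖)]
  have h6 := abs_le_of_sq_le_sq' h4 (by positivity)
  linarith [h6.2]

end Boost

/-- The geometry of real hyperbolic space. -/
lemma exists_geometry_realHyperbolic (n : ℕ) :
    ∃ G : Geometry (realHyperbolic n) n, G.profile = Profile.hyperbolic := by
  have : FiniteDimensional ℝ (realHyperbolic n).V :=
    inferInstanceAs (FiniteDimensional ℝ (EuclideanSpace ℝ (Fin (n + 2))))
  have hsymm : ∀ x y, (realHyperbolic n).form x y = (realHyperbolic n).form y x := lorentzForm_comm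
  have hcar : ∀ x ∈ (realHyperbolic n).carrier,
      (realHyperbolic n).form x x = Profile.hyperbolic.κ := fun x hx => hx.1
  refine ⟨quadricGeometry (p := Profile.hyperbolic) (Or.inr rfl) hsymm hcar (fun x _ => boost x)
    (fun x hx => form_boost hx) (fun x hx => form_boost_right hx)
    (fun x hx y hy => exists_boost_eq hx hy) (fun x hx w hw s => ?_) (fun x hx y hy => ?_), rfl⟩
  · refine ⟨quadric_form_curve (p := Profile.hyperbolic) (Or.inr rfl) hsymm hcar hx
      (a := boost x w) ((form_boost hx w w).trans (by rw [real_inner_self_eq_norm_sq, hw, one_pow]))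
      (form_boost_right hx w) s, ?_⟩
    refine (boost_upper hx hw s).trans_eq ?_
    change _ = x.ofLp 0 + Real.sinh s * boost x w 0 +
      (Real.cosh s - 1) * -(-1 * x.ofLp 0)
    ring
  · have h3 := one_le_neg_lorentzForm hx hy
    refine ⟨Real.arcosh (-lorentzForm (n + 1) x y), Real.arcosh_nonneg h3,
      Real.sinh_nonneg_iff.2 (Real.arcosh_nonneg h3), ?_⟩
    have h4 := Real.cosh_arcosh h3
    change lorentzForm (n + 1) x y = -1 - (Real.cosh _ - 1)
    linarith

/-! ### Composition algebras -/

/-- The composition algebra laws that `ℂ`, `ℍ` and `𝕆` share. -/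
class Hurwitz (F : Type) [NormedAddCommGroup F] [InnerProductSpace ℝ F] [Mul F] [One F] [Star F] :
    Prop where
  finiteDimensional : FiniteDimensional ℝ F
  add_mul : ∀ a b c : F, (a + b) * c = a * c + b * c
  mul_add : ∀ a b c : F, a * (b + c) = a * b + a * c
  smul_mul : ∀ (r : ℝ) (a b : F), (r • a) * b = r • (a * b)
  mul_smul : ∀ (r : ℝ) (a b : F), a * (r • b) = r • (a * b)
  one_mul : ∀ a : F, 1 * a = a
  mul_one : ∀ a : F, a * 1 = a
  star_mul : ∀ a b : F, star (a * b) = star b * star a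
  inner_star : ∀ a b : F, inner ℝ (star a) (star b) = inner ℝ a b
  inner_mul_left : ∀ a b c : F, inner ℝ (a * b) c = inner ℝ b (star a * c)
  star_mul_mul : ∀ a b : F, star a * (a * b) = ‖a‖ ^ 2 • b
  star_eq : ∀ a : F, star a = (2 * inner ℝ 1 a) • (1 : F) - a
  inner_one : inner ℝ (1 : F) 1 = (1 : ℝ)

namespace Hurwitz

variable {F : Type} [NormedAddCommGroup F] [InnerProductSpace ℝ F] [Mul F] [One F] [Star F]
  [Hurwitz F]

/-- Multiplication as a bilinear map. -/
def mulL : F →ₗ[ℝ] F →ₗ[ℝ] F := LinearMap.mk₂ ℝ (· * ·) add_mul smul_mul mul_add mul_smul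

@[simp] lemma mulL_apply (a b : F) : mulL a b = a * b := rfl

/-- Conjugation as a linear map. -/
def starL : F →ₗ[ℝ] F where
  toFun := star
  map_add' a b := by simp only [star_eq, inner_add_right]; module
  map_smul' r a := by
    simp only [star_eq a, star_eq (r • a), real_inner_smul_right, RingHom.id_apply]; module

@[simp] lemma starL_apply (a : F) : starL a = star a := rfl

lemma star_add (a b : F) : star (a + b) = star a + star b := map_add starL a b
lemma star_smul (r : ℝ) (a : F) : star (r • a) = r • star a := map_smul starL r a
lemma star_zero : star (0 : F) = 0 := map_zero starL
lemma star_sum {ι : Type*} (s : Finset ι) (f : ι → F) :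
    star (∑ i ∈ s, f i) = ∑ i ∈ s, star (f i) := map_sum starL f s
lemma zero_mul (a : F) : 0 * a = 0 := by rw [← mulL_apply, map_zero, LinearMap.zero_apply]
lemma mul_zero (a : F) : a * 0 = 0 := by rw [← mulL_apply, map_zero]
lemma sub_mul (a b c : F) : (a - b) * c = a * c - b * c := by
  rw [← mulL_apply, map_sub, LinearMap.sub_apply, mulL_apply, mulL_apply]
lemma mul_sub (a b c : F) : a * (b - c) = a * b - a * c := by
  rw [← mulL_apply, map_sub, mulL_apply, mulL_apply]
lemma sum_mul {ι : Type*} (s : Finset ι) (f : ι → F) (a : F) :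
    (∑ i ∈ s, f i) * a = ∑ i ∈ s, f i * a := by
  rw [← mulL_apply, map_sum, LinearMap.sum_apply]; rfl
lemma mul_sum {ι : Type*} (s : Finset ι) (f : ι → F) (a : F) :
    a * (∑ i ∈ s, f i) = ∑ i ∈ s, a * f i := by
  rw [← mulL_apply, map_sum]; rfl

lemma star_one : star (1 : F) = 1 := by rw [star_eq, inner_one]; module
lemma star_star (a : F) : star (star a) = a := by
  conv_lhs => rw [star_eq a]
  rw [← starL_apply, map_sub, map_smul, starL_apply, starL_apply, star_one, star_eq a]
  module

lemma inner_mul_right (a b c : F) : inner ℝ (a * b) c = inner ℝ a (c * star b) := by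
  rw [← inner_star, star_mul, inner_mul_left, star_star, ← inner_star, star_star, star_mul, star_star]

lemma norm_star (a : F) : ‖star a‖ = ‖a‖ := by
  rw [norm_eq_sqrt_real_inner, inner_star, ← norm_eq_sqrt_real_inner]

lemma mul_star_mul (a b : F) : a * (star a * b) = ‖a‖ ^ 2 • b := by
  have := star_mul_mul (star a) b
  rwa [star_star, norm_star] at this

lemma mul_mul_star (a b : F) : (b * a) * star a = ‖a‖ ^ 2 • b := by
  have h := congrArg star (mul_star_mul a (star b))
  rwa [star_mul, star_mul, star_star, star_star, star_smul, star_star] at h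

lemma mul_star_mul_self (a b : F) : (b * star a) * a = ‖a‖ ^ 2 • b := by
  have := mul_mul_star (star a) b
  rwa [star_star, norm_star] at this

lemma mul_star_self (a : F) : a * star a = ‖a‖ ^ 2 • (1 : F) := by
  rw [← mul_mul_star a 1, one_mul]

lemma star_mul_self (a : F) : star a * a = ‖a‖ ^ 2 • (1 : F) := by
  rw [← star_mul_mul a 1, mul_one]

lemma inner_mul_mul_left (u a b : F) : inner ℝ (u * a) (u * b) = ‖u‖ ^ 2 * inner ℝ a b := by
  rw [inner_mul_left, star_mul_mul, real_inner_smul_right]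

lemma inner_mul_mul_right (u a b : F) : inner ℝ (a * u) (b * u) = ‖u‖ ^ 2 * inner ℝ a b := by
  rw [inner_mul_right, mul_mul_star, real_inner_smul_right]

lemma norm_mul (a b : F) : ‖a * b‖ = ‖a‖ * ‖b‖ := by
  have h := inner_mul_mul_left a b b
  rw [real_inner_self_eq_norm_sq, real_inner_self_eq_norm_sq, ← mul_pow] at h
  exact (pow_left_inj₀ (norm_nonneg _) (by positivity) two_ne_zero).1 h

lemma norm_one : ‖(1 : F)‖ = 1 := by
  rw [norm_eq_sqrt_real_inner, inner_one, Real.sqrt_one]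

lemma real_mul (r : ℝ) (a : F) : (r • (1 : F)) * a = r • a := by rw [smul_mul, one_mul]
lemma mul_real (r : ℝ) (a : F) : a * (r • (1 : F)) = r • a := by rw [mul_smul, mul_one]

lemma eq_real {a : F} (h : star a = a) : a = (inner ℝ 1 a : ℝ) • (1 : F) := by
  have h1 := star_eq a
  rw [h] at h1
  have h2 : (2 : ℝ) • a = (2 : ℝ) • ((inner ℝ 1 a : ℝ) • (1 : F)) := by
    rw [two_smul]
    nth_rw 2 [h1]
    module
  exact smul_right_injective F two_ne_zero h2

/-- The polarized form of `ā (a b) = |a|² b`. -/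
lemma star_mul_mul_add (a c b : F) :
    star a * (c * b) + star c * (a * b) = (2 * inner ℝ a c) • b := by
  have h := star_mul_mul (a + c) b
  simp only [star_add, add_mul, mul_add, star_mul_mul, norm_add_sq_real] at h
  linear_combination (norm := module) h

lemma inner_polar (x y z w : F) : inner ℝ (x * y) (z * w) + inner ℝ (z * y) (x * w) =
    2 * inner ℝ x z * inner ℝ y w := by
  rw [inner_mul_left, inner_mul_left z, ← inner_add_right, star_mul_mul_add, real_inner_smul_right]

/-- Both sides of the middle Moufang identity. -/
lemma inner_moufang (a x y z : F) : inner ℝ ((a * x) * (y * a)) z =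
    2 * inner ℝ (x * y) (star a) * inner ℝ a z - ‖a‖ ^ 2 * inner ℝ (x * y) (star z) := by
  -- Polarized multiplicativity of the norm, with the third argument chosen so that its product with
  -- a collapses to ‖a‖² x̄.
  have h1 := inner_polar y a (star x * star a) z
  rw [mul_star_mul_self, real_inner_smul_left] at h1
  have h2 : inner ℝ y (star x * star a) = inner ℝ (x * y) (star a) := by
    rw [inner_mul_left x]
  have h3 : inner ℝ (star x) (y * z) = inner ℝ (x * y) (star z) := by
    rw [real_inner_comm, inner_mul_right, inner_mul_left x]
  rw [inner_mul_left, star_mul]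
  rw [h2, h3] at h1
  linarith

/-- By `inner_moufang` the left side depends on x and y only through x y, so the pair (x y, 1) may
be substituted. -/
lemma moufang_middle (a x y : F) : (a * x) * (y * a) = (a * (x * y)) * a := by
  refine ext_inner_right ℝ fun z => ?_
  have h := inner_moufang a (x * y) 1 z
  rw [one_mul, mul_one] at h
  rw [inner_moufang, h]

lemma mul_mul_self (a x : F) : (a * x) * a = (2 * inner ℝ x (star a)) • a - ‖a‖ ^ 2 • star x := by
  refine ext_inner_right ℝ fun z => ?_
  have h := inner_moufang a x 1 z
  rw [one_mul, mul_one] at h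
  rw [h, inner_sub_left, real_inner_smul_left, real_inner_smul_left, ← inner_star (star x),
    star_star]

/-- Both sides equal 2⟨a, r̄⟩ ax - ‖a‖² r̄x: the left one by `mul_mul_self`, the right one by
polarizing ā(ab) = ‖a‖² b. -/
lemma moufang_left (a r x : F) : ((a * r) * a) * x = a * (r * (a * x)) := by
  have h := star_mul_mul_add a (star r) x
  rw [star_star] at h
  have h2 : r * (a * x) = (2 * inner ℝ a (star r)) • x - star a * (star r * x) := by
    rw [← h]; abel
  rw [h2, mul_sub, mul_smul, mul_star_mul, mul_mul_self, sub_mul, smul_mul, smul_mul,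
    ← inner_star a, star_star, real_inner_comm]

lemma moufang_right (a r x : F) : x * (a * (r * a)) = ((x * a) * r) * a := by
  have h := congrArg star (moufang_left (star a) (star r) (star x))
  simpa only [star_mul, star_star] using h

end Hurwitz

open ComplexConjugate in
instance : Hurwitz ℂ where
  finiteDimensional := inferInstance
  add_mul := add_mul
  mul_add := mul_add
  smul_mul := smul_mul_assoc
  mul_smul := fun r a b => mul_smul_comm r a b
  one_mul := one_mul
  mul_one := mul_one
  star_mul := star_mul
  inner_star a b := by simp
  inner_mul_left a b c := by simp [Complex.inner]; ring
  star_mul_mul a b := by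
    rw [← mul_assoc, Complex.star_def, Complex.conj_mul', Complex.real_smul]
    push_cast; rfl
  star_eq a := by
    apply Complex.ext <;> simp [Complex.inner]
    ring
  inner_one := by simp

instance : Hurwitz ℍ[ℝ] where
  finiteDimensional := inferInstance
  add_mul := add_mul
  mul_add := mul_add
  smul_mul := smul_mul_assoc
  mul_smul := fun r a b => mul_smul_comm r a b
  one_mul := one_mul
  mul_one := mul_one
  star_mul := star_mul
  inner_star a b := by simp [Quaternion.inner_def]
  inner_mul_left a b c := by simp [Quaternion.inner_def]; ring
  star_mul_mul a b := by
    rw [← mul_assoc, Quaternion.star_mul_self, Quaternion.normSq_eq_norm_mul_self, ← sq,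
      Quaternion.coe_mul_eq_smul]
  star_eq a := by
    ext <;> simp [Quaternion.inner_def]
    ring
  inner_one := by simp

namespace Octonion

@[ext] lemma ext {x y : Octonion} (h1 : x.left = y.left) (h2 : x.right = y.right) : x = y :=
  WithLp.ofLp_injective 2 (Prod.ext h1 h2)

@[simp] lemma left_mk (a b : ℍ[ℝ]) : (mk a b).left = a := rfl
@[simp] lemma right_mk (a b : ℍ[ℝ]) : (mk a b).right = b := rfl
@[simp] lemma left_add (x y : Octonion) : (x + y).left = x.left + y.left := rfl
@[simp] lemma right_add (x y : Octonion) : (x + y).right = x.right + y.right := rfl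
@[simp] lemma left_sub (x y : Octonion) : (x - y).left = x.left - y.left := rfl
@[simp] lemma right_sub (x y : Octonion) : (x - y).right = x.right - y.right := rfl
@[simp] lemma left_smul (r : ℝ) (x : Octonion) : (r • x).left = r • x.left := rfl
@[simp] lemma right_smul (r : ℝ) (x : Octonion) : (r • x).right = r • x.right := rfl
@[simp] lemma left_mul (x y : Octonion) :
    (x * y).left = x.left * y.left - star y.right * x.right := rfl
@[simp] lemma right_mul (x y : Octonion) :
    (x * y).right = y.right * x.left + x.right * star y.left := rfl
@[simp] lemma left_one : (1 : Octonion).left = 1 := rfl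
@[simp] lemma right_one : (1 : Octonion).right = 0 := rfl
@[simp] lemma left_star (x : Octonion) : (star x).left = star x.left := rfl
@[simp] lemma right_star (x : Octonion) : (star x).right = -x.right := rfl

lemma inner_eq (x y : Octonion) :
    inner ℝ x y = inner ℝ x.left y.left + inner ℝ x.right y.right := rfl

lemma norm_sq (x : Octonion) : ‖x‖ ^ 2 = ‖x.left‖ ^ 2 + ‖x.right‖ ^ 2 := by
  rw [← real_inner_self_eq_norm_sq, inner_eq, real_inner_self_eq_norm_sq,
    real_inner_self_eq_norm_sq]

lemma star_mul_quaternion (a : ℍ[ℝ]) : star a * a = ((‖a‖ ^ 2 : ℝ) : ℍ[ℝ]) := by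
  rw [Quaternion.star_mul_self, Quaternion.normSq_eq_norm_mul_self, sq]

lemma quaternion_mul_star (a : ℍ[ℝ]) : a * star a = ((‖a‖ ^ 2 : ℝ) : ℍ[ℝ]) := by
  rw [Quaternion.self_mul_star, Quaternion.normSq_eq_norm_mul_self, sq]

end Octonion

open Octonion in
instance : Hurwitz Octonion where
  finiteDimensional := inferInstanceAs (FiniteDimensional ℝ (WithLp 2 (ℍ[ℝ] × ℍ[ℝ])))
  add_mul a b c := by ext1 <;> simp [add_mul, mul_add] <;> abel
  mul_add a b c := by ext1 <;> simp [add_mul, mul_add] <;> abel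
  smul_mul r a b := by ext1 <;> simp [smul_sub]
  mul_smul r a b := by ext1 <;> simp [smul_sub]
  one_mul a := by ext1 <;> simp
  mul_one a := by ext1 <;> simp
  star_mul a b := by ext1 <;> simp
  inner_star a b := by
    rw [inner_eq, inner_eq]
    simp [Quaternion.inner_def]
  inner_mul_left a b c := by
    rw [inner_eq, inner_eq]
    simp [Quaternion.inner_def]
    ring
  star_mul_mul a b := by
    have h1 := star_mul_quaternion a.left
    have h2 := quaternion_mul_star a.left
    have h3 := star_mul_quaternion a.right
    have h4 := quaternion_mul_star a.right
    ext1
    · simp only [left_mul, right_mul, left_star, right_star, left_smul, norm_sq, mul_sub,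
        mul_neg, sub_neg_eq_add, star_add, star_mul, star_star, add_mul]
      rw [← mul_assoc, h1, mul_assoc, mul_assoc, h3, Quaternion.coe_mul_eq_smul,
        Quaternion.mul_coe_eq_smul, add_smul]
      abel
    · simp only [left_mul, right_mul, left_star, right_star, right_smul, norm_sq, star_sub,
        star_mul, star_star, add_mul, mul_sub, neg_mul]
      rw [mul_assoc, h2, ← mul_assoc a.right (star a.right), h4, Quaternion.coe_mul_eq_smul,
        Quaternion.mul_coe_eq_smul, add_smul]
      simp only [mul_assoc]
      abel
  star_eq a := by
    ext1
    · ext <;> simp [inner_eq, Quaternion.inner_def]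
      ring
    · simp
  inner_one := by
    rw [inner_eq, left_one, right_one, Quaternion.inner_def, Quaternion.inner_def]
    simp

/-! ### Hermitian matrices over a composition algebra -/

/-- Square matrices over `F`. -/
abbrev Mat (F : Type) (m : ℕ) : Type := Fin (m + 1) → Fin (m + 1) → F

lemma signature_zero {m : ℕ} : signature (0 : Fin (m + 1)) = -1 := rfl

lemma signature_succ {m : ℕ} (i : Fin m) : signature i.succ = 1 := by
  simp [signature, Fin.succ_ne_zero]

section Matrices

open Hurwitz

variable {F : Type} [NormedAddCommGroup F] [InnerProductSpace ℝ F] [Mul F] [One F] [Star F]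
  [Hurwitz F] {m : ℕ}

/-- The product `(X, Y) ↦ X J Y` with `J = diag (-1, 1, …, 1)`. -/
def conv : Mat F m →ₗ[ℝ] Mat F m →ₗ[ℝ] Mat F m :=
  LinearMap.mk₂ ℝ (fun X Y i j => ∑ k, signature k • (X i k * Y k j))
    (fun X Y Z => by ext i j; simp [Hurwitz.add_mul, Finset.sum_add_distrib])
    (fun c X Y => by
      ext i j
      simp only [Pi.smul_apply, Hurwitz.smul_mul, Finset.smul_sum]
      exact Finset.sum_congr rfl fun k _ => smul_comm _ _ _)
    (fun X Y Z => by ext i j; simp [Hurwitz.mul_add, Finset.sum_add_distrib])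
    (fun c X Y => by
      ext i j
      simp only [Pi.smul_apply, Hurwitz.mul_smul, Finset.smul_sum]
      exact Finset.sum_congr rfl fun k _ => smul_comm _ _ _)

lemma conv_apply (X Y : Mat F m) (i j : Fin (m + 1)) :
    conv X Y i j = ∑ k, signature k • (X i k * Y k j) := rfl

lemma conv_eq (X Y : Mat F m) (i j : Fin (m + 1)) :
    conv X Y i j = -(X i 0 * Y 0 j) + ∑ k : Fin m, X i k.succ * Y k.succ j := by
  rw [conv_apply, Fin.sum_univ_succ]
  simp only [signature_zero, signature_succ, one_smul, neg_smul]

/-- Hermitian matrices. -/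
def Herm (X : Mat F m) : Prop := ∀ i j, star (X i j) = X j i

lemma Herm.diag {X : Mat F m} (h : Herm X) (i : Fin (m + 1)) :
    X i i = (inner ℝ 1 (X i i) : ℝ) • (1 : F) := eq_real (h i i)

lemma Herm.add {X Y : Mat F m} (hX : Herm X) (hY : Herm Y) : Herm (X + Y) := fun i j => by
  simp only [Pi.add_apply, Hurwitz.star_add, hX i j, hY i j]

omit [Mul F] [One F] [Star F] [Hurwitz F] in
lemma hermitianForm_apply (X Y : Mat F m) : hermitianForm F m X Y =
    -2 * ∑ i, ∑ j, signature i * signature j * inner ℝ (X i j) (Y i j) := rfl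

omit [Mul F] [One F] [Star F] [Hurwitz F] in
lemma hermitianForm_comm (X Y : Mat F m) : hermitianForm F m X Y = hermitianForm F m Y X := by
  simp only [hermitianForm, LinearMap.mk₂_apply, real_inner_comm]

/-- The points of the hyperbolic space of `F`. -/
structure IsPoint (X : Mat F m) : Prop where
  herm : Herm X
  conv_self : conv X X = -X
  trace : ∑ k, signature k • X k k = -1
  pos : 0 < inner ℝ (1 : F) (X 0 0)

omit [Hurwitz F] in
lemma mem_carrier_iff [Hurwitz F] (X : Mat F m) : X ∈ (hyperbolic F m).carrier ↔ IsPoint X :=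
  ⟨fun ⟨h1, h2, h3, h4⟩ => ⟨h1, funext fun i => funext fun j => h2 i j, h3, h4⟩,
    fun ⟨h1, h2, h3, h4⟩ => ⟨h1, fun i j => congrFun (congrFun h2 i) j, h3, h4⟩⟩

namespace IsPoint

variable {X : Mat F m} (hX : IsPoint X)
include hX

/-- This is the real part of the (0, 0) entry of X J X = -X. -/
lemma norm_sum : ∑ i : Fin m, ‖X i.succ 0‖ ^ 2 =
    inner ℝ (1 : F) (X 0 0) ^ 2 - inner ℝ (1 : F) (X 0 0) := by
  have h := congrArg (fun z => inner ℝ (1 : F) z) (congrFun (congrFun hX.conv_self 0) 0)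
  simp only [conv_eq, Pi.neg_apply, inner_add_right, inner_neg_right, inner_sum] at h
  have h1 : ∀ k : Fin m, inner ℝ (1 : F) (X 0 k.succ * X k.succ 0) = ‖X k.succ 0‖ ^ 2 := fun k => by
    rw [← hX.herm k.succ 0, star_mul_self, real_inner_smul_right, inner_one, _root_.mul_one]
  have h2 : inner ℝ (1 : F) (X 0 0 * X 0 0) = inner ℝ (1 : F) (X 0 0) ^ 2 := by
    conv_lhs => rw [hX.herm.diag 0, real_mul, real_inner_smul_right, real_inner_smul_right, inner_one]
    ring
  simp only [h1, h2] at h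
  linarith

lemma one_le : 1 ≤ inner ℝ (1 : F) (X 0 0) := by
  have h := hX.norm_sum
  have h1 : 0 ≤ ∑ i : Fin m, ‖X i.succ 0‖ ^ 2 := Finset.sum_nonneg fun i _ => sq_nonneg _
  have h2 := hX.pos
  rw [h] at h1
  nlinarith

lemma norm_lt (i : Fin m) : ‖X i.succ 0‖ < inner ℝ (1 : F) (X 0 0) := by
  have h := hX.norm_sum
  have h1 : ‖X i.succ 0‖ ^ 2 ≤ ∑ i : Fin m, ‖X i.succ 0‖ ^ 2 :=
    Finset.single_le_sum (fun i _ => sq_nonneg ‖X i.succ 0‖) (Finset.mem_univ i)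
  exact lt_of_pow_lt_pow_left₀ 2 hX.pos.le (by linarith [hX.pos])

/-- After expansion every term is determined by the entries (i, 0), (i, i) and (0, 0) of X J X = -X
and by the trace, and the total cancels. Only adjointness of multiplication and multiplicativity of
the norm enter, not associativity. -/
lemma rank_one_aux : ∑ i : Fin m, ∑ j : Fin m, ‖inner ℝ (1 : F) (X 0 0) • X i.succ j.succ -
    X i.succ 0 * X 0 j.succ‖ ^ 2 = 0 := by
  set a : ℝ := inner ℝ (1 : F) (X 0 0) with ha
  have h00 : X 0 0 = a • (1 : F) := hX.herm.diag 0
  have hτ := hX.norm_sum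
  rw [← ha] at hτ
  have h0 : ∀ i : Fin m, ‖X 0 i.succ‖ = ‖X i.succ 0‖ := fun i => by
    rw [← hX.herm, Hurwitz.norm_star]
  have hi0 : ∀ i : Fin m, ∑ k : Fin m, X i.succ k.succ * X k.succ 0 = (a - 1) • X i.succ 0 :=
    fun i => by
      have h := congrFun (congrFun hX.conv_self i.succ) 0
      rw [conv_eq, h00, mul_real, Pi.neg_apply, Pi.neg_apply] at h
      linear_combination (norm := module) h
  have hii : ∀ i : Fin m, ∑ k : Fin m, ‖X i.succ k.succ‖ ^ 2 =
      ‖X i.succ 0‖ ^ 2 - inner ℝ (1 : F) (X i.succ i.succ) := fun i => by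
    have h := congrArg (fun z => inner ℝ (1 : F) z) (congrFun (congrFun hX.conv_self i.succ) i.succ)
    simp only [conv_eq, Pi.neg_apply, inner_add_right, inner_neg_right, inner_sum] at h
    have h1 : ∀ k, inner ℝ (1 : F) (X i.succ k * X k i.succ) = ‖X i.succ k‖ ^ 2 := fun k => by
      rw [← hX.herm i.succ k, mul_star_self, real_inner_smul_right, inner_one, _root_.mul_one]
    simp only [h1] at h
    linarith
  have htr : ∑ i : Fin m, inner ℝ (1 : F) (X i.succ i.succ) = a - 1 := by
    have h := congrArg (fun z => inner ℝ (1 : F) z) hX.trace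
    simp only [Fin.sum_univ_succ, signature_zero, signature_succ, one_smul, neg_smul,
      inner_add_right, inner_neg_right, inner_sum, inner_one] at h
    linarith
  have hmix : ∀ i j : Fin m, inner ℝ (X i.succ j.succ) (X i.succ 0 * X 0 j.succ) =
      inner ℝ (X i.succ j.succ * X j.succ 0) (X i.succ 0) := fun i j => by
    rw [Hurwitz.inner_mul_right, hX.herm]
  have hrow : ∀ i : Fin m, ∑ j : Fin m, ‖a • X i.succ j.succ - X i.succ 0 * X 0 j.succ‖ ^ 2 =
      a ^ 2 * (‖X i.succ 0‖ ^ 2 - inner ℝ (1 : F) (X i.succ i.succ)) -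
        2 * a * (a - 1) * ‖X i.succ 0‖ ^ 2 + ‖X i.succ 0‖ ^ 2 * (a ^ 2 - a) := fun i => by
    have h1 : ∑ j : Fin m, inner ℝ (X i.succ j.succ * X j.succ 0) (X i.succ 0) =
        (a - 1) * ‖X i.succ 0‖ ^ 2 := by
      rw [← sum_inner, hi0, real_inner_smul_left, real_inner_self_eq_norm_sq]
    rw [← hii i, ← hτ, _root_.mul_assoc (2 * a), ← h1, Finset.mul_sum, Finset.mul_sum, Finset.mul_sum,
      ← Finset.sum_sub_distrib, ← Finset.sum_add_distrib]
    refine Finset.sum_congr rfl fun j _ => ?_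
    rw [norm_sub_sq_real, real_inner_smul_left, hmix, norm_smul, Hurwitz.norm_mul, h0, mul_pow,
      mul_pow, Real.norm_eq_abs, sq_abs]
    ring
  simp only [hrow, Finset.sum_add_distrib, Finset.sum_sub_distrib, ← Finset.mul_sum,
    ← Finset.sum_mul, htr, hτ]
  ring

/-- Points are matrices of rank one. -/
lemma rank_one (i j : Fin (m + 1)) : inner ℝ (1 : F) (X 0 0) • X i j = X i 0 * X 0 j := by
  have h00 : X 0 0 = (inner ℝ (1 : F) (X 0 0) : ℝ) • (1 : F) := hX.herm.diag 0
  refine Fin.cases ?_ (fun i => ?_) i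
  · conv_rhs => rw [h00, real_mul]
  refine Fin.cases ?_ (fun j => ?_) j
  · conv_rhs => rw [h00, mul_real]
  have h := hX.rank_one_aux
  rw [Finset.sum_eq_zero_iff_of_nonneg fun i _ => Finset.sum_nonneg fun j _ => sq_nonneg _] at h
  have h1 := h i (Finset.mem_univ i)
  rw [Finset.sum_eq_zero_iff_of_nonneg fun j _ => sq_nonneg _] at h1
  have h2 := h1 j (Finset.mem_univ j)
  exact sub_eq_zero.1 (norm_eq_zero.1 (pow_eq_zero_iff two_ne_zero |>.1 h2))

end IsPoint

/-! ### Symmetries -/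

/-- Linear isometries of the hyperbolic space that respect the Jordan algebra structure. -/
structure IsSymmetry (g : Mat F m →ₗ[ℝ] Mat F m) : Prop where
  form : ∀ X Y, hermitianForm F m (g X) (g Y) = hermitianForm F m X Y
  herm : ∀ X, Herm X → Herm (g X)
  conv_self : ∀ X, Herm X → conv (g X) (g X) = g (conv X X)
  point : ∀ X, IsPoint X → IsPoint (g X)

lemma IsSymmetry.comp {g h : Mat F m →ₗ[ℝ] Mat F m} (hg : IsSymmetry g) (hh : IsSymmetry h) :
    IsSymmetry (g ∘ₗ h) where
  form _ _ := (hg.form _ _).trans (hh.form _ _)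
  herm _ hX := hg.herm _ (hh.herm _ hX)
  conv_self X hX := (hg.conv_self _ (hh.herm _ hX)).trans (congrArg g (hh.conv_self X hX))
  point _ hX := hg.point _ (hh.point _ hX)

/-- Linearization of squaring: a symmetry respects the Jordan product, though not necessarily the
matrix product. -/
lemma IsSymmetry.conv_add {g : Mat F m →ₗ[ℝ] Mat F m} (hg : IsSymmetry g) {X Y : Mat F m}
    (hX : Herm X) (hY : Herm Y) : conv (g X) (g Y) + conv (g Y) (g X) =
      g (conv X Y + conv Y X) := by
  have h := hg.conv_self (X + Y) (hX.add hY)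
  simp only [map_add, LinearMap.add_apply, hg.conv_self X hX, hg.conv_self Y hY] at h ⊢
  linear_combination (norm := module) h

/-- Entrywise symmetries. -/
structure IsTwist (T : Fin (m + 1) → Fin (m + 1) → F →ₗ[ℝ] F) : Prop where
  inner_map : ∀ i j x y, inner ℝ (T i j x) (T i j y) = inner ℝ x y
  star_map : ∀ i j x, star (T i j x) = T j i (star x)
  map_one : ∀ i, T i i 1 = 1
  mul_map : ∀ i k j x y, i ≠ k → k ≠ j → i ≠ j → T i k x * T k j y = T i j (x * y)

/-- The linear map acting entrywise. -/
def entrywise (T : Fin (m + 1) → Fin (m + 1) → F →ₗ[ℝ] F) : Mat F m →ₗ[ℝ] Mat F m where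
  toFun X i j := T i j (X i j)
  map_add' X Y := by ext i j; exact map_add _ _ _
  map_smul' c X := by ext i j; exact map_smul _ _ _

/-- In the square of a Hermitian matrix a product with a repeated index involves a real diagonal
entry or has the form x x̄. So multiplicativity of the twists matters for three distinct indices
only. -/
lemma IsTwist.isSymmetry {T : Fin (m + 1) → Fin (m + 1) → F →ₗ[ℝ] F} (hT : IsTwist T) :
    IsSymmetry (entrywise T) := by
  have hdiag : ∀ X : Mat F m, Herm X → ∀ i, T i i (X i i) = X i i := fun X hX i => by
    rw [hX.diag i, map_smul, hT.map_one]
  have hherm : ∀ X : Mat F m, Herm X → Herm (entrywise T X) := fun X hX i j => by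
    change star (T i j (X i j)) = T j i (X j i)
    rw [hT.star_map, hX]
  have hnorm : ∀ i j x, ‖T i j x‖ = ‖x‖ := fun i j x => by
    rw [norm_eq_sqrt_real_inner, hT.inner_map, ← norm_eq_sqrt_real_inner]
  have hconv : ∀ X : Mat F m, Herm X → conv (entrywise T X) (entrywise T X) =
      entrywise T (conv X X) := fun X hX => by
    ext i j
    change ∑ k, signature k • (T i k (X i k) * T k j (X k j)) =
      T i j (∑ k, signature k • (X i k * X k j))
    rw [map_sum]
    refine Finset.sum_congr rfl fun k _ => ?_
    rw [map_smul]
    congr 1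
    by_cases h1 : i = k
    · subst h1
      rw [hdiag X hX, hX.diag i, real_mul, real_mul, map_smul]
    by_cases h2 : k = j
    · subst h2
      rw [hdiag X hX, hX.diag k, mul_real, mul_real, map_smul]
    by_cases h3 : i = j
    · subst h3
      rw [← hX i k, ← hT.star_map, mul_star_self, mul_star_self, map_smul, hT.map_one, hnorm]
    · exact hT.mul_map i k j _ _ h1 h2 h3
  refine ⟨fun X Y => ?_, hherm, hconv, fun X hX => ⟨hherm X hX.herm, ?_, ?_, ?_⟩⟩
  · rw [hermitianForm_apply, hermitianForm_apply]
    simp only [entrywise, LinearMap.coe_mk, AddHom.coe_mk, hT.inner_map]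
  · rw [hconv X hX.herm, hX.conv_self, map_neg]
  · rw [← hX.trace]
    exact Finset.sum_congr rfl fun k _ => congrArg _ (hdiag X hX.herm k)
  · have : entrywise T X 0 0 = X 0 0 := hdiag X hX.herm 0
    rw [this]
    exact hX.pos

/-! ### Real reflections -/

/-- The Lorentzian product of a real vector with a vector. -/
def pair (u : Fin (m + 1) → ℝ) (Z : Fin (m + 1) → F) : F := ∑ k, (signature k * u k) • Z k

/-- The action of the reflection in `u` on rows. -/
def reflectRow (u : Fin (m + 1) → ℝ) : Mat F m →ₗ[ℝ] Mat F m where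
  toFun X i j := X i j + (2 * u i) • pair u fun k => X k j
  map_add' X Y := by
    ext i j
    simp only [pair, Pi.add_apply, smul_add, Finset.sum_add_distrib]
    abel
  map_smul' c X := by
    ext i j
    simp only [pair, Pi.smul_apply, smul_add, RingHom.id_apply, Finset.smul_sum]
    congr 1
    exact Finset.sum_congr rfl fun k _ => by module

/-- The action of the reflection in `u` on columns. -/
def reflectCol (u : Fin (m + 1) → ℝ) : Mat F m →ₗ[ℝ] Mat F m where
  toFun X i j := X i j + (2 * u j) • pair u (X i)
  map_add' X Y := by
    ext i j
    simp only [pair, Pi.add_apply, smul_add, Finset.sum_add_distrib]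
    abel
  map_smul' c X := by
    ext i j
    simp only [pair, Pi.smul_apply, smul_add, RingHom.id_apply, Finset.smul_sum]
    congr 1
    exact Finset.sum_congr rfl fun k _ => by module

omit [Mul F] [One F] [Star F] [Hurwitz F] in
lemma reflectRow_apply (u : Fin (m + 1) → ℝ) (X : Mat F m) (i j : Fin (m + 1)) :
    reflectRow u X i j = X i j + (2 * u i) • pair u fun k => X k j := rfl

omit [Mul F] [One F] [Star F] [Hurwitz F] in
lemma reflectCol_apply (u : Fin (m + 1) → ℝ) (X : Mat F m) (i j : Fin (m + 1)) :
    reflectCol u X i j = X i j + (2 * u j) • pair u (X i) := rfl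

omit [Mul F] [One F] [Star F] [Hurwitz F] in
lemma pair_add (u : Fin (m + 1) → ℝ) (Z Z' : Fin (m + 1) → F) :
    pair u (fun k => Z k + Z' k) = pair u Z + pair u Z' := by
  simp only [pair, smul_add, Finset.sum_add_distrib]

omit [Mul F] [One F] [Star F] [Hurwitz F] in
lemma pair_smul_right (u : Fin (m + 1) → ℝ) (c : ℝ) (Z : Fin (m + 1) → F) :
    pair u (fun k => c • Z k) = c • pair u Z := by
  simp only [pair, Finset.smul_sum]
  exact Finset.sum_congr rfl fun k _ => by module

omit [Mul F] [One F] [Star F] [Hurwitz F] in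
lemma pair_pair (u : Fin (m + 1) → ℝ) (X : Mat F m) :
    (pair u fun k => pair u fun l => X k l) = pair u fun l => pair u fun k => X k l := by
  simp only [pair, Finset.smul_sum]
  rw [Finset.sum_comm]
  exact Finset.sum_congr rfl fun k _ => Finset.sum_congr rfl fun l _ => by module

lemma star_pair (u : Fin (m + 1) → ℝ) (Z : Fin (m + 1) → F) :
    star (pair u Z) = pair u fun k => star (Z k) := by
  simp only [pair, Hurwitz.star_sum, Hurwitz.star_smul]

lemma pair_mul (u : Fin (m + 1) → ℝ) (Z : Fin (m + 1) → F) (x : F) :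
    pair u Z * x = pair u fun k => Z k * x := by
  simp only [pair, Hurwitz.sum_mul, Hurwitz.smul_mul]

lemma mul_pair (u : Fin (m + 1) → ℝ) (Z : Fin (m + 1) → F) (x : F) :
    x * pair u Z = pair u fun k => x * Z k := by
  simp only [pair, Hurwitz.mul_sum, Hurwitz.mul_smul]

omit [Mul F] [One F] [Star F] [Hurwitz F] in
lemma inner_pair (u : Fin (m + 1) → ℝ) (Z : Fin (m + 1) → F) (x : F) :
    inner ℝ x (pair u Z) = ∑ k, signature k * u k * inner ℝ x (Z k) := by
  simp only [pair, inner_sum, real_inner_smul_right]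

section Reflection

variable {u : Fin (m + 1) → ℝ} (hu : ∑ k, signature k * u k * u k = -1)
include hu

omit [Mul F] [One F] [Star F] [Hurwitz F] in
lemma pair_smul_left (x : F) : (pair u fun k => (2 * u k) • x) = (-2 : ℝ) • x := by
  have h : ∀ k, (signature k * u k) • ((2 * u k) • x) = (2 * (signature k * u k * u k)) • x :=
    fun k => by module
  simp only [pair, h]
  rw [← Finset.sum_smul, ← Finset.mul_sum, hu]
  norm_num

omit [Mul F] [One F] [Star F] [Hurwitz F] in
lemma pair_reflectRow (X : Mat F m) (j : Fin (m + 1)) :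
    (pair u fun k => reflectRow u X k j) = -pair u fun k => X k j := by
  simp only [reflectRow_apply]
  rw [pair_add, pair_smul_left hu]
  module

omit [Mul F] [One F] [Star F] [Hurwitz F] in
lemma pair_reflectCol (X : Mat F m) (i : Fin (m + 1)) :
    pair u (reflectCol u X i) = -pair u (X i) := by
  have : reflectCol u X i = fun j => X i j + (2 * u j) • pair u (X i) := rfl
  rw [this, pair_add, pair_smul_left hu]
  module

omit [Mul F] [One F] [Star F] [Hurwitz F] in
lemma reflectRow_reflectRow (X : Mat F m) : reflectRow u (reflectRow u X) = X := by
  ext i j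
  rw [reflectRow_apply, pair_reflectRow hu, reflectRow_apply]
  module

omit [Mul F] [One F] [Star F] [Hurwitz F] in
lemma reflectCol_reflectCol (X : Mat F m) : reflectCol u (reflectCol u X) = X := by
  ext i j
  rw [reflectCol_apply, pair_reflectCol hu, reflectCol_apply]
  module

omit [Mul F] [One F] [Star F] [Hurwitz F] hu in
lemma reflectRow_reflectCol (X : Mat F m) :
    reflectRow u (reflectCol u X) = reflectCol u (reflectRow u X) := by
  ext i j
  have h1 : (pair u fun k => reflectCol u X k j) =
      (pair u fun k => X k j) + (2 * u j) • pair u fun k => pair u (X k) := by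
    simp only [reflectCol_apply]
    rw [pair_add, pair_smul_right]
  have h2 : pair u (reflectRow u X i) =
      pair u (X i) + (2 * u i) • pair u fun l => pair u fun k => X k l := by
    have : reflectRow u X i = fun j => X i j + (2 * u i) • pair u fun k => X k j := rfl
    rw [this, pair_add, pair_smul_right]
  rw [reflectRow_apply, reflectCol_apply, h1, reflectCol_apply u (reflectRow u X), h2,
    reflectRow_apply, ← pair_pair]
  module

/-- The reflection in u preserves the Lorentzian form, and its real entries pass through the
possibly nonassociative products. -/
lemma conv_reflect (X Y : Mat F m) : conv (reflectCol u X) (reflectRow u Y) = conv X Y := by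
  ext i j
  have h1 : ∀ k, signature k • (reflectCol u X i k * reflectRow u Y k j) =
      signature k • (X i k * Y k j) + (2 : ℝ) • ((signature k * u k) • (pair u (X i) * Y k j)) +
      (2 : ℝ) • ((signature k * u k) • (X i k * pair u fun k => Y k j)) +
      (4 * (signature k * u k * u k)) • (pair u (X i) * pair u fun k => Y k j) := fun k => by
    rw [reflectCol_apply, reflectRow_apply]
    simp only [Hurwitz.add_mul, Hurwitz.mul_add, Hurwitz.smul_mul, Hurwitz.mul_smul]
    module
  rw [conv_apply, Finset.sum_congr rfl fun k _ => h1 k]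
  simp only [Finset.sum_add_distrib, ← Finset.smul_sum, ← Finset.sum_smul, ← Finset.mul_sum, hu]
  have h2 : ∑ k, (signature k * u k) • (pair u (X i) * Y k j) =
      pair u (X i) * pair u fun k => Y k j := by rw [mul_pair]; rfl
  have h3 : ∑ k, (signature k * u k) • (X i k * pair u fun k => Y k j) =
      pair u (X i) * pair u fun k => Y k j := by rw [pair_mul]; rfl
  rw [h2, h3, conv_apply]
  module

omit hu in
lemma conv_reflectRow (X Y : Mat F m) : conv (reflectRow u X) Y = reflectRow u (conv X Y) := by
  ext i j
  have h : (pair u fun k => conv X Y k j) =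
      ∑ l, signature l • ((pair u fun k => X k l) * Y l j) := by
    simp only [conv_apply, pair, Finset.smul_sum, Hurwitz.sum_mul, Hurwitz.smul_mul]
    rw [Finset.sum_comm]
    exact Finset.sum_congr rfl fun k _ => Finset.sum_congr rfl fun l _ => smul_comm _ _ _
  rw [reflectRow_apply, h, conv_apply, conv_apply, Finset.smul_sum, ← Finset.sum_add_distrib]
  refine Finset.sum_congr rfl fun k _ => ?_
  rw [reflectRow_apply, Hurwitz.add_mul, Hurwitz.smul_mul]
  module

omit hu in
lemma conv_reflectCol (X Y : Mat F m) : conv X (reflectCol u Y) = reflectCol u (conv X Y) := by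
  ext i j
  have h : pair u (conv X Y i) = ∑ l, signature l • (X i l * pair u (Y l)) := by
    simp only [conv_apply, pair, Finset.smul_sum, Hurwitz.mul_sum, Hurwitz.mul_smul]
    rw [Finset.sum_comm]
    exact Finset.sum_congr rfl fun k _ => Finset.sum_congr rfl fun l _ => smul_comm _ _ _
  rw [reflectCol_apply, h, conv_apply, conv_apply, Finset.smul_sum, ← Finset.sum_add_distrib]
  refine Finset.sum_congr rfl fun k _ => ?_
  rw [reflectCol_apply, Hurwitz.mul_add, Hurwitz.mul_smul]
  module

omit [Mul F] [One F] [Star F] [Hurwitz F] in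
lemma sum_inner_reflect (Z Z' : Fin (m + 1) → F) :
    ∑ i, signature i * inner ℝ (Z i + (2 * u i) • pair u Z) (Z' i + (2 * u i) • pair u Z') =
      ∑ i, signature i * inner ℝ (Z i) (Z' i) := by
  have h1 : ∀ i, signature i * inner ℝ (Z i + (2 * u i) • pair u Z) (Z' i + (2 * u i) • pair u Z') =
      signature i * inner ℝ (Z i) (Z' i) + 2 * (signature i * u i * inner ℝ (pair u Z) (Z' i)) +
      2 * (signature i * u i * inner ℝ (pair u Z') (Z i)) +
      4 * (signature i * u i * u i) * inner ℝ (pair u Z) (pair u Z') := fun i => by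
    simp only [inner_add_left, inner_add_right, real_inner_smul_left, real_inner_smul_right,
      real_inner_comm (pair u Z') (Z i)]
    ring
  simp only [h1, Finset.sum_add_distrib, ← Finset.mul_sum, ← Finset.sum_mul, hu, ← inner_pair,
    real_inner_comm (pair u Z) (pair u Z')]
  ring

omit [Mul F] [One F] [Star F] [Hurwitz F] in
lemma form_reflectRow (X Y : Mat F m) : hermitianForm F m (reflectRow u X) (reflectRow u Y) =
    hermitianForm F m X Y := by
  have h : ∀ X Y : Mat F m, hermitianForm F m X Y =
      -2 * ∑ j, signature j * ∑ i, signature i * inner ℝ (X i j) (Y i j) := fun X Y => by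
    simp only [hermitianForm, LinearMap.mk₂_apply, Finset.mul_sum]
    rw [Finset.sum_comm]
    exact Finset.sum_congr rfl fun k _ => Finset.sum_congr rfl fun l _ => by ring
  rw [h, h]
  congr 1
  refine Finset.sum_congr rfl fun j _ => ?_
  congr 1
  exact sum_inner_reflect hu (fun i => X i j) fun i => Y i j

omit [Mul F] [One F] [Star F] [Hurwitz F] in
lemma form_reflectCol (X Y : Mat F m) : hermitianForm F m (reflectCol u X) (reflectCol u Y) =
    hermitianForm F m X Y := by
  have h : ∀ X Y : Mat F m, hermitianForm F m X Y =
      -2 * ∑ i, signature i * ∑ j, signature j * inner ℝ (X i j) (Y i j) := fun X Y => by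
    simp only [hermitianForm, LinearMap.mk₂_apply, Finset.mul_sum]
    exact Finset.sum_congr rfl fun k _ => Finset.sum_congr rfl fun l _ => by ring
  rw [h, h]
  congr 1
  refine Finset.sum_congr rfl fun i _ => ?_
  congr 1
  exact sum_inner_reflect hu (X i) (Y i)

/-- The action of the reflection in `u` on matrices. -/
def reflect (u : Fin (m + 1) → ℝ) : Mat F m →ₗ[ℝ] Mat F m := reflectRow u ∘ₗ reflectCol u

omit [Mul F] [One F] [Star F] [Hurwitz F] in
lemma reflect_reflect (X : Mat F m) : reflect u (reflect u X) = X := by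
  change reflectRow u (reflectCol u (reflectRow u (reflectCol u X))) = X
  rw [reflectRow_reflectCol, reflectRow_reflectRow hu, reflectCol_reflectCol hu]

omit hu in
lemma herm_reflect {X : Mat F m} (hX : Herm X) : Herm (reflect u X) := fun i j => by
  have h1 : reflect u X j i = reflectCol u (reflectRow u X) j i := by
    rw [← reflectRow_reflectCol]; rfl
  rw [h1]
  change star (reflectCol u X i j + (2 * u i) • pair u fun k => reflectCol u X k j) =
    reflectRow u X j i + (2 * u i) • pair u (reflectRow u X j)
  have h2 : ∀ i j, star (reflectCol u X i j) = reflectRow u X j i := fun i j => by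
    simp only [reflectCol_apply, reflectRow_apply, Hurwitz.star_add, Hurwitz.star_smul, star_pair,
      hX i]
  rw [Hurwitz.star_add, Hurwitz.star_smul, star_pair, h2]
  simp only [h2]

lemma conv_reflect_self (X : Mat F m) : conv (reflect u X) (reflect u X) = reflect u (conv X X) := by
  have h : reflect u X = reflectCol u (reflectRow u X) := (reflectRow_reflectCol X)
  calc conv (reflect u X) (reflect u X)
      = conv (reflectRow u (reflectCol u X)) (reflectCol u (reflectRow u X)) := by rw [← h]; rfl
    _ = _ := by rw [conv_reflectRow, conv_reflectCol, conv_reflect hu]; rfl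

omit [Mul F] [One F] [Star F] [Hurwitz F] in
lemma trace_reflect (X : Mat F m) :
    ∑ k, signature k • reflect u X k k = ∑ k, signature k • X k k := by
  have h1 : ∀ Y : Mat F m, ∑ k, signature k • reflectRow u Y k k =
      ∑ k, signature k • Y k k + (2 : ℝ) • pair u fun l => pair u fun k => Y k l := fun Y => by
    have : ∀ k, signature k • reflectRow u Y k k = signature k • Y k k +
        (2 : ℝ) • ((signature k * u k) • pair u fun l => Y l k) := fun k => by
      rw [reflectRow_apply]; module
    simp only [this, Finset.sum_add_distrib, ← Finset.smul_sum]
    rfl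
  have h2 : ∑ k, signature k • reflectCol u X k k =
      ∑ k, signature k • X k k + (2 : ℝ) • pair u fun k => pair u fun l => X k l := by
    have : ∀ k, signature k • reflectCol u X k k = signature k • X k k +
        (2 : ℝ) • ((signature k * u k) • pair u fun l => X k l) := fun k => by
      rw [reflectCol_apply]; module
    simp only [this, Finset.sum_add_distrib, ← Finset.smul_sum]
    rfl
  have h3 : (pair u fun l => pair u fun k => reflectCol u X k l) =
      -pair u fun k => pair u fun l => X k l := by
    rw [← pair_pair]
    have : ∀ k, (pair u fun l => reflectCol u X k l) = -pair u fun l => X k l := fun k =>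
      pair_reflectCol hu X k
    simp only [this]
    have := pair_smul_right u (-1) fun k => pair u fun l => X k l
    simpa only [neg_smul, one_smul] using this
  change ∑ k, signature k • reflectRow u (reflectCol u X) k k = _
  rw [h1, h2, h3]
  module

omit hu in
/-- Reflections of matrices of rank one. -/
lemma reflect_rank_one {X : Mat F m} (hX : IsPoint X) (i j : Fin (m + 1)) :
    inner ℝ (1 : F) (X 0 0) • reflect u X i j = reflectRow u X i 0 * star (reflectRow u X j 0) := by
  have h1 : ∀ i j, inner ℝ (1 : F) (X 0 0) • reflectRow u X i j = reflectRow u X i 0 * X 0 j :=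
    fun i j => by
      rw [reflectRow_apply, reflectRow_apply, Hurwitz.add_mul, Hurwitz.smul_mul, pair_mul, smul_add,
        hX.rank_one, smul_comm, ← pair_smul_right]
      simp only [hX.rank_one]
  have h2 : star (reflectRow u X j 0) = X 0 j + (2 * u j) • pair u fun k => X 0 k := by
    simp only [reflectRow_apply, Hurwitz.star_add, Hurwitz.star_smul, star_pair, hX.herm _ 0]
  have h3 : reflect u X i j = reflectRow u X i j + (2 * u j) • pair u (reflectRow u X i) := by
    change reflectRow u (reflectCol u X) i j = _
    rw [reflectRow_reflectCol]; rfl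
  rw [h2, h3, Hurwitz.mul_add, Hurwitz.mul_smul, mul_pair, smul_add, h1, smul_comm,
    ← pair_smul_right]
  simp only [h1]

end Reflection

end Matrices

/-! ### Homogeneity of the hyperbolic spaces -/

section Homogeneity

open Hurwitz

variable {F : Type} [NormedAddCommGroup F] [InnerProductSpace ℝ F] [Mul F] [One F] [Star F]
  [Hurwitz F] {m : ℕ}

/-- The vector `(c, 0, …, s, …, 0)`. -/
def boostVector (p : Fin m) (c s : ℝ) : Fin (m + 1) → ℝ := Fin.cons c (Pi.single p s)

omit [Mul F] [One F] [Star F] [Hurwitz F] in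
lemma pair_boostVector (p : Fin m) (c s : ℝ) (Z : Fin (m + 1) → F) :
    pair (boostVector p c s) Z = s • Z p.succ - c • Z 0 := by
  rw [pair, Fin.sum_univ_succ, Finset.sum_eq_single p]
  · simp only [signature_zero, signature_succ, boostVector, Fin.cons_zero, Fin.cons_succ,
      Pi.single_eq_same]
    module
  · intro i _ hi
    simp [boostVector, Pi.single_eq_of_ne hi]
  · simp

lemma boostVector_sq (p : Fin m) {c s : ℝ} (h : c ^ 2 - s ^ 2 = 1) :
    ∑ k, signature k * boostVector p c s k * boostVector p c s k = -1 := by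
  rw [Fin.sum_univ_succ, Finset.sum_eq_single p]
  · simp only [signature_zero, signature_succ, boostVector, Fin.cons_zero, Fin.cons_succ,
      Pi.single_eq_same]
    linarith
  · intro i _ hi
    simp [boostVector, Pi.single_eq_of_ne hi]
  · simp

omit [Mul F] [One F] [Star F] [Hurwitz F] in
lemma reflectRow_boost_zero (p : Fin m) {c s : ℝ} (h : c ^ 2 - s ^ 2 = 1) (X : Mat F m) (j : Fin (m + 1)) :
    reflectRow (boostVector p c s) X 0 j = (2 * c * s) • X p.succ j - (c ^ 2 + s ^ 2) • X 0 j := by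
  rw [reflectRow_apply, pair_boostVector]
  have : c ^ 2 + s ^ 2 = 2 * c ^ 2 - 1 := by linarith
  rw [this]
  simp only [boostVector, Fin.cons_zero]
  module

omit [Mul F] [One F] [Star F] [Hurwitz F] in
lemma reflectRow_boost_same (p : Fin m) {c s : ℝ} (h : c ^ 2 - s ^ 2 = 1) (X : Mat F m) (j : Fin (m + 1)) :
    reflectRow (boostVector p c s) X p.succ j =
      (c ^ 2 + s ^ 2) • X p.succ j - (2 * c * s) • X 0 j := by
  rw [reflectRow_apply, pair_boostVector]
  have : c ^ 2 + s ^ 2 = 2 * s ^ 2 + 1 := by linarith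
  rw [this]
  simp only [boostVector, Fin.cons_succ, Pi.single_eq_same]
  module

omit [Mul F] [One F] [Star F] [Hurwitz F] in
lemma reflectRow_boost_of_ne {p i : Fin m} (hi : i ≠ p) (c s : ℝ) (X : Mat F m) (j : Fin (m + 1)) :
    reflectRow (boostVector p c s) X i.succ j = X i.succ j := by
  rw [reflectRow_apply]
  simp [boostVector, Pi.single_eq_of_ne hi]

lemma isSymmetry_boost (p : Fin m) {c s : ℝ} (h : c ^ 2 - s ^ 2 = 1) :
    IsSymmetry (reflect (boostVector p c s) : Mat F m →ₗ[ℝ] Mat F m) := by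
  have hu := boostVector_sq p h
  refine ⟨fun X Y => ?_, fun X hX => herm_reflect hX, fun X _ => conv_reflect_self hu X,
    fun X hX => ⟨herm_reflect hX.herm, ?_, ?_, ?_⟩⟩
  · exact (form_reflectRow hu _ _).trans (form_reflectCol hu _ _)
  · rw [conv_reflect_self hu, hX.conv_self, map_neg]
  · rw [trace_reflect hu, hX.trace]
  · set a : ℝ := inner ℝ (1 : F) (X 0 0) with ha
    have h1 := congrArg (fun z => inner ℝ (1 : F) z)
      (reflect_rank_one (u := boostVector p c s) hX 0 0)
    simp only [real_inner_smul_right, mul_star_self, inner_one, _root_.mul_one] at h1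
    -- By `reflect_rank_one` the corner of the image times the corner of X is the squared norm of
    -- this entry. So the entry only has to be nonzero, which follows from |Re X_p0| < X_00.
    have h2 : inner ℝ (1 : F) (reflectRow (boostVector p c s) X 0 0) < 0 := by
      rw [reflectRow_boost_zero p h, inner_sub_right, real_inner_smul_right, real_inner_smul_right, ← ha]
      have h3 : |inner ℝ (1 : F) (X p.succ 0)| < a := by
        refine (abs_real_inner_le_norm _ _).trans_lt ?_
        rw [Hurwitz.norm_one, _root_.one_mul]
        exact hX.norm_lt p
      obtain ⟨h4, h5⟩ := abs_lt.1 h3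
      have h6 : (c + s) * (c - s) = 1 := by linarith
      have h7 : 0 < (c + s) ^ 2 := by have := left_ne_zero_of_mul_eq_one h6; positivity
      have h8 : 0 < (c - s) ^ 2 := by have := right_ne_zero_of_mul_eq_one h6; positivity
      nlinarith [mul_pos h7 (sub_pos.2 h5), mul_pos h8 (sub_pos.2 h4)]
    have h3 : reflectRow (boostVector p c s) X 0 0 ≠ 0 := fun h0 => by
      rw [h0, inner_zero_right] at h2
      exact lt_irrefl _ h2
    have h4 : 0 < ‖reflectRow (boostVector p c s) X 0 0‖ ^ 2 := by positivity
    rw [← h1] at h4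
    exact (pos_iff_pos_of_mul_pos h4).1 hX.pos

-- c and s are cosh and sinh of half the angle t with tanh t = b/a, because the reflection in (c, s)
-- acts with the doubled angle.
omit [Mul F] [One F] [Star F] [Hurwitz F] in
lemma exists_boost {a b : ℝ} (h : |b| < a) :
    ∃ c s : ℝ, c ^ 2 - s ^ 2 = 1 ∧ (c ^ 2 + s ^ 2) * b = 2 * c * s * a := by
  obtain ⟨h1, h2⟩ := abs_lt.1 h
  have hp : 0 < a ^ 2 - b ^ 2 := by nlinarith
  set r := √(a ^ 2 - b ^ 2)
  have hr : 0 < r := Real.sqrt_pos.2 hp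
  have hr2 : r ^ 2 = a ^ 2 - b ^ 2 := Real.sq_sqrt hp.le
  set t := Real.arsinh (b / r)
  have hs : Real.sinh t = b / r := Real.sinh_arsinh _
  have hc : Real.cosh t = a / r := by
    have h3 : Real.cosh t ^ 2 = (a / r) ^ 2 := by
      rw [Real.cosh_sq, hs]
      field_simp
      linarith
    have h4 : 0 ≤ a / r := div_nonneg (by linarith) hr.le
    exact (sq_eq_sq₀ (Real.cosh_pos t).le h4).1 h3
  refine ⟨Real.cosh (t / 2), Real.sinh (t / 2), Real.cosh_sq_sub_sinh_sq _, ?_⟩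
  have h3 : Real.cosh (t / 2) ^ 2 + Real.sinh (t / 2) ^ 2 = a / r := by
    rw [← Real.cosh_two_mul, mul_div_cancel₀ t two_ne_zero, hc]
  have h4 : 2 * Real.cosh (t / 2) * Real.sinh (t / 2) = b / r := by
    rw [← hs, ← mul_div_cancel₀ t (two_ne_zero (α := ℝ)), Real.sinh_two_mul]
    simp only [mul_div_cancel₀ t (two_ne_zero (α := ℝ))]
    ring
  rw [h3, h4]
  ring

/-- The spaces `H_F^m` have enough symmetries to be homogeneous. -/
class HurwitzSpace (F : Type) [NormedAddCommGroup F] [InnerProductSpace ℝ F] [Mul F] [One F]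
    [Star F] [Hurwitz F] (m : ℕ) : Prop where
  assoc : ∀ (w : Fin m → F) (i j k : Fin m) (x : F),
    (w i * star (w j)) * ((w j * star (w k)) * x) = ‖w j‖ ^ 2 • ((w i * star (w k)) * x)
  twist : ∀ p : Fin m, ∃ T : F → Fin (m + 1) → Fin (m + 1) → F →ₗ[ℝ] F, ∀ u, ‖u‖ = 1 →
    IsTwist (T u) ∧ (∀ i j x, T (star u) i j (T u i j x) = x) ∧ ∀ x, T u p.succ 0 x = u * x

lemma hurwitzSpace_of_assoc (h : ∀ a b c : F, a * b * c = a * (b * c)) (m : ℕ) :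
    HurwitzSpace F m where
  assoc w i j k x := by
    rw [h, ← h (star (w j)), ← h (star (w j)), star_mul_self, real_mul, ← h, Hurwitz.mul_smul,
      Hurwitz.smul_mul]
  twist p := by
    -- The twist is conjugation X ↦ D X D* by a diagonal matrix of unit elements, which is
    -- multiplicative by associativity.
    let d : F → Fin (m + 1) → F := fun u i => if i = p.succ then u else 1
    have hd : ∀ u, ‖u‖ = 1 → ∀ i, ‖d u i‖ = 1 := fun u hu i => by
      simp only [d]; split_ifs <;> simp [hu, Hurwitz.norm_one]
    have hs : ∀ u i, d (star u) i = star (d u i) := fun u i => by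
      simp only [d]; split_ifs <;> simp [Hurwitz.star_one]
    refine ⟨fun u i j => (mulL.flip (star (d u j))) ∘ₗ mulL (d u i), fun u hu => ⟨⟨?_, ?_, ?_, ?_⟩,
      ?_, ?_⟩⟩
    · intro i j x y
      change inner ℝ ((d u i * x) * star (d u j)) ((d u i * y) * star (d u j)) = _
      rw [inner_mul_mul_right, inner_mul_mul_left, Hurwitz.norm_star, hd u hu, hd u hu]
      ring
    · intro i j x
      change star ((d u i * x) * star (d u j)) = (d u j * star x) * star (d u i)
      rw [Hurwitz.star_mul, Hurwitz.star_star, Hurwitz.star_mul, h]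
    · intro i
      change (d u i * 1) * star (d u i) = 1
      rw [Hurwitz.mul_one, mul_star_self, hd u hu]
      norm_num
    · intro i k j x y _ _ _
      change ((d u i * x) * star (d u k)) * ((d u k * y) * star (d u j)) =
        (d u i * (x * y)) * star (d u j)
      rw [h (d u i * x), ← h (star (d u k)), ← h (star (d u k)), star_mul_self, hd u hu,
        real_mul, one_pow, one_smul, ← h, ← h]
    · intro i j x
      change (d (star u) i * ((d u i * x) * star (d u j))) * star (d (star u) j) = x
      rw [hs, hs, Hurwitz.star_star, h, h, star_mul_self, ← h, ← h, star_mul_self,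
        hd u hu, hd u hu, mul_real, one_pow, one_smul, one_smul, Hurwitz.one_mul]
    · intro x
      change (d u p.succ * x) * star (d u 0) = u * x
      have h0 : (0 : Fin (m + 1)) ≠ p.succ := (Fin.succ_ne_zero p).symm
      simp only [d, if_true, if_neg h0, Hurwitz.star_one, Hurwitz.mul_one]

instance (m : ℕ) : HurwitzSpace ℂ m := hurwitzSpace_of_assoc _root_.mul_assoc m

instance (m : ℕ) : HurwitzSpace ℍ[ℝ] m := hurwitzSpace_of_assoc _root_.mul_assoc m

lemma flexible (a x : F) : (a * x) * a = a * (x * a) := by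
  have h := moufang_middle a 1 x
  rw [Hurwitz.mul_one, Hurwitz.one_mul] at h
  exact h.symm

/-- The symmetries of `3 × 3` matrices with first column `(1, u, ū)`. -/
def cayleyTwist (u : F) : Fin 3 → Fin 3 → F →ₗ[ℝ] F :=
  ![![LinearMap.id, mulL.flip (star u), mulL.flip u],
    ![mulL u, LinearMap.id, mulL.flip u ∘ₗ mulL u],
    ![mulL (star u), mulL.flip (star u) ∘ₗ mulL (star u), LinearMap.id]]

/-- For distinct indices the required multiplicativity is, case by case, a form of one of the
Moufang identities; they take the place of associativity. -/
lemma isTwist_cayleyTwist {u : F} (hu : ‖u‖ = 1) : IsTwist (m := 2) (cayleyTwist u) where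
  inner_map i j x y := by
    fin_cases i <;> fin_cases j <;>
      simp [cayleyTwist, inner_mul_mul_left, inner_mul_mul_right, Hurwitz.norm_star, hu]
  star_map i j x := by
    fin_cases i <;> fin_cases j <;>
      simp [cayleyTwist, Hurwitz.star_mul, Hurwitz.star_star, flexible]
  map_one i := by
    fin_cases i <;> rfl
  mul_map i k j x y hik hkj hij := by
    have hs : ‖star u‖ = 1 := (Hurwitz.norm_star u).trans hu
    have h1 : ∀ v : F, ‖v‖ = 1 → (x * star v) * ((v * y) * v) = (x * y) * v := fun v hv => by
      rw [flexible, moufang_right, mul_star_mul_self, hv, one_pow, one_smul]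
    have h2 : ∀ v : F, ‖v‖ = 1 → ((v * x) * v) * (star v * y) = v * (x * y) := fun v hv => by
      rw [moufang_left, mul_star_mul, hv, one_pow, one_smul]
    have h3 := h1 (star u) hs
    have h4 := h2 (star u) hs
    rw [Hurwitz.star_star] at h3 h4
    fin_cases i <;> fin_cases k <;> fin_cases j <;> first
      | exact absurd rfl hik
      | exact absurd rfl hkj
      | exact absurd rfl hij
      | exact h1 u hu
      | exact h2 u hu
      | exact h3
      | exact h4
      | exact moufang_middle _ _ _

lemma cayleyTwist_star {u : F} (hu : ‖u‖ = 1) (i j : Fin 3) (x : F) :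
    cayleyTwist (star u) i j (cayleyTwist u i j x) = x := by
  have hs : ‖star u‖ = 1 := (Hurwitz.norm_star u).trans hu
  have h1 : ∀ v y : F, ‖v‖ = 1 → star v * (v * y) = y := fun v y hv => by
    have := mul_star_mul (star v) y
    rwa [Hurwitz.star_star, Hurwitz.norm_star, hv, one_pow, one_smul] at this
  have h2 : ∀ v y : F, ‖v‖ = 1 → (y * v) * star v = y := fun v y hv => by
    rw [mul_mul_star, hv, one_pow, one_smul]
  have h3 := fun y => h1 (star u) y hs
  have h4 := fun y => h2 (star u) y hs
  simp only [Hurwitz.star_star] at h3 h4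
  fin_cases i <;> fin_cases j <;>
    simp [cayleyTwist, Hurwitz.star_star, flexible, h1 u _ hu, h2 u _ hu, h3, h4]

lemma hurwitzSpace_two : HurwitzSpace F 2 where
  assoc w i j k x := by
    by_cases hij : i = j
    · subst hij
      rw [mul_star_self, real_mul]
    by_cases hjk : j = k
    · subst hjk
      rw [mul_star_self, real_mul, Hurwitz.mul_smul]
    -- Among three indices in `Fin 2` two coincide, so alternative laws are enough.
    have hik : i = k := by omega
    subst hik
    have h : w j * star (w i) = star (w i * star (w j)) := by
      rw [Hurwitz.star_mul, Hurwitz.star_star]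
    rw [h, mul_star_mul, mul_star_self, real_mul, Hurwitz.norm_mul, Hurwitz.norm_star, smul_smul]
    ring_nf
  twist p := by
    fin_cases p
    · exact ⟨cayleyTwist, fun u hu => ⟨isTwist_cayleyTwist hu, cayleyTwist_star hu, fun x => rfl⟩⟩
    -- The last entry of the first column is acted on by ū, so the conjugate parameter makes it u.
    · refine ⟨fun u => cayleyTwist (star u), fun u hu => ?_⟩
      have hs : ‖star u‖ = 1 := (Hurwitz.norm_star u).trans hu
      refine ⟨isTwist_cayleyTwist hs, cayleyTwist_star hs, fun x => ?_⟩
      change star (star u) * x = u * x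
      rw [Hurwitz.star_star]

instance : HurwitzSpace Octonion 2 := hurwitzSpace_two

/-- The base point of `H_F^m`. -/
def basePoint (F : Type) [Zero F] [One F] (m : ℕ) : Mat F m :=
  fun i j => if i = 0 ∧ j = 0 then 1 else 0

lemma IsPoint.eq_basePoint {X : Mat F m} (hX : IsPoint X) (h : ∀ i : Fin m, X i.succ 0 = 0) :
    X = basePoint F m := by
  have h1 := hX.norm_sum
  have h0 := hX.herm.diag 0
  have hr := hX.rank_one
  have ha : inner ℝ (1 : F) (X 0 0) = 1 := by
    simp only [h, norm_zero] at h1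
    have := hX.pos
    simp at h1
    nlinarith
  have hzero : ∀ i : Fin (m + 1), i ≠ 0 → X i 0 = 0 := fun i hi => by
    obtain ⟨k, rfl⟩ := Fin.exists_succ_eq.2 hi
    exact h k
  ext i j
  have hij := hr i j
  rw [ha, one_smul] at hij
  by_cases hi : i = 0
  · by_cases hj : j = 0
    · rw [basePoint, if_pos ⟨hi, hj⟩, hi, hj, h0, ha, one_smul]
    · rw [basePoint, if_neg fun h => hj h.2, hij, ← hX.herm j 0, hzero j hj, Hurwitz.star_zero,
        Hurwitz.mul_zero]
  · rw [basePoint, if_neg fun h => hi h.1, hij, hzero i hi, Hurwitz.zero_mul]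

/-- The symmetry group is transitive. -/
lemma exists_symmetry [HurwitzSpace F m] {X : Mat F m} (hX : IsPoint X) :
    ∃ g g' : Mat F m →ₗ[ℝ] Mat F m, IsSymmetry g ∧ IsSymmetry g' ∧ (∀ Y, g (g' Y) = Y) ∧
      (∀ Y, g' (g Y) = Y) ∧ g X = basePoint F m := by
  classical
  -- Induction on the number of nonzero entries of the first column below the corner: each step
  -- removes one and creates none.
  generalize hk : (Finset.univ.filter fun i : Fin m => X i.succ 0 ≠ 0).card = k
  induction k using Nat.strong_induction_on generalizing X with
  | _ k ih =>
  by_cases h : ∀ i : Fin m, X i.succ 0 = 0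
  · exact ⟨LinearMap.id, LinearMap.id, ⟨fun _ _ => rfl, fun _ => id, fun _ _ => rfl, fun _ => id⟩,
      ⟨fun _ _ => rfl, fun _ => id, fun _ _ => rfl, fun _ => id⟩, fun _ => rfl, fun _ => rfl,
      hX.eq_basePoint h⟩
  push Not at h
  obtain ⟨p, hp⟩ := h
  obtain ⟨T, hT⟩ := HurwitzSpace.twist (F := F) p
  have hn : ‖X p.succ 0‖ ≠ 0 := norm_ne_zero_iff.2 hp
  -- The unit whose twist turns the entry at p into its norm, so that a real boost can cancel it
  -- against the corner.
  set u := ‖X p.succ 0‖⁻¹ • star (X p.succ 0) with hu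
  have hu1 : ‖u‖ = 1 := by
    rw [hu, norm_smul, Hurwitz.norm_star, norm_inv, norm_norm, inv_mul_cancel₀ hn]
  have hus : ‖star u‖ = 1 := (Hurwitz.norm_star u).trans hu1
  obtain ⟨hT1, hT2, hT3⟩ := hT u hu1
  obtain ⟨hT1', hT2', -⟩ := hT (star u) hus
  rw [Hurwitz.star_star] at hT2'
  set X₁ := entrywise (T u) X with hX₁
  have hP1 : IsPoint X₁ := hT1.isSymmetry.point X hX
  have hp1 : X₁ p.succ 0 = ‖X p.succ 0‖ • (1 : F) := by
    change T u p.succ 0 (X p.succ 0) = _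
    rw [hT3, hu, Hurwitz.smul_mul, star_mul_self, smul_smul]
    congr 1
    field_simp
  have hz1 : ∀ i : Fin m, X i.succ 0 = 0 → X₁ i.succ 0 = 0 := fun i hi => by
    change T u i.succ 0 (X i.succ 0) = 0
    rw [hi, map_zero]
  have hlt := hP1.norm_lt p
  set a : ℝ := inner ℝ (1 : F) (X₁ 0 0) with ha
  set b := ‖X p.succ 0‖ with hb
  rw [hp1, norm_smul, Hurwitz.norm_one, _root_.mul_one, Real.norm_eq_abs] at hlt
  obtain ⟨c, s, hcs, hab⟩ := exists_boost hlt
  have hr := isSymmetry_boost (F := F) p hcs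
  set r : Mat F m →ₗ[ℝ] Mat F m := reflect (boostVector p c s)
  have hrr : ∀ Y, r (r Y) = Y := reflect_reflect (boostVector_sq p hcs)
  have h0 : X₁ 0 0 = a • (1 : F) := hP1.herm.diag 0
  have hz2 : ∀ i : Fin m, reflectRow (boostVector p c s) X₁ i.succ 0 = 0 → r X₁ i.succ 0 = 0 :=
    fun i hi => by
      have := reflect_rank_one (u := boostVector p c s) hP1 i.succ 0
      rw [hi, Hurwitz.zero_mul] at this
      exact (smul_eq_zero.1 this).resolve_left hP1.pos.ne'
  have hz3 : r X₁ p.succ 0 = 0 := hz2 p <| by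
    rw [reflectRow_boost_same p hcs, hp1, h0, smul_smul, smul_smul, hab, sub_self]
  have hz4 : ∀ i : Fin m, X i.succ 0 = 0 → r X₁ i.succ 0 = 0 := fun i hi => by
    refine hz2 i ?_
    have hip : i ≠ p := fun h => hp (by rw [← h, hi])
    rw [reflectRow_boost_of_ne hip, hz1 i hi]
  obtain ⟨g, g', hg, hg', h1, h2, h3⟩ := ih _ (by
    rw [← hk]
    refine Finset.card_lt_card ⟨fun i hi => ?_, fun hsub => ?_⟩
    · rw [Finset.mem_filter] at hi ⊢
      exact ⟨hi.1, fun h => hi.2 (hz4 i h)⟩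
    · have := hsub (Finset.mem_filter.2 ⟨Finset.mem_univ p, hp⟩)
      exact (Finset.mem_filter.1 this).2 hz3) (hr.point _ hP1) rfl
  have ht1 : ∀ Y, entrywise (T (star u)) (entrywise (T u) Y) = Y := fun Y => by
    ext i j; exact hT2 i j _
  have ht2 : ∀ Y, entrywise (T u) (entrywise (T (star u)) Y) = Y := fun Y => by
    ext i j; exact hT2' i j _
  refine ⟨g ∘ₗ (r ∘ₗ entrywise (T u)), entrywise (T (star u)) ∘ₗ (r ∘ₗ g'),
    hg.comp (hr.comp hT1.isSymmetry), hT1'.isSymmetry.comp (hr.comp hg'), fun Y => ?_, fun Y => ?_,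
    h3⟩
  · simp only [LinearMap.comp_apply, ht2, hrr, h1]
  · simp only [LinearMap.comp_apply, ht1, hrr, h2]

end Homogeneity

/-! ### Transport along isometries -/

/-- `L` is a linear isometry that preserves `carrier`. -/
structure Ambient.IsIsometry (A : Ambient) (L : A.V ≃L[ℝ] A.V) : Prop where
  form : ∀ x y, A.form (L x) (L y) = A.form x y
  mem : ∀ x, L x ∈ A.carrier ↔ x ∈ A.carrier

lemma deriv_continuousLinearEquiv {E : Type*} [NormedAddCommGroup E] [NormedSpace ℝ E]
    (L : E ≃L[ℝ] E) (c : ℝ → E) : (deriv fun s => L (c s)) = fun s => L (deriv c s) := by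
  funext s
  rw [← fderiv_apply_one_eq_deriv, ← fderiv_apply_one_eq_deriv]
  exact congrArg (fun l : ℝ →L[ℝ] E => l 1) (L.comp_fderiv (f := c) (x := s))

lemma Ambient.IsUnitGeodesic.shift {A : Ambient} {γ : ℝ → A.V} (h : A.IsUnitGeodesic γ) (r : ℝ) :
    A.IsUnitGeodesic fun s => γ (s + r) := by
  have d1 : (deriv fun s => γ (s + r)) = fun s => deriv γ (s + r) :=
    funext fun s => deriv_comp_add_const γ r s
  have d2 : ∀ s, deriv (deriv fun s => γ (s + r)) s = deriv (deriv γ) (s + r) := fun s => by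
    rw [d1, deriv_comp_add_const]
  refine ⟨h.smooth.comp (contDiff_id.add contDiff_const), fun s => h.mem _, fun s => ?_,
    fun s v hv => ?_⟩
  · rw [d1]; exact h.unit _
  · rw [d2]; exact h.geodesic _ v hv

namespace Ambient.IsIsometry

variable {A : Ambient} {L : A.V ≃L[ℝ] A.V} (hL : A.IsIsometry L)
include hL

lemma symm : A.IsIsometry L.symm where
  form x y := by rw [← hL.form, L.apply_symm_apply, L.apply_symm_apply]
  mem x := by rw [← hL.mem, L.apply_symm_apply]

lemma mem_tangent {x v : A.V} (h : v ∈ A.tangent x) : L v ∈ A.tangent (L x) := by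
  obtain ⟨c, h1, h2, h3⟩ := h
  exact ⟨fun s => L (c s), fun s => (hL.mem _).2 (h1 s), congrArg L h2,
    L.toContinuousLinearMap.hasFDerivAt.comp_hasDerivAt 0 h3⟩

lemma mem_tangent_iff {x v : A.V} : L v ∈ A.tangent (L x) ↔ v ∈ A.tangent x :=
  ⟨fun h => by simpa only [L.symm_apply_apply] using hL.symm.mem_tangent h, hL.mem_tangent⟩

lemma isUnitGeodesic {γ : ℝ → A.V} (hγ : A.IsUnitGeodesic γ) :
    A.IsUnitGeodesic fun s => L (γ s) where
  smooth := L.contDiff.comp hγ.smooth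
  mem s := (hL.mem _).2 (hγ.mem s)
  unit s := by rw [deriv_continuousLinearEquiv, hL.form, hγ.unit]
  geodesic s v hv := by
    rw [deriv_continuousLinearEquiv, deriv_continuousLinearEquiv, ← L.apply_symm_apply v, hL.form]
    exact hγ.geodesic s _ (hL.mem_tangent_iff.1 (by rwa [L.apply_symm_apply]))

/-- Transport of polar coordinates. -/
def polar {n : ℕ} {p : Profile} {d : ℕ} {x : A.V} (P : Polar A n p d (L x)) : Polar A n p d x where
  ι := L.symm.toLinearEquiv.toLinearMap ∘ₗ P.ι
  β := P.β.compr₂ L.symm.toLinearEquiv.toLinearMap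
  K := P.K
  form_ι v w := (hL.symm.form _ _).trans (P.form_ι v w)
  β_symm v w := congrArg L.symm (P.β_symm v w)
  form_β_ι w v := (hL.symm.form _ _).trans (P.form_β_ι w v)
  tangent_eq := by
    ext v
    rw [← hL.mem_tangent_iff, P.tangent_eq]
    exact exists_congr fun w => (L.toLinearEquiv.symm_apply_eq (x := P.ι w) (y := v)).symm
  sff c hc h0 hd w ξ h1 := by
    have h := P.sff (fun s => L (c s)) (hc.mono fun s hs => (hL.mem _).2 hs) (congrArg L h0)
      (L.contDiff.contDiffAt.comp 0 hd) w ξ (by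
        rw [deriv_continuousLinearEquiv]
        change L (deriv c 0) = _
        rw [h1]
        exact L.apply_symm_apply _)
    rw [deriv_continuousLinearEquiv, deriv_continuousLinearEquiv] at h
    rw [← h, ← hL.form]
    congr 2
    exact L.apply_symm_apply _
  K_symm := P.K_symm
  K_self := P.K_self
  K_idem := P.K_idem
  K_rank := P.K_rank
  isGeodesic w hw := by
    have h := hL.symm.isUnitGeodesic (P.isGeodesic w hw)
    simp only [map_add, map_smul, L.symm_apply_apply] at h
    exact h
  geodesic_second γ hγ h0 w h1 := by
    have h := P.geodesic_second _ (hL.isUnitGeodesic hγ) (congrArg L h0) w (by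
      rw [deriv_continuousLinearEquiv]
      change L (deriv γ 0) = _
      rw [h1]
      exact L.apply_symm_apply _)
    rw [deriv_continuousLinearEquiv, deriv_continuousLinearEquiv] at h
    exact (L.symm_apply_eq.2 h.symm).symm
  surj y hy := by
    obtain ⟨s, hs, w, hw, h⟩ := P.surj (L y) ((hL.mem y).2 hy)
    refine ⟨s, hs, w, hw, ?_⟩
    rw [← L.symm_apply_apply y, h]
    simp only [map_add, map_smul, L.symm_apply_apply]
    rfl

end Ambient.IsIsometry

/-! ### The hyperbolic spaces at their base points -/

section Base

variable {F : Type} [NormedAddCommGroup F] [InnerProductSpace ℝ F] {m : ℕ}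

/-- Column vectors over `F`. -/
abbrev Col (F : Type) (m : ℕ) : Type := PiLp 2 fun _ : Fin m => F

/-- Block matrices. -/
def blockMat (a : F) (r c : Fin m → F) (B : Fin m → Fin m → F) : Mat F m :=
  Fin.cons (Fin.cons a r) fun i => Fin.cons (c i) (B i)

section

variable (a : F) (r c : Fin m → F) (B : Fin m → Fin m → F) (i j : Fin m)

omit [NormedAddCommGroup F] [InnerProductSpace ℝ F]

@[simp] lemma blockMat_zero_zero : blockMat a r c B 0 0 = a := rfl
@[simp] lemma blockMat_zero_succ : blockMat a r c B 0 j.succ = r j := rfl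
@[simp] lemma blockMat_succ_zero : blockMat a r c B i.succ 0 = c i := rfl
@[simp] lemma blockMat_succ_succ : blockMat a r c B i.succ j.succ = B i j := rfl

end

omit [NormedAddCommGroup F] [InnerProductSpace ℝ F] in
lemma mat_ext {X Y : Mat F m} (h1 : X 0 0 = Y 0 0) (h2 : ∀ j : Fin m, X 0 j.succ = Y 0 j.succ)
    (h3 : ∀ i : Fin m, X i.succ 0 = Y i.succ 0)
    (h4 : ∀ i j : Fin m, X i.succ j.succ = Y i.succ j.succ) : X = Y := by
  ext i j
  refine Fin.cases ?_ (fun i => ?_) i <;> refine Fin.cases ?_ (fun j => ?_) j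
  exacts [h1, h2 j, h3 i, h4 i j]

lemma hermitianForm_eq (X Y : Mat F m) : hermitianForm F m X Y =
    -2 * (inner ℝ (X 0 0) (Y 0 0) - ∑ j : Fin m, inner ℝ (X 0 j.succ) (Y 0 j.succ) -
      ∑ i : Fin m, inner ℝ (X i.succ 0) (Y i.succ 0) +
      ∑ i : Fin m, ∑ j : Fin m, inner ℝ (X i.succ j.succ) (Y i.succ j.succ)) := by
  rw [hermitianForm_apply]
  simp only [Fin.sum_univ_succ, signature_zero, signature_succ, Finset.sum_add_distrib, mul_neg,
    mul_one, one_mul, neg_mul, Finset.sum_neg_distrib]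
  ring

variable [Mul F] [One F] [Star F] [Hurwitz F]

lemma finiteDimensional_mat : FiniteDimensional ℝ (Mat F m) := by
  have := Hurwitz.finiteDimensional (F := F)
  infer_instance

/-! #### Algebra -/

/-- Multiplication by a Hermitian matrix is self-adjoint for the form; entrywise this is adjointness
of multiplication in F, without associativity. -/
lemma form_conv_left {X : Mat F m} (hX : Herm X) (Y Z : Mat F m) :
    hermitianForm F m (conv X Y) Z = hermitianForm F m Y (conv X Z) := by
  rw [hermitianForm_apply, hermitianForm_apply]
  congr 1
  have h1 : ∀ i j, signature i * signature j * inner ℝ (conv X Y i j) (Z i j) =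
      ∑ k, signature k * signature j * (signature i * inner ℝ (Y k j) (X k i * Z i j)) :=
    fun i j => by
      rw [conv_apply, sum_inner, Finset.mul_sum]
      refine Finset.sum_congr rfl fun k _ => ?_
      rw [real_inner_smul_left, Hurwitz.inner_mul_left, hX]
      ring
  have h2 : ∀ k j, signature k * signature j * inner ℝ (Y k j) (conv X Z k j) =
      ∑ i, signature k * signature j * (signature i * inner ℝ (Y k j) (X k i * Z i j)) :=
    fun k j => by
      rw [conv_apply, inner_sum, Finset.mul_sum]
      refine Finset.sum_congr rfl fun k _ => ?_
      rw [real_inner_smul_right]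
  simp only [h1, h2]
  rw [Finset.sum_comm]
  conv_rhs => rw [Finset.sum_comm]
  exact Finset.sum_congr rfl fun j _ => Finset.sum_comm

lemma form_conv_right {Y : Mat F m} (hY : Herm Y) (X Z : Mat F m) :
    hermitianForm F m (conv X Y) Z = hermitianForm F m X (conv Z Y) := by
  rw [hermitianForm_apply, hermitianForm_apply]
  congr 1
  have h1 : ∀ i j, signature i * signature j * inner ℝ (conv X Y i j) (Z i j) =
      ∑ k, signature i * signature k * (signature j * inner ℝ (X i k) (Z i j * Y j k)) :=
    fun i j => by
      rw [conv_apply, sum_inner, Finset.mul_sum]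
      refine Finset.sum_congr rfl fun k _ => ?_
      rw [real_inner_smul_left, Hurwitz.inner_mul_right, hY]
      ring
  have h2 : ∀ i k, signature i * signature k * inner ℝ (X i k) (conv Z Y i k) =
      ∑ j, signature i * signature k * (signature j * inner ℝ (X i k) (Z i j * Y j k)) :=
    fun i k => by
      rw [conv_apply, inner_sum, Finset.mul_sum]
      refine Finset.sum_congr rfl fun k _ => ?_
      rw [real_inner_smul_right]
  simp only [h1, h2]
  exact Finset.sum_congr rfl fun i _ => Finset.sum_comm

/-- The matrix `y ↦ (0, ȳ/2; y/2, 0)`. -/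
def tangentMat : Col F m →ₗ[ℝ] Mat F m where
  toFun y := blockMat 0 (fun j => (1 / 2 : ℝ) • star (y j)) (fun i => (1 / 2 : ℝ) • y i) 0
  map_add' y z := by
    apply mat_ext <;> intros <;> simp [Hurwitz.star_add]
  map_smul' c y := by
    apply mat_ext <;> intros <;> simp [Hurwitz.star_smul, smul_comm c]

/-- The second fundamental form at the base point. -/
def secondForm : Col F m →ₗ[ℝ] Col F m →ₗ[ℝ] Mat F m :=
  LinearMap.mk₂ ℝ (fun y z => blockMat ((1 / 2 * inner ℝ y z : ℝ) • 1) 0 0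
      fun i j => (1 / 4 : ℝ) • (y i * star (z j) + z i * star (y j)))
    (fun x y z => by
      apply mat_ext <;> intros <;>
        simp only [blockMat_zero_zero, blockMat_zero_succ, blockMat_succ_zero, blockMat_succ_succ,
          Pi.add_apply, Pi.zero_apply, PiLp.add_apply, inner_add_left, Hurwitz.star_add,
          Hurwitz.add_mul, Hurwitz.mul_add] <;> module)
    (fun c y z => by
      apply mat_ext <;> intros <;>
        simp only [blockMat_zero_zero, blockMat_zero_succ, blockMat_succ_zero, blockMat_succ_succ,
          Pi.smul_apply, Pi.zero_apply, PiLp.smul_apply, real_inner_smul_left, Hurwitz.star_smul,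
          Hurwitz.smul_mul, Hurwitz.mul_smul] <;> module)
    (fun x y z => by
      apply mat_ext <;> intros <;>
        simp only [blockMat_zero_zero, blockMat_zero_succ, blockMat_succ_zero, blockMat_succ_succ,
          Pi.add_apply, Pi.zero_apply, PiLp.add_apply, inner_add_right, Hurwitz.star_add,
          Hurwitz.add_mul, Hurwitz.mul_add] <;> module)
    (fun c y z => by
      apply mat_ext <;> intros <;>
        simp only [blockMat_zero_zero, blockMat_zero_succ, blockMat_succ_zero, blockMat_succ_succ,
          Pi.smul_apply, Pi.zero_apply, PiLp.smul_apply, real_inner_smul_right, Hurwitz.star_smul,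
          Hurwitz.smul_mul, Hurwitz.mul_smul] <;> module)

lemma tangentMat_apply (y : Col F m) : tangentMat y =
    blockMat 0 (fun j => (1 / 2 : ℝ) • star (y j)) (fun i => (1 / 2 : ℝ) • y i) 0 := rfl

lemma secondForm_apply (y z : Col F m) : secondForm y z =
    blockMat ((1 / 2 * inner ℝ y z : ℝ) • 1) 0 0
      fun i j => (1 / 4 : ℝ) • (y i * star (z j) + z i * star (y j)) := rfl

/-- The matrix with blocks `a`, `b w̄`, `b w` and `c w w̄`. -/
def rankOne (w : Col F m) (a b c : ℝ) : Mat F m :=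
  blockMat (a • 1) (fun j => b • star (w j)) (fun i => b • w i) fun i j => c • (w i * star (w j))

omit [Mul F] [One F] [Star F] [Hurwitz F] in
lemma norm_sq_col (w : Col F m) : ∑ i, ‖w i‖ ^ 2 = ‖w‖ ^ 2 := by
  rw [← real_inner_self_eq_norm_sq, PiLp.inner_apply]
  simp only [real_inner_self_eq_norm_sq]

lemma secondForm_comm (y z : Col F m) : secondForm y z = secondForm z y := by
  rw [secondForm_apply, secondForm_apply, real_inner_comm]
  simp only [add_comm]

lemma form_tangentMat (y z : Col F m) :
    hermitianForm F m (tangentMat y) (tangentMat z) = inner ℝ y z := by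
  rw [hermitianForm_eq, tangentMat_apply, tangentMat_apply, PiLp.inner_apply]
  simp only [blockMat_zero_zero, blockMat_zero_succ, blockMat_succ_zero, blockMat_succ_succ,
    real_inner_smul_left, real_inner_smul_right, Hurwitz.inner_star, ← Finset.mul_sum, Pi.zero_apply,
    inner_zero_left, Finset.sum_const_zero]
  ring

lemma form_secondForm_tangentMat (x y z : Col F m) :
    hermitianForm F m (secondForm x y) (tangentMat z) = 0 := by
  rw [hermitianForm_eq, tangentMat_apply, secondForm_apply]
  simp only [blockMat_zero_zero, blockMat_zero_succ, blockMat_succ_zero, blockMat_succ_succ,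
    Pi.zero_apply, inner_zero_left, inner_zero_right, Finset.sum_const_zero]
  ring

/-- The radial curves stay in the family `rankOne w`, where products are computed with three real
parameters. -/
lemma curve_eq_rankOne (w : Col F m) (hw : ‖w‖ = 1) (s : ℝ) (c : ℝ) :
    basePoint F m + s • tangentMat w + c • secondForm w w =
      rankOne w (1 + c / 2) (s / 2) (c / 2) := by
  have hw2 : inner ℝ w w = (1 : ℝ) := by rw [real_inner_self_eq_norm_sq, hw, one_pow]
  have h : basePoint F m = blockMat 1 0 0 0 := by
    apply mat_ext <;> intros <;> simp [basePoint]
  rw [h, tangentMat_apply, secondForm_apply, rankOne, hw2]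
  apply mat_ext <;> intros <;>
    simp only [blockMat_zero_zero, blockMat_zero_succ, blockMat_succ_zero, blockMat_succ_succ,
      Pi.add_apply, Pi.smul_apply, Pi.zero_apply] <;> module

lemma derivCurve_eq_rankOne (w : Col F m) (hw : ‖w‖ = 1) (s c : ℝ) :
    s • tangentMat w + c • secondForm w w = rankOne w (c / 2) (s / 2) (c / 2) := by
  have hw2 : inner ℝ w w = (1 : ℝ) := by rw [real_inner_self_eq_norm_sq, hw, one_pow]
  rw [tangentMat_apply, secondForm_apply, rankOne, hw2]
  apply mat_ext <;> intros <;>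
    simp only [blockMat_zero_zero, blockMat_zero_succ, blockMat_succ_zero, blockMat_succ_succ,
      Pi.add_apply, Pi.smul_apply, Pi.zero_apply] <;> module

lemma herm_rankOne (w : Col F m) (a b c : ℝ) : Herm (rankOne w a b c) := by
  intro i j
  refine Fin.cases ?_ (fun i => ?_) i <;> refine Fin.cases ?_ (fun j => ?_) j <;>
    simp [rankOne, Hurwitz.star_smul, Hurwitz.star_mul, Hurwitz.star_star, Hurwitz.star_one]

/-- For fixed w the family multiplies like real 2 × 2 matrices with diag(-1, 1) inserted. The triple
products that occur are covered by alternativity and `HurwitzSpace.assoc`. -/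
lemma conv_rankOne [HurwitzSpace F m] {w : Col F m} (hw : ‖w‖ = 1) (a b c a' b' c' : ℝ) :
    conv (rankOne w a b c) (rankOne w a' b' c') =
      blockMat ((-(a * a') + b * b') • 1) (fun j => (-(a * b') + b * c') • star (w j))
        (fun i => (-(b * a') + c * b') • w i)
        fun i j => (-(b * b') + c * c') • (w i * star (w j)) := by
  have hw2 : ∑ i, ‖w i‖ ^ 2 = 1 := by rw [norm_sq_col, hw, one_pow]
  have h1 : ∀ k x, star (w k) * (w k * x) = ‖w k‖ ^ 2 • x := fun k x =>
    Hurwitz.star_mul_mul _ _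
  have h2 : ∀ x k, (x * star (w k)) * w k = ‖w k‖ ^ 2 • x := fun k x =>
    Hurwitz.mul_star_mul_self _ _
  have h3 : ∀ i j k, (w i * star (w k)) * (w k * star (w j)) =
      ‖w k‖ ^ 2 • (w i * star (w j)) := fun i j k => by
    have := HurwitzSpace.assoc w.ofLp i k j 1
    rwa [Hurwitz.mul_one, Hurwitz.mul_one] at this
  apply mat_ext <;> intros <;>
    simp only [conv_eq, rankOne, blockMat_zero_zero, blockMat_zero_succ, blockMat_succ_zero,
      blockMat_succ_succ, Hurwitz.smul_mul, Hurwitz.mul_smul, Hurwitz.one_mul, Hurwitz.mul_one,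
      h1, h2, h3, Hurwitz.star_mul_self, smul_smul, ← Finset.sum_smul, ← Finset.mul_sum, hw2]
  all_goals module

lemma form_rankOne {w : Col F m} (hw : ‖w‖ = 1) (a b c a' b' c' : ℝ) :
    hermitianForm F m (rankOne w a b c) (rankOne w a' b' c') =
      -2 * (a * a' - 2 * (b * b') + c * c') := by
  have hw2 : ∑ i, ‖w i‖ ^ 2 = 1 := by rw [norm_sq_col, hw, one_pow]
  have h : ∀ i, inner ℝ (w i) (w i) = ‖w i‖ ^ 2 := fun i => real_inner_self_eq_norm_sq _
  have h1 : ∀ i j, inner ℝ (w i * star (w j)) (w i * star (w j)) = ‖w i‖ ^ 2 * ‖w j‖ ^ 2 :=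
    fun i j => by rw [Hurwitz.inner_mul_mul_left, Hurwitz.inner_star, h]
  rw [hermitianForm_eq]
  simp only [rankOne, blockMat_zero_zero, blockMat_zero_succ, blockMat_succ_zero,
    blockMat_succ_succ, real_inner_smul_left, real_inner_smul_right, Hurwitz.inner_star, h, h1,
    ← Finset.mul_sum, mul_one, hw2, Hurwitz.inner_one]
  ring

lemma isPoint_rankOne [HurwitzSpace F m] {w : Col F m} (hw : ‖w‖ = 1) {a b c : ℝ}
    (h1 : a - c = 1) (h2 : b ^ 2 = a * c) (h3 : 0 < a) : IsPoint (rankOne w a b c) where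
  herm := herm_rankOne w a b c
  conv_self := by
    obtain rfl : c = a - 1 := by linarith
    have e1 : -(a * a) + b * b = -a := by linear_combination h2
    have e2 : -(a * b) + b * (a - 1) = -b := by ring
    have e3 : -(b * a) + (a - 1) * b = -b := by ring
    have e4 : -(b * b) + (a - 1) * (a - 1) = -(a - 1) := by linear_combination -h2
    rw [conv_rankOne hw, e1, e2, e3, e4]
    apply mat_ext <;> intros <;> exact neg_smul _ _
  trace := by
    have hw2 : ∑ i, ‖w i‖ ^ 2 = 1 := by rw [norm_sq_col, hw, one_pow]
    rw [Fin.sum_univ_succ]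
    simp only [rankOne, signature_zero, signature_succ, blockMat_zero_zero, blockMat_succ_succ,
      one_smul, Hurwitz.mul_star_self, ← Finset.smul_sum, ← Finset.sum_smul, hw2]
    have : a = c + 1 := by linarith
    rw [this]
    module
  pos := by
    rwa [rankOne, blockMat_zero_zero, real_inner_smul_right, Hurwitz.inner_one, mul_one]

/-- In the real 2 × 2 calculus the product has entries 0 and ±(b² - ac). The partner with a and c
exchanged supplies a second normal direction along the radial geodesics. -/
lemma conv_rankOne_swap [HurwitzSpace F m] {w : Col F m} (hw : ‖w‖ = 1) {a b c : ℝ}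
    (h : b ^ 2 = a * c) : conv (rankOne w a b c) (rankOne w c b a) = 0 := by
  have e1 : -(a * c) + b * b = 0 := by linear_combination h
  have e2 : -(a * b) + b * a = 0 := by ring
  have e3 : -(b * c) + c * b = 0 := by ring
  have e4 : -(b * b) + c * a = 0 := by linear_combination -h
  rw [conv_rankOne hw, e1, e2, e3, e4]
  apply mat_ext <;> intros <;> simp

/-- Matrices tangent to the hyperbolic space at `X` are orthogonal to `X`. -/
lemma form_tangent_self {X v : Mat F m} (hX : Herm X) (hXX : conv X X = -X)
    (hv : conv X v + conv v X = -v) : hermitianForm F m X v = 0 := by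
  have h := congrArg (fun Z => hermitianForm F m Z X) hv
  simp only [map_add, map_neg, LinearMap.add_apply, LinearMap.neg_apply, form_conv_left hX,
    form_conv_right hX, hXX] at h
  rw [hermitianForm_comm]
  linarith

/-- Pairing the tangency equation with q and moving X across the form kills its left side. -/
lemma form_tangent_eq_zero {X q v : Mat F m} (hX : Herm X) (h1 : conv X q = 0) (h2 : conv q X = 0)
    (hv : conv X v + conv v X = -v) : hermitianForm F m q v = 0 := by
  have h := congrArg (fun Z => hermitianForm F m Z q) hv
  simp only [map_add, map_neg, LinearMap.add_apply, LinearMap.neg_apply, form_conv_left hX,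
    form_conv_right hX, h1, h2, map_zero] at h
  rw [hermitianForm_comm]
  linarith

/-! #### The projection to the line spanned by a vector -/

/-- The orthogonal projection to `w F`, for a unit vector `w`. -/
def lineProj (w : Col F m) : Col F m →ₗ[ℝ] Col F m where
  toFun x := WithLp.toLp 2 fun i => ∑ j, (w i * star (w j)) * x j
  map_add' x y := by
    ext i
    simp [Hurwitz.mul_add, Finset.sum_add_distrib]
  map_smul' c x := by
    ext i
    simp [Hurwitz.mul_smul, Finset.smul_sum]

lemma lineProj_apply (w x : Col F m) (i : Fin m) :
    lineProj w x i = ∑ j, (w i * star (w j)) * x j := rfl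

lemma inner_lineProj (w x y : Col F m) :
    inner ℝ (lineProj w x) y = ∑ i, ∑ j, inner ℝ (w i * star (w j)) (y i * star (x j)) := by
  rw [PiLp.inner_apply]
  refine Finset.sum_congr rfl fun i _ => ?_
  rw [lineProj_apply, sum_inner]
  exact Finset.sum_congr rfl fun j _ => Hurwitz.inner_mul_right _ _ _

lemma lineProj_symm (w x y : Col F m) : inner ℝ (lineProj w x) y = inner ℝ x (lineProj w y) := by
  rw [inner_lineProj, real_inner_comm, inner_lineProj, Finset.sum_comm]
  refine Finset.sum_congr rfl fun i _ => Finset.sum_congr rfl fun j _ => ?_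
  rw [← Hurwitz.inner_star]
  simp only [Hurwitz.star_mul, Hurwitz.star_star]

section Unit

variable {w : Col F m} (hw : ‖w‖ = 1)
include hw

lemma lineProj_self : lineProj w w = w := by
  have hw2 : ∑ i, ‖w i‖ ^ 2 = 1 := by rw [norm_sq_col, hw, one_pow]
  ext i
  simp only [lineProj_apply, Hurwitz.mul_star_mul_self, ← Finset.sum_smul, hw2, one_smul]

lemma lineProj_idem [HurwitzSpace F m] (x : Col F m) :
    lineProj w (lineProj w x) = lineProj w x := by
  have hw2 : ∑ i, ‖w i‖ ^ 2 = 1 := by rw [norm_sq_col, hw, one_pow]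
  ext i
  simp only [lineProj_apply, Hurwitz.mul_sum]
  rw [Finset.sum_comm]
  refine Finset.sum_congr rfl fun k _ => ?_
  have h : ∀ j, (w i * star (w j)) * ((w j * star (w k)) * x k) =
      ‖w j‖ ^ 2 • ((w i * star (w k)) * x k) := fun j => HurwitzSpace.assoc w.ofLp i j k _
  simp only [h, ← Finset.sum_smul, hw2, one_smul]

omit hw in
/-- The projection is determined by each of its coordinates on which `w` does not vanish. -/
lemma norm_sq_smul_lineProj [HurwitzSpace F m] (p : Fin m) (x : Col F m) (i : Fin m) :
    ‖w p‖ ^ 2 • lineProj w x i = (w i * star (w p)) * lineProj w x p := by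
  simp only [lineProj_apply, Hurwitz.mul_sum, Finset.smul_sum]
  exact Finset.sum_congr rfl fun k _ => (HurwitzSpace.assoc w.ofLp i p k _).symm

/-- Where w p ≠ 0, the coordinate p identifies the range with F: the other coordinates are recovered
by `norm_sq_smul_lineProj`, and vectors supported at p reach every value. -/
lemma finrank_range_lineProj [HurwitzSpace F m] :
    Module.finrank ℝ (LinearMap.range (lineProj w)) = Module.finrank ℝ F := by
  obtain ⟨p, hp⟩ : ∃ p, w p ≠ 0 := by
    by_contra! h
    have : w = 0 := by ext i; exact h i
    rw [this, norm_zero] at hw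
    exact zero_ne_one hw
  have hn : ‖w p‖ ^ 2 ≠ 0 := pow_ne_zero 2 (norm_ne_zero_iff.2 hp)
  let π : LinearMap.range (lineProj w) →ₗ[ℝ] F :=
    { toFun := fun x => x.1 p
      map_add' := fun _ _ => rfl
      map_smul' := fun _ _ => rfl }
  refine (LinearEquiv.ofBijective π ⟨?_, fun y => ?_⟩).finrank_eq
  · rw [injective_iff_map_eq_zero]
    rintro ⟨_, x, rfl⟩ h
    have h0 : lineProj w x p = 0 := h
    refine Subtype.ext ?_
    ext i
    have := norm_sq_smul_lineProj (w := w) p x i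
    rw [h0, Hurwitz.mul_zero] at this
    exact (smul_eq_zero.1 this).resolve_left hn
  · refine ⟨⟨_, (‖w p‖ ^ 2)⁻¹ • PiLp.single 2 p y, rfl⟩, ?_⟩
    change lineProj w _ p = y
    rw [map_smul, PiLp.smul_apply, lineProj_apply, Finset.sum_eq_single p]
    · rw [Hurwitz.mul_star_self, Hurwitz.real_mul, smul_smul, inv_mul_cancel₀ hn, one_smul]
      simp
    · intro j _ hj
      simp [hj, Hurwitz.mul_zero]
    · simp

end Unit

/-- `secondForm w w` has no off-diagonal blocks, so only the diagonal blocks of Z enter. For the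
acceleration of a curve these are fixed by the velocity, whatever its tangential part is. -/
lemma form_secondForm (w ξ : Col F m) {Z : Mat F m} (h0 : Z 0 0 = (1 / 2 * ‖ξ‖ ^ 2 : ℝ) • (1 : F))
    (h1 : ∀ i j : Fin m, Z i.succ j.succ = (1 / 2 : ℝ) • (ξ i * star (ξ j))) :
    hermitianForm F m (secondForm w w) Z =
      -1 / 2 * (‖w‖ ^ 2 * ‖ξ‖ ^ 2 + inner ℝ (lineProj w ξ) ξ) := by
  have h2 : ∀ i j, (1 / 4 : ℝ) • (w i * star (w j) + w i * star (w j)) =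
      (1 / 2 : ℝ) • (w i * star (w j)) := fun i j => by module
  rw [hermitianForm_eq, secondForm_apply, inner_lineProj]
  simp only [blockMat_zero_zero, blockMat_zero_succ, blockMat_succ_zero, blockMat_succ_succ, h0, h1,
    h2, Pi.zero_apply, inner_zero_left, Finset.sum_const_zero, real_inner_smul_left,
    real_inner_smul_right, real_inner_self_eq_norm_sq, Hurwitz.norm_one, ← Finset.mul_sum]
  ring

/-- Polar coordinates of the points of the hyperbolic space. -/
lemma IsPoint.exists_polar {X : Mat F m} (hX : IsPoint X) (h : ∃ w : Col F m, ‖w‖ = 1) :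
    ∃ s, 0 ≤ s ∧ ∃ w : Col F m, ‖w‖ = 1 ∧
      X = basePoint F m + Real.sinh s • tangentMat w + (Real.cosh s - 1) • secondForm w w := by
  set a : ℝ := inner ℝ (1 : F) (X 0 0) with ha
  have h1 : 1 ≤ a := hX.one_le
  have h2 : 1 ≤ 2 * a - 1 := by linarith
  -- On the radial curve the corner entry is (1 + cosh s)/2.
  set s := Real.arcosh (2 * a - 1) with hs
  have hs0 : 0 ≤ s := Real.arcosh_nonneg h2
  have hc : Real.cosh s = 2 * a - 1 := Real.cosh_arcosh h2
  have hs1 : 0 ≤ Real.sinh s := Real.sinh_nonneg_iff.2 hs0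
  have hs2 : Real.sinh s ^ 2 = 4 * (a ^ 2 - a) := by rw [Real.sinh_sq, hc]; ring
  let z : Col F m := WithLp.toLp 2 fun i => X i.succ 0
  have hz : ‖z‖ = Real.sinh s / 2 := by
    have h3 : ‖z‖ ^ 2 = (Real.sinh s / 2) ^ 2 := by
      rw [← norm_sq_col, div_pow, hs2]
      exact hX.norm_sum.trans (by ring)
    exact (sq_eq_sq₀ (norm_nonneg z) (by positivity)).1 h3
  obtain ⟨w, hw, hzw⟩ : ∃ w : Col F m, ‖w‖ = 1 ∧ z = (Real.sinh s / 2) • w := by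
    rcases eq_or_ne z 0 with h0 | h0
    · obtain ⟨w, hw⟩ := h
      refine ⟨w, hw, ?_⟩
      rw [← hz, h0, norm_zero, zero_smul]
    · have hn := norm_ne_zero_iff.2 h0
      exact ⟨‖z‖⁻¹ • z, by rw [norm_smul, norm_inv, norm_norm, inv_mul_cancel₀ hn],
        by rw [← hz, smul_smul, mul_inv_cancel₀ hn, one_smul]⟩
  have hi : ∀ i : Fin m, X i.succ 0 = (Real.sinh s / 2) • w i := fun i =>
    congrArg (fun y : Col F m => y i) hzw
  have hj : ∀ j : Fin m, X 0 j.succ = (Real.sinh s / 2) • star (w j) := fun j => by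
    rw [← hX.herm, hi, Hurwitz.star_smul]
  refine ⟨s, hs0, w, hw, ?_⟩
  rw [curve_eq_rankOne w hw]
  refine mat_ext ?_ hj hi fun i j => ?_
  · rw [hX.herm.diag 0, ← ha, hc]
    simp only [rankOne, blockMat_zero_zero]
    congr 1
    ring
  · have h3 := hX.rank_one i.succ j.succ
    have ha0 : a ≠ 0 := by linarith
    rw [← ha, hi, hj, Hurwitz.smul_mul, Hurwitz.mul_smul, smul_smul] at h3
    refine smul_right_injective F ha0 ?_
    simp only [rankOne, blockMat_succ_succ, h3, smul_smul, hc]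
    congr 1
    linear_combination hs2 / 4

end Base

/-! ### The geometry of the hyperbolic spaces -/

lemma ContDiffAt.eventually_hasDerivAt {E : Type*} [NormedAddCommGroup E] [NormedSpace ℝ E]
    {c : ℝ → E} {s : ℝ} (hd : ContDiffAt ℝ 2 c s) : ∀ᶠ u in 𝓝 s, HasDerivAt c (deriv c u) u := by
  filter_upwards [(hd.of_le one_le_two : ContDiffAt ℝ 1 c s).eventually (by simp)] with u hu
  exact (hu.differentiableAt (by simp)).hasDerivAt

lemma ContDiffAt.hasDerivAt_deriv {E : Type*} [NormedAddCommGroup E] [NormedSpace ℝ E]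
    {c : ℝ → E} {s : ℝ} (hd : ContDiffAt ℝ 2 c s) :
    HasDerivAt (deriv c) (deriv (deriv c) s) s :=
  (((hd.fderiv_right (m := 1) (by norm_num)).clm_apply contDiffAt_const).differentiableAt
    (by simp)).hasDerivAt

section Hyperbolic

variable {F : Type} [NormedAddCommGroup F] [InnerProductSpace ℝ F] [Mul F] [One F] [Star F]
  [Hurwitz F] {m : ℕ}

lemma HasDerivAt.conv {c d : ℝ → Mat F m} {c' d' : Mat F m} {s : ℝ} (hc : HasDerivAt c c' s)
    (hd : HasDerivAt d d' s) : HasDerivAt (fun t => conv (c t) (d t))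
      (WeingartenFlow.conv (c s) d' + WeingartenFlow.conv c' (d s)) s := by
  have := finiteDimensional_mat (F := F) (m := m)
  exact (WeingartenFlow.conv (F := F) (m := m)).toContinuousBilinearMap.hasDerivAt_of_bilinear
    (fun _ => hc) fun _ => hd

/-- The conjugate transpose. -/
def adj : Mat F m →ₗ[ℝ] Mat F m where
  toFun X i j := star (X j i)
  map_add' X Y := by ext i j; exact Hurwitz.star_add _ _
  map_smul' c X := by ext i j; exact Hurwitz.star_smul _ _

lemma herm_iff_adj {X : Mat F m} : Herm X ↔ adj X = X :=
  ⟨fun h => funext fun i => funext fun j => h j i, fun h i j => congrFun (congrFun h j) i⟩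

lemma herm_of_hasDerivAt {c : ℝ → Mat F m} {v : Mat F m} {s : ℝ} (hc : ∀ᶠ t in 𝓝 s, Herm (c t))
    (h : HasDerivAt c v s) : Herm v := by
  have := finiteDimensional_mat (F := F) (m := m)
  have h1 := (adj (F := F) (m := m)).toContinuousLinearMap.hasFDerivAt.comp_hasDerivAt s h
  exact herm_iff_adj.2 (h1.unique (h.congr_of_eventuallyEq (hc.mono fun t ht => herm_iff_adj.1 ht)))

lemma conv_of_hasDerivAt {c : ℝ → Mat F m} {v : Mat F m} {s : ℝ}
    (hc : ∀ᶠ t in 𝓝 s, IsPoint (c t)) (h : HasDerivAt c v s) :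
    conv (c s) v + conv v (c s) = -v :=
  (HasDerivAt.conv h h).unique (h.neg.congr_of_eventuallyEq (hc.mono fun _ ht => ht.conv_self))

lemma conv_basePoint_zero (X : Mat F m) (j : Fin (m + 1)) : conv (basePoint F m) X 0 j = -X 0 j := by
  simp [conv_eq, basePoint, Hurwitz.one_mul, Hurwitz.zero_mul, Fin.succ_ne_zero]

lemma conv_basePoint_succ (X : Mat F m) (i : Fin m) (j : Fin (m + 1)) :
    conv (basePoint F m) X i.succ j = 0 := by
  simp [conv_eq, basePoint, Hurwitz.zero_mul, Fin.succ_ne_zero]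

lemma conv_zero_basePoint (X : Mat F m) (i : Fin (m + 1)) : conv X (basePoint F m) i 0 = -X i 0 := by
  simp [conv_eq, basePoint, Hurwitz.mul_one, Hurwitz.mul_zero, Fin.succ_ne_zero]

lemma conv_succ_basePoint (X : Mat F m) (i : Fin (m + 1)) (j : Fin m) :
    conv X (basePoint F m) i j.succ = 0 := by
  simp [conv_eq, basePoint, Hurwitz.mul_zero, Fin.succ_ne_zero]

lemma isPoint_basePoint : IsPoint (basePoint F m) where
  herm i j := by
    by_cases h : i = 0 ∧ j = 0
    · simp [basePoint, h, Hurwitz.star_one]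
    · have h' : ¬(j = 0 ∧ i = 0) := fun h' => h h'.symm
      simp [basePoint, h, h', Hurwitz.star_zero]
  conv_self := by
    apply mat_ext <;> intros <;> simp only [conv_basePoint_zero, conv_basePoint_succ] <;>
      simp [basePoint, Fin.succ_ne_zero]
  trace := by
    rw [Fin.sum_univ_succ]
    simp [basePoint, signature_zero, Fin.succ_ne_zero]
  pos := by
    simp [basePoint, Hurwitz.norm_one]

/-- Multiplication by the base point only touches the zeroth row or column. The tangency equation
therefore kills the diagonal blocks and leaves the off-diagonal ones free. -/
lemma exists_tangentMat {v : Mat F m} (hv : Herm v)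
    (h : conv (basePoint F m) v + conv v (basePoint F m) = -v) : ∃ y, tangentMat y = v := by
  refine ⟨WithLp.toLp 2 fun i => (2 : ℝ) • v i.succ 0, ?_⟩
  have hij : ∀ i j, conv (basePoint F m) v i j + conv v (basePoint F m) i j = -v i j :=
    fun i j => congrFun (congrFun h i) j
  rw [tangentMat_apply]
  refine mat_ext ?_ (fun j => ?_) (fun i => ?_) fun i j => ?_
  · have h0 := hij 0 0
    rw [conv_basePoint_zero, conv_zero_basePoint] at h0
    have h1 : v 0 0 = 0 := by linear_combination (norm := module) -h0
    exact h1.symm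
  · simp only [blockMat_zero_succ, Hurwitz.star_smul, hv j.succ 0]
    module
  · simp only [blockMat_succ_zero]
    module
  · have h0 := hij i.succ j.succ
    rw [conv_basePoint_succ, conv_succ_basePoint] at h0
    have h1 : v i.succ j.succ = 0 := by linear_combination (norm := module) h0
    exact h1.symm

/-- Second derivatives of curves through the base point. -/
lemma second_basePoint {c : ℝ → Mat F m} (hc : ∀ᶠ t in 𝓝 0, IsPoint (c t))
    (h0 : c 0 = basePoint F m) (hd : ContDiffAt ℝ 2 c 0) {y : Col F m}
    (h1 : deriv c 0 = tangentMat y) :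
    Herm (deriv (deriv c) 0) ∧
      deriv (deriv c) 0 0 0 = (1 / 2 * ‖y‖ ^ 2 : ℝ) • (1 : F) ∧
      ∀ i j : Fin m, deriv (deriv c) 0 i.succ j.succ = (1 / 2 : ℝ) • (y i * star (y j)) := by
  have hev := ContDiffAt.eventually_hasDerivAt hd
  have h2 := ContDiffAt.hasDerivAt_deriv hd
  have hherm : Herm (deriv (deriv c) 0) := by
    refine herm_of_hasDerivAt ?_ h2
    filter_upwards [hc.eventually_nhds, hev] with t ht hdt
    exact herm_of_hasDerivAt (ht.mono fun _ h => h.herm) hdt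
  have hev1 : ∀ᶠ t in 𝓝 0, conv (c t) (deriv c t) + conv (deriv c t) (c t) = -deriv c t := by
    filter_upwards [hc.eventually_nhds, hev] with t ht hdt
    exact conv_of_hasDerivAt ht hdt
  -- X J X = -X differentiated twice; on the diagonal blocks this can be solved for the
  -- acceleration.
  have h3 := ((HasDerivAt.conv hev.self_of_nhds h2).add
    (HasDerivAt.conv h2 hev.self_of_nhds)).unique (h2.neg.congr_of_eventuallyEq hev1)
  rw [h0, h1] at h3
  have hij : ∀ i j, conv (basePoint F m) (deriv (deriv c) 0) i j +
      conv (tangentMat y) (tangentMat y) i j + (conv (tangentMat y) (tangentMat y) i j +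
      conv (deriv (deriv c) 0) (basePoint F m) i j) = -deriv (deriv c) 0 i j :=
    fun i j => congrFun (congrFun h3 i) j
  refine ⟨hherm, ?_, fun i j => ?_⟩
  · have h4 := hij 0 0
    have h5 : conv (tangentMat y) (tangentMat y) 0 0 = (1 / 4 * ‖y‖ ^ 2 : ℝ) • (1 : F) := by
      rw [conv_eq, ← norm_sq_col, Finset.mul_sum, Finset.sum_smul]
      simp only [tangentMat_apply, blockMat_zero_zero, blockMat_zero_succ, blockMat_succ_zero,
        Hurwitz.zero_mul, neg_zero, zero_add, Hurwitz.smul_mul, Hurwitz.mul_smul,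
        Hurwitz.star_mul_self, smul_smul]
      refine Finset.sum_congr rfl fun i _ => ?_
      congr 1
      ring
    rw [conv_basePoint_zero, conv_zero_basePoint, h5] at h4
    linear_combination (norm := module) -h4
  · have h4 := hij i.succ j.succ
    have h5 : conv (tangentMat y) (tangentMat y) i.succ j.succ =
        -((1 / 4 : ℝ) • (y i * star (y j))) := by
      rw [conv_eq]
      simp only [tangentMat_apply, blockMat_zero_succ, blockMat_succ_zero, blockMat_succ_succ,
        Pi.zero_apply, Hurwitz.zero_mul, Hurwitz.smul_mul, Hurwitz.mul_smul, smul_smul,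
        Finset.sum_const_zero, add_zero]
      norm_num
    rw [conv_basePoint_succ, conv_succ_basePoint, h5] at h4
    linear_combination (norm := module) h4

lemma form_tangentMat_right {X : Mat F m} (hX : Herm X) (y : Col F m) :
    hermitianForm F m X (tangentMat y) = 2 * ∑ i, inner ℝ (X i.succ 0) (y i) := by
  have h : ∀ j : Fin m, inner ℝ (X 0 j.succ) (star (y j)) = inner ℝ (X j.succ 0) (y j) := fun j => by
    rw [← hX j.succ 0, Hurwitz.inner_star]
  rw [hermitianForm_eq, tangentMat_apply]
  simp only [blockMat_zero_zero, blockMat_zero_succ, blockMat_succ_zero, blockMat_succ_succ,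
    real_inner_smul_right, h, Pi.zero_apply, inner_zero_right, Finset.sum_const_zero,
    ← Finset.mul_sum]
  ring

/-- Testing with the tangent vector built from the first column of X itself shows that the
off-diagonal blocks vanish. -/
lemma eq_secondForm {X : Mat F m} {y : Col F m} (hX : Herm X)
    (h0 : X 0 0 = (1 / 2 * ‖y‖ ^ 2 : ℝ) • (1 : F))
    (h1 : ∀ i j : Fin m, X i.succ j.succ = (1 / 2 : ℝ) • (y i * star (y j)))
    (h2 : ∀ z, hermitianForm F m X (tangentMat z) = 0) : X = secondForm y y := by
  have h3 : ∀ i : Fin m, X i.succ 0 = 0 := fun i => by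
    have h4 := h2 (WithLp.toLp 2 fun i => X i.succ 0)
    rw [form_tangentMat_right hX, mul_eq_zero, or_iff_right two_ne_zero,
      Finset.sum_eq_zero_iff_of_nonneg fun i _ => real_inner_self_nonneg] at h4
    exact inner_self_eq_zero.1 (h4 i (Finset.mem_univ i))
  rw [secondForm_apply, real_inner_self_eq_norm_sq]
  refine mat_ext h0 (fun j => ?_) h3 fun i j => ?_
  · rw [← hX j.succ 0, h3, Hurwitz.star_zero]
    rfl
  · rw [h1, blockMat_succ_succ]
    module

lemma tangentMat_eq_rankOne {w : Col F m} (hw : ‖w‖ = 1) :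
    tangentMat w = rankOne w 0 (1 / 2) 0 := by
  simpa using derivCurve_eq_rankOne w hw 1 0

lemma secondForm_eq_rankOne {w : Col F m} (hw : ‖w‖ = 1) :
    secondForm w w = rankOne w (1 / 2) 0 (1 / 2) := by
  simpa using derivCurve_eq_rankOne w hw 0 1

/-- Expresses the second fundamental form by the base point and the square of a tangent vector, a
formula that every symmetry carries to other points. -/
lemma secondForm_eq [HurwitzSpace F m] {w : Col F m} (hw : ‖w‖ = 1) :
    secondForm w w = basePoint F m - (2 : ℝ) • conv (tangentMat w) (tangentMat w) := by
  have h : basePoint F m = rankOne w 1 0 0 := by simpa using curve_eq_rankOne w hw 0 0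
  rw [secondForm_eq_rankOne hw, h, tangentMat_eq_rankOne hw, conv_rankOne hw]
  apply mat_ext <;> intros <;>
    simp only [rankOne, Pi.sub_apply, Pi.smul_apply, blockMat_zero_zero, blockMat_zero_succ,
      blockMat_succ_zero, blockMat_succ_succ] <;> module

lemma conv_secondForm_tangentMat [HurwitzSpace F m] {w : Col F m} (hw : ‖w‖ = 1) :
    conv (secondForm w w) (tangentMat w) + conv (tangentMat w) (secondForm w w) = 0 := by
  rw [secondForm_eq_rankOne hw, tangentMat_eq_rankOne hw, conv_rankOne hw, conv_rankOne hw]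
  apply mat_ext <;> intros <;>
    simp only [Pi.add_apply, Pi.zero_apply, blockMat_zero_zero, blockMat_zero_succ,
      blockMat_succ_zero, blockMat_succ_succ] <;> module

lemma tangent_hyperbolic {x v : Mat F m} (h : v ∈ (hyperbolic F m).tangent x) :
    Herm v ∧ conv x v + conv v x = -v := by
  obtain ⟨c, hc, rfl, hv⟩ := h
  have hp : ∀ s, IsPoint (c s) := fun s => (mem_carrier_iff _).1 (hc s)
  exact ⟨herm_of_hasDerivAt (c := c) (Eventually.of_forall fun s => (hp s).herm) hv,
    conv_of_hasDerivAt (c := c) (Eventually.of_forall hp) hv⟩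

lemma isPoint_curve [HurwitzSpace F m] {w : Col F m} (hw : ‖w‖ = 1) (s : ℝ) :
    IsPoint (basePoint F m + Real.sinh s • tangentMat w + (Real.cosh s - 1) • secondForm w w) := by
  have h := Real.cosh_sq s
  have h1 := Real.one_le_cosh s
  rw [curve_eq_rankOne w hw]
  exact isPoint_rankOne hw (by ring) (by linear_combination -h / 4) (by linarith)

lemma deriv_curve_eq {E : Type*} [NormedAddCommGroup E] [NormedSpace ℝ E] (x a b : E) :
    (deriv fun s => x + Real.sinh s • a + (Real.cosh s - 1) • b) =
      fun s => Real.cosh s • a + Real.sinh s • b :=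
  funext fun s => ((((Real.hasDerivAt_sinh s).smul_const a).const_add x).add
    (((Real.hasDerivAt_cosh s).sub_const 1).smul_const b)).deriv

lemma deriv_deriv_curve_eq {E : Type*} [NormedAddCommGroup E] [NormedSpace ℝ E] (x a b : E)
    (s : ℝ) : deriv (deriv fun s => x + Real.sinh s • a + (Real.cosh s - 1) • b) s =
      Real.sinh s • a + Real.cosh s • b := by
  rw [deriv_curve_eq]
  exact (((Real.hasDerivAt_cosh s).smul_const a).add ((Real.hasDerivAt_sinh s).smul_const b)).deriv

lemma form_deriv_curve {w : Col F m} (hw : ‖w‖ = 1) (s : ℝ) : hermitianForm F m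
    (deriv (fun s => basePoint F m + Real.sinh s • tangentMat w +
      (Real.cosh s - 1) • secondForm w w) s)
    (deriv (fun s => basePoint F m + Real.sinh s • tangentMat w +
      (Real.cosh s - 1) • secondForm w w) s) = 1 := by
  simp only [deriv_curve_eq]
  rw [derivCurve_eq_rankOne w hw, form_rankOne hw]
  linear_combination Real.cosh_sq s

/-- The acceleration is (x + q)/2, where q is the swapped partner of the point x and annihilates it
on both sides. Both x and q are orthogonal to the vectors v tangent at x. -/
lemma form_deriv_deriv_curve [HurwitzSpace F m] {w : Col F m} (hw : ‖w‖ = 1) (s : ℝ) {v : Mat F m}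
    (hv : conv (basePoint F m + Real.sinh s • tangentMat w + (Real.cosh s - 1) • secondForm w w) v +
      conv v (basePoint F m + Real.sinh s • tangentMat w + (Real.cosh s - 1) • secondForm w w) =
        -v) :
    hermitianForm F m (deriv (deriv fun s => basePoint F m + Real.sinh s • tangentMat w +
      (Real.cosh s - 1) • secondForm w w) s) v = 0 := by
  rw [deriv_deriv_curve_eq]
  have hp := isPoint_curve hw s
  set x := basePoint F m + Real.sinh s • tangentMat w + (Real.cosh s - 1) • secondForm w w with hx
  set q := rankOne w ((Real.cosh s - 1) / 2) (Real.sinh s / 2) (1 + (Real.cosh s - 1) / 2) with hq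
  have h := Real.cosh_sq s
  rw [curve_eq_rankOne w hw] at hx
  have h1 : conv x q = 0 := by
    rw [hx, hq]
    exact conv_rankOne_swap hw (by linear_combination -h / 4)
  have h2 : conv q x = 0 := by
    rw [hx, hq]
    exact conv_rankOne_swap hw (by linear_combination -h / 4)
  have h3 : Real.sinh s • tangentMat w + Real.cosh s • secondForm w w = (1 / 2 : ℝ) • (x + q) := by
    rw [derivCurve_eq_rankOne w hw, hx, hq]
    apply mat_ext <;> intros <;>
      simp only [rankOne, Pi.add_apply, Pi.smul_apply, blockMat_zero_zero, blockMat_zero_succ,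
        blockMat_succ_zero, blockMat_succ_succ] <;> module
  rw [h3, map_smul, map_add, LinearMap.smul_apply, LinearMap.add_apply,
    form_tangent_self hp.herm hp.conv_self hv, form_tangent_eq_zero hp.herm h1 h2 hv]
  simp

variable [HurwitzSpace F m] {n : ℕ} (φ : Euc n ≃ₗᵢ[ℝ] Col F m)

lemma tangentMat_mem_tangent (w : Euc n) :
    tangentMat (φ w) ∈ (hyperbolic F m).tangent (basePoint F m) :=
  Profile.hyperbolic.range_subset_tangent (A := hyperbolic F m)
    (ι := (tangentMat ∘ₗ φ.toLinearEquiv.toLinearMap : Euc n →ₗ[ℝ] Mat F m))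
    (β := fun w => secondForm (φ w) (φ w)) ((mem_carrier_iff _).2 isPoint_basePoint)
    (fun w hw s => (mem_carrier_iff _).2 (isPoint_curve ((φ.norm_map w).trans hw) s)) ⟨w, rfl⟩

/-- Polar coordinates about the base point. -/
def basePolar : Polar (hyperbolic F m) n Profile.hyperbolic (Module.finrank ℝ F)
    (basePoint F m) where
  ι := (tangentMat ∘ₗ φ.toLinearEquiv.toLinearMap : Euc n →ₗ[ℝ] Mat F m)
  β := (secondForm.compl₁₂ φ.toLinearEquiv.toLinearMap φ.toLinearEquiv.toLinearMap :
    Euc n →ₗ[ℝ] Euc n →ₗ[ℝ] Mat F m)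
  K w := φ.symm.toLinearEquiv.toLinearMap ∘ₗ lineProj (φ w) ∘ₗ φ.toLinearEquiv.toLinearMap
  form_ι v w := (form_tangentMat (φ v) (φ w)).trans (φ.inner_map_map v w)
  β_symm v w := secondForm_comm (φ v) (φ w)
  form_β_ι w v := form_secondForm_tangentMat (φ w) (φ w) (φ v)
  tangent_eq := by
    refine Subset.antisymm (fun v hv => ?_) ?_
    · obtain ⟨h1, h2⟩ := tangent_hyperbolic (F := F) (m := m) hv
      obtain ⟨y, hy⟩ := exists_tangentMat h1 h2
      refine ⟨φ.symm y, ?_⟩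
      change tangentMat (φ (φ.symm y)) = v
      rw [φ.apply_symm_apply]
      exact hy
    · rintro _ ⟨w, rfl⟩
      exact tangentMat_mem_tangent φ w
  sff c hc h0 hd w ξ h1 := by
    obtain ⟨-, h2, h3⟩ := second_basePoint (F := F) (m := m) (c := c) (y := φ ξ)
      (hc.mono fun s hs => (mem_carrier_iff _).1 hs) h0 hd h1
    have h4 := form_secondForm (φ w) (φ ξ) h2 h3
    rw [φ.norm_map, φ.norm_map] at h4
    refine h4.trans ?_
    congr 2
    change _ = inner ℝ (φ.symm (lineProj (φ w) (φ ξ))) ξ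
    rw [← φ.inner_map_map, φ.apply_symm_apply]
  K_symm w ξ η := by
    change inner ℝ (φ.symm (lineProj (φ w) (φ ξ))) η = inner ℝ ξ (φ.symm (lineProj (φ w) (φ η)))
    rw [← φ.inner_map_map, ← φ.inner_map_map ξ, φ.apply_symm_apply, φ.apply_symm_apply,
      lineProj_symm]
  K_self w hw := by
    change φ.symm (lineProj (φ w) (φ w)) = w
    rw [lineProj_self ((φ.norm_map w).trans hw), φ.symm_apply_apply]
  K_idem w hw ξ := by
    change φ.symm (lineProj (φ w) (φ (φ.symm (lineProj (φ w) (φ ξ))))) =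
      φ.symm (lineProj (φ w) (φ ξ))
    rw [φ.apply_symm_apply, lineProj_idem ((φ.norm_map w).trans hw)]
  K_rank w hw := by
    rw [LinearMap.range_comp, LinearMap.range_comp_of_range_eq_top _ φ.toLinearEquiv.range,
      ← finrank_range_lineProj ((φ.norm_map w).trans hw)]
    exact LinearEquiv.finrank_map_eq φ.symm.toLinearEquiv _
  isGeodesic w hw := by
    have hw' : ‖φ w‖ = 1 := (φ.norm_map w).trans hw
    refine ⟨Profile.hyperbolic.contDiff_curve (A := hyperbolic F m) _ _ _,
      fun s => (mem_carrier_iff _).2 (isPoint_curve hw' s), fun s => ?_, fun s v hv => ?_⟩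
    · exact form_deriv_curve hw' s
    · exact form_deriv_deriv_curve hw' s (tangent_hyperbolic (F := F) (m := m) hv).2
  geodesic_second γ hγ h0 w h1 := by
    have hp : ∀ s, IsPoint (F := F) (m := m) (γ s) := fun s => (mem_carrier_iff _).1 (hγ.mem s)
    obtain ⟨h2, h3, h4⟩ := second_basePoint (F := F) (m := m) (c := γ) (y := φ w)
      (Eventually.of_forall hp) h0 (hγ.smooth.contDiffAt.of_le (by norm_cast)) h1
    refine eq_secondForm h2 h3 h4 fun z => hγ.geodesic 0 _ ?_
    have hz : tangentMat (φ (φ.symm z)) ∈ (hyperbolic F m).tangent (basePoint F m) :=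
      tangentMat_mem_tangent φ _
    rw [φ.apply_symm_apply] at hz
    rw [h0]
    exact hz
  surj y hy := by
    obtain ⟨s, hs, w, hw, h⟩ := ((mem_carrier_iff (F := F) (m := m) y).1 hy).exists_polar
      ⟨φ (EuclideanSpace.single 0 1), by rw [φ.norm_map]; simp⟩
    refine ⟨s, hs, φ.symm w, (φ.symm.norm_map w).trans hw, h.trans ?_⟩
    change _ = basePoint F m + Real.sinh s • tangentMat (φ (φ.symm w)) +
      (Real.cosh s - 1) • secondForm (φ (φ.symm w)) (φ (φ.symm w))
    rw [φ.apply_symm_apply]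

omit φ in
lemma exists_linearEquiv {x : Mat F m} (hx : IsPoint x) : ∃ L : Mat F m ≃L[ℝ] Mat F m,
    IsSymmetry L.toLinearEquiv.toLinearMap ∧ (∀ y, IsPoint (L y) ↔ IsPoint y) ∧
      L x = basePoint F m := by
  have := finiteDimensional_mat (F := F) (m := m)
  obtain ⟨g, g', hg, hg', h1, h2, h3⟩ := exists_symmetry hx
  let e : Mat F m ≃ₗ[ℝ] Mat F m := LinearEquiv.ofLinearMap g g' (LinearMap.ext h1) (LinearMap.ext h2)
  refine ⟨e.toContinuousLinearEquiv, hg, fun y => ⟨fun h => ?_, hg.point y⟩, h3⟩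
  have h4 := hg'.point _ h
  rwa [show g' (e.toContinuousLinearEquiv y) = y from h2 y] at h4

omit φ [HurwitzSpace F m] in
lemma isIsometry_of_isSymmetry {L : Mat F m ≃L[ℝ] Mat F m}
    (h1 : IsSymmetry L.toLinearEquiv.toLinearMap) (h2 : ∀ y, IsPoint (L y) ↔ IsPoint y) :
    (hyperbolic F m).IsIsometry L :=
  ⟨h1.form, fun y => (mem_carrier_iff _).trans ((h2 y).trans (mem_carrier_iff _).symm)⟩

-- The equation γ'' = γ - 2 γ' J γ' involves only the point and a Jordan square, so it can be
-- checked after a symmetry has moved γ s to the base point. The same holds for the vanishing Jordan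
-- product of γ' and γ''.
include φ in
lemma geodesic_hyperbolic {γ : ℝ → Mat F m} (hγ : (hyperbolic F m).IsUnitGeodesic γ) (s : ℝ) :
    deriv (deriv γ) s = γ s - (2 : ℝ) • conv (deriv γ s) (deriv γ s) ∧
      conv (deriv γ s) (deriv (deriv γ) s) + conv (deriv (deriv γ) s) (deriv γ s) = 0 := by
  have hp : ∀ s, IsPoint (γ s) := fun s => (mem_carrier_iff _).1 (hγ.mem s)
  obtain ⟨L, hS, hP, hx⟩ := exists_linearEquiv (hp s)
  have hI := isIsometry_of_isSymmetry hS hP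
  have hδ : (hyperbolic F m).IsUnitGeodesic fun t => L (γ (t + s)) :=
    hI.isUnitGeodesic (hγ.shift s)
  have e0 : L (γ (0 + s)) = basePoint F m := by rw [zero_add, hx]
  have e1 : (deriv fun t => L (γ (t + s))) = fun t => L (deriv γ (t + s)) := by
    rw [deriv_continuousLinearEquiv]
    exact funext fun t => congrArg L (deriv_comp_add_const γ s t)
  have e2 : deriv (deriv fun t => L (γ (t + s))) 0 = L (deriv (deriv γ) s) := by
    rw [e1, deriv_continuousLinearEquiv]
    exact congrArg L ((deriv_comp_add_const (deriv γ) s 0).trans (by rw [zero_add]))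
  have e3 : deriv (fun t => L (γ (t + s))) 0 = L (deriv γ s) := by
    rw [e1]
    exact congrArg (fun t => L (deriv γ t)) (zero_add s)
  have h1 := tangent_hyperbolic (hδ.deriv_mem_tangent 0)
  have h2 : conv (basePoint F m) (L (deriv γ s)) + conv (L (deriv γ s)) (basePoint F m) =
      -L (deriv γ s) := by
    rw [← e0, ← e3]
    exact h1.2
  have h3 : Herm (L (deriv γ s)) := by
    rw [← e3]
    exact h1.1
  obtain ⟨y, hy⟩ := exists_tangentMat h3 h2
  have hu : ‖y‖ = 1 := by
    have h4 : hermitianForm F m (L (deriv γ s)) (L (deriv γ s)) = 1 :=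
      (hS.form _ _).trans (hγ.unit s)
    rw [← hy, form_tangentMat, real_inner_self_eq_norm_sq] at h4
    exact (pow_eq_one_iff_of_nonneg (norm_nonneg _) two_ne_zero).1 h4
  have h5 : L (deriv (deriv γ) s) = secondForm y y := by
    have h6 : deriv (deriv fun t => L (γ (t + s))) 0 =
        secondForm (φ (φ.symm y)) (φ (φ.symm y)) :=
      (basePolar φ).geodesic_second _ hδ e0 (φ.symm y) (e3.trans (by
        change _ = tangentMat (φ (φ.symm y))
        rw [φ.apply_symm_apply, hy]))
    rw [← e2, h6, φ.apply_symm_apply]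
  have g1 := (tangent_hyperbolic (F := F) (m := m) (hγ.deriv_mem_tangent s)).1
  have g2 : Herm (deriv (deriv γ) s) := by
    have hs : ContDiff ℝ 2 γ := (show ContDiff ℝ ∞ γ from hγ.smooth).of_le (by norm_cast)
    exact herm_of_hasDerivAt (Eventually.of_forall fun t =>
      (tangent_hyperbolic (F := F) (m := m) (hγ.deriv_mem_tangent t)).1)
      (ContDiffAt.hasDerivAt_deriv hs.contDiffAt)
  constructor
  · apply L.injective
    have h6 : L (conv (deriv γ s) (deriv γ s)) = conv (tangentMat y) (tangentMat y) := by
      rw [hy]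
      exact (hS.conv_self _ g1).symm
    rw [map_sub, map_smul, h5, h6, hx, secondForm_eq hu]
  · apply L.injective
    have h6 := (hS.conv_add g1 g2).symm
    change L (conv (deriv γ s) (deriv (deriv γ) s) + conv (deriv (deriv γ) s) (deriv γ s)) =
      conv (L (deriv γ s)) (L (deriv (deriv γ) s)) +
        conv (L (deriv (deriv γ) s)) (L (deriv γ s)) at h6
    rw [h6, ← hy, h5, add_comm, conv_secondForm_tangentMat hu, map_zero]

-- When the second-order equation is differentiated, the derivative of the square is the Jordan
-- product that vanishes.
include φ in
lemma geodesic_hyperbolic_third {γ : ℝ → Mat F m} (hγ : (hyperbolic F m).IsUnitGeodesic γ) (s : ℝ) :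
    deriv (deriv (deriv γ)) s = deriv γ s := by
  have h1 : deriv (deriv γ) = fun s => γ s - (2 : ℝ) • conv (deriv γ s) (deriv γ s) :=
    funext fun s => (geodesic_hyperbolic φ hγ s).1
  have hs : ContDiff ℝ 2 γ := (show ContDiff ℝ ∞ γ from hγ.smooth).of_le (by norm_cast)
  have h2 := ContDiffAt.hasDerivAt_deriv hs.contDiffAt (s := s)
  have h3 := (hs.differentiable (by norm_num) s).hasDerivAt
  have h4 := h3.sub ((HasDerivAt.conv h2 h2).const_smul (2 : ℝ))
  rw [(geodesic_hyperbolic φ hγ s).2, smul_zero, sub_zero] at h4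
  exact (congrArg (fun f => deriv f s) h1).trans h4.deriv

/-- The geometry of the hyperbolic spaces. -/
def hyperbolicGeometry : Geometry (hyperbolic F m) n where
  profile := Profile.hyperbolic
  d := Module.finrank ℝ F
  finiteDimensional := finiteDimensional_mat
  symm := hermitianForm_comm
  one_le_d := by
    have := Hurwitz.finiteDimensional (F := F)
    have h : (1 : F) ≠ 0 := fun h => by simpa [h] using Hurwitz.norm_one (F := F)
    have : Nontrivial F := ⟨1, 0, h⟩
    exact Module.finrank_pos
  d_le := by
    -- The dimension of F is the rank of a projection in ℝ^(n+1).
    have h := (basePolar φ).K_rank (EuclideanSpace.single 0 1) (by simp)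
    rw [← h]
    refine (Submodule.finrank_le _).trans_eq ?_
    simp
  d_eq := Or.inl (by simp [Profile.hyperbolic])
  third γ hγ s := by
    have h : -Profile.hyperbolic.κ = 1 := neg_neg 1
    rw [h, one_smul]
    exact geodesic_hyperbolic_third φ hγ s
  polar x hx := by
    have hx' := (mem_carrier_iff (F := F) (m := m) x).1 hx
    have hL := (exists_linearEquiv hx').choose_spec
    refine (isIsometry_of_isSymmetry hL.1 hL.2.1).polar (x := x) ?_
    have key : ∀ y : (hyperbolic F m).V, y = basePoint F m →
        Polar (hyperbolic F m) n Profile.hyperbolic (Module.finrank ℝ F) y :=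
      fun y hy => by subst hy; exact basePolar φ
    exact key _ hL.2.2

end Hyperbolic

/-- The column space F^m has real dimension n + 1, so an orthonormal basis identifies it with
ℝ^(n+1). -/
lemma exists_geometry_hyperbolic {F : Type} [NormedAddCommGroup F] [InnerProductSpace ℝ F] [Mul F]
    [One F] [Star F] [Hurwitz F] {m n : ℕ} [HurwitzSpace F m]
    (h : n + 1 = Module.finrank ℝ F * m) :
    ∃ G : Geometry (hyperbolic F m) n, G.profile = Profile.hyperbolic := by
  have := Hurwitz.finiteDimensional (F := F)
  have h1 : Module.finrank ℝ (Col F m) = n + 1 := by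
    rw [(WithLp.linearEquiv 2 ℝ (Fin m → F)).finrank_eq]
    simp [h, Module.finrank_pi_fintype, mul_comm]
  exact ⟨hyperbolicGeometry ((stdOrthonormalBasis ℝ (Col F m)).reindex (finCongr h1)).repr.symm, rfl⟩

/-- All the model spaces have geodesic polar coordinates. -/
lemma exists_geometry {n : ℕ} (X : ModelSpace n) {R : ℝ} (hR : X.IsConvexRadius R) :
    ∃ G : Geometry X.ambient n, R ∈ G.profile.I := by
  have key : ∀ {A : Ambient}, (∃ G : Geometry A n, G.profile = Profile.hyperbolic) → 0 < R →
      ∃ G : Geometry A n, R ∈ G.profile.I := fun ⟨G, hG⟩ h => ⟨G, by rw [hG]; exact h⟩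
  cases X with
  | euclidean => exact ⟨euclideanGeometry n, hR⟩
  | sphere =>
    obtain ⟨G, hG⟩ := exists_geometry_sphere n
    exact ⟨G, by rw [hG]; exact hR⟩
  | realHyperbolic => exact key (exists_geometry_realHyperbolic n) hR
  | complexHyperbolic m h =>
    exact key (exists_geometry_hyperbolic (F := ℂ) (by rw [Complex.finrank_real_complex, h])) hR
  | quaternionicHyperbolic m h =>
    exact key (exists_geometry_hyperbolic (F := ℍ[ℝ]) (by rw [Quaternion.finrank_eq_four, h])) hR
  | cayleyHyperbolic h =>
    refine key (exists_geometry_hyperbolic (F := Octonion) ?_) hR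
    have : Module.finrank ℝ Octonion = 8 := by
      change Module.finrank ℝ (WithLp 2 (ℍ[ℝ] × ℍ[ℝ])) = 8
      rw [(WithLp.linearEquiv 2 ℝ (ℍ[ℝ] × ℍ[ℝ])).finrank_eq, Module.finrank_prod,
        Quaternion.finrank_eq_four]
    rw [this, h]

end WeingartenFlow

end

/-! ### The theorem for the concrete model spaces. -/

theorem mainTheorem6 {n : ℕ} (hn : 1 ≤ n) (X : WeingartenFlow.ModelSpace n)
    {M : Type*} [TopologicalSpace M] [ChartedSpace (EuclideanSpace ℝ (Fin n)) M]
    [IsManifold (𝓡 n) ∞ M] [T2Space M] [CompactSpace M] [Nonempty M]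
    (Γ : Set (Fin n → ℝ)) (W : (Fin n → ℝ) → ℝ) (hW : WeingartenFlow.IsWeingarten Γ W)
    (T : EReal) (hT : 0 < T) (F N : ℝ → M → X.ambient.V)
    (hF : WeingartenFlow.IsWFlow X.ambient Γ W T F N)
    (o : X.ambient.V) (ho : o ∈ X.ambient.carrier) (R : ℝ) (hR : X.IsConvexRadius R)
    (hball : Set.range (F 0) ⊆ X.ambient.geodesicBall o R)
    (horient : WeingartenFlow.IsOdd Γ W ∨
      ∀ t ∈ WeingartenFlow.timeInterval T, Topology.IsEmbedding (F t) ∧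
        (Set.range (F t) ⊆ X.ambient.geodesicBall o R →
          WeingartenFlow.IsInward X.ambient (X.ambient.geodesicBall o R) (F t) (N t))) :
    (∃ T_R φ P ν, WeingartenFlow.IsMaximalSphericalFlow X.ambient Γ W o R T_R φ P ν) ∧
    ∀ T_R φ P ν, WeingartenFlow.IsMaximalSphericalFlow X.ambient Γ W o R T_R φ P ν →
      (∀ t ∈ WeingartenFlow.timeInterval T,
        Disjoint (Set.range (F t)) (Set.range (P t))) ∧
      T ≤ T_R ∧ T_R < ⊤ := by
  obtain ⟨G, hG⟩ := WeingartenFlow.exists_geometry X hR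
  exact WeingartenFlow.main_of_geometry hn G hW hF ho hG hball horient
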